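/- Let $A:\mathbb R^2\to\mathbb C$ be continuous with $\limsup_{p\to\infty}|A(p)|/p^2<1$, and let $H_0$ be the self-adjoint operator in $L^2(\mathbb R^2)\otimes\mathbb C^2$ that acts in Fourier space as multiplication by $$\widehat H_0(p)=\begin{pmatrix}p^2&A(p)\\ \overline{A(p)}&p^2\end{pmatrix}.$$ Put $\kappa=\inf_{p}\,(p^2-|A(p)|)$ and $S=\{p\in\mathbb R^2: p^2-|A(p)|=\kappa\}$, and let $\#S\in\mathbb N\cup\{\infty\}$ be the number of points of $S$ ($\infty$ if $S$ is infinite). Assume that $|A|$ is of class $C^2$ in a neighbourhood of $S$. Let $m$ be a finite positive Borel measure on $\mathbb R^2$ and $h:\mathbb R^2\to\mathbb R$ a bounded Borel function such that, for some $a\in(0,1)$ and $b>0$, $$\int(1+|h|^2)|f|^2\,dm\le a\int|\nabla f|^2\,dx+b\int|f|^2\,dx\qquad\text{for all Schwartz functions } f,$$ and put $\nu=hm$. Let $J:H^1(\mathbb R^2)\to L^2(\mathbb R^2,m)$ be the continuous extension of $f\mapsto f$, $f$ Schwartz, and $J_2=J\otimes 1$. Let $q(u,v)=q_0(u,v)+\int\langle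 J_2u,J_2v\rangle_{\mathbb C^2}\,d\nu$ on $H^1(\mathbb R^2)\otimes\mathbb C^2$, where $q_0$ is the sesquilinear form of $H_0$. Assume that the form $\int\langle J_2u,J_2v\rangle\,d\nu$ is bounded relative to $q_0$ with relative bound less than $1$ (for $\nu\le 0$ this is equivalent to $q$ being closed and semibounded from below), and let $H=H_0+\nu$ be the self-adjoint operator associated with $q$. If $\nu\le0$ and $\operatorname{supp}\nu$ has positive Lebesgue measure, then $H$ has at least $\#S$ eigenvalues below $\kappa$, counted with multiplicity; if $S$ is infinite, then $H$ has infinitely many distinct eigenvalues below $\kappa$. In particular, for every real $\alpha\neq0$ and every such $\nu$, the operator $H_0+\nu$ has infinitely many distinct eigenvalues below $\kappa$ if $H_0$ is the Rashba Hamiltonian ($A(p)=\alpha(p_y+ip_x)$) or the Dresselhaus Hamiltonian ($A(p)=-\alpha(p_x+ip_y)$); here the relative bound and the $C^2$ condition hold automatically. -/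

import Mathlib

open MeasureTheory Filter Topology
open scoped FourierTransform LineDeriv SchwartzMap ENNReal

noncomputable section

namespace SpinOrbit

/-- The Euclidean plane `ℝ²`. -/
abbrev Plane : Type := EuclideanSpace ℝ (Fin 2)

/-- The scalar space `L²(ℝ²)`. -/
abbrev L2 : Type := Lp (α := Plane) ℂ 2 volume

/-- The Hilbert space `L²(ℝ²) ⊗ ℂ²` of two-dimensional spinors. -/
abbrev Spinor : Type := PiLp 2 (fun _ : Fin 2 => L2)

/-! ### The Sobolev space `H¹(ℝ²)` -/

/-- The Sobolev space `H¹(ℝ²)`, realised as the space of all `(f, g₀, g₁)` with `f ∈ L²` and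
`gᵢ = ∂ᵢ f ∈ L²`; the partial derivative is expressed by `(𝓕 gᵢ)(ξ) = 2πi ξᵢ (𝓕 f)(ξ)`, where
`(𝓕 f)(ξ) = ∫ exp (-2πi ⟨ξ, x⟩) f(x) dx`. The norm inherited from the ambient Hilbert space is
`‖f‖² + ‖∂₀ f‖² + ‖∂₁ f‖²`. -/
def H1 : Submodule ℂ (WithLp 2 (L2 × PiLp 2 (fun _ : Fin 2 => L2))) where
  carrier := {u | ∀ i : Fin 2, ∀ᵐ ξ : Plane,
    (𝓕 (u.snd i) : L2) ξ = (2 * Real.pi * ξ i * Complex.I : ℂ) * (𝓕 u.fst : L2) ξ}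
  zero_mem' := by
    intro i
    have h0 : (𝓕 (0 : L2) : L2) = 0 := (Lp.fourierTransformₗᵢ Plane ℂ).map_zero
    simp only [WithLp.zero_fst, WithLp.zero_snd, PiLp.zero_apply, h0]
    filter_upwards [Lp.coeFn_zero ℂ 2 (volume : Measure Plane)] with ξ hξ
    rw [hξ, Pi.zero_apply, mul_zero]
  add_mem' := by
    intro u v hu hv i
    simp only [WithLp.add_fst, WithLp.add_snd, PiLp.add_apply, FourierTransform.fourier_add]
    filter_upwards [hu i, hv i, Lp.coeFn_add (𝓕 (u.snd i) : L2) (𝓕 (v.snd i)),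
      Lp.coeFn_add (𝓕 u.fst : L2) (𝓕 v.fst)] with ξ h1 h2 h3 h4
    rw [h3, h4, Pi.add_apply, Pi.add_apply, h1, h2, mul_add]
  smul_mem' := by
    intro c u hu i
    simp only [WithLp.smul_fst, WithLp.smul_snd, PiLp.smul_apply, FourierTransform.fourier_smul]
    filter_upwards [hu i, Lp.coeFn_smul c (𝓕 (u.snd i) : L2),
      Lp.coeFn_smul c (𝓕 u.fst : L2)] with ξ h1 h3 h4
    rw [h3, h4, Pi.smul_apply, Pi.smul_apply, h1, smul_eq_mul, smul_eq_mul]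
    ring

/-- The inclusion `H¹(ℝ²) → L²(ℝ²)`. -/
def H1.toL2 : H1 →ₗ[ℂ] L2 where
  toFun u := u.1.fst
  map_add' _ _ := rfl
  map_smul' _ _ := rfl

/-- The `i`-th partial derivative `H¹(ℝ²) → L²(ℝ²)`. -/
def H1.deriv (i : Fin 2) : H1 →ₗ[ℂ] L2 where
  toFun u := u.1.snd i
  map_add' _ _ := rfl
  map_smul' _ _ := rfl

/-- The `i`-th standard basis vector of the plane. -/
abbrev e (i : Fin 2) : Plane := EuclideanSpace.single i 1

/-- The inclusion `𝓢(ℝ²) → H¹(ℝ²)`, `φ ↦ (φ, ∂₀ φ, ∂₁ φ)`. -/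
def schwartzToH1 : 𝓢(Plane, ℂ) →ₗ[ℂ] H1 where
  toFun φ := ⟨WithLp.toLp 2 ((φ.toLp 2 : L2), WithLp.toLp 2 fun i : Fin 2 =>
      ((∂_{e i} φ : 𝓢(Plane, ℂ)).toLp 2 : L2)), by
    intro i
    change ∀ᵐ ξ : Plane, (𝓕 ((∂_{e i} φ : 𝓢(Plane, ℂ)).toLp 2 : L2) : L2) ξ =
      (2 * Real.pi * ξ i * Complex.I : ℂ) * (𝓕 (φ.toLp 2 : L2) : L2) ξ
    rw [SchwartzMap.toLp_fourier_eq, SchwartzMap.toLp_fourier_eq]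
    filter_upwards [(𝓕 φ).coeFn_toLp 2 volume,
      (𝓕 (∂_{e i} φ : 𝓢(Plane, ℂ))).coeFn_toLp 2 volume] with ξ h1 h2
    rw [h1, h2, SchwartzMap.fourier_lineDerivOp_eq]
    have hg : Function.HasTemperateGrowth (fun x : Plane => inner ℝ x (e i)) := by fun_prop
    rw [smul_apply, SchwartzMap.smulLeftCLM_apply_apply hg]
    simp [EuclideanSpace.inner_single_right]
    ring⟩
  map_add' φ ψ := by
    apply Subtype.ext
    simp only [LineDeriv.lineDerivOp_add]
    rfl
  map_smul' c φ := by
    apply Subtype.ext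
    simp only [LineDeriv.lineDerivOp_smul]
    rfl

theorem L2_norm_sq {μ : Measure Plane} (f : Lp (α := Plane) ℂ 2 μ) :
    ‖f‖ ^ 2 = ∫ x, ‖f x‖ ^ 2 ∂μ := by
  have h := congrArg RCLike.re (L2.inner_def (𝕜 := ℂ) f f)
  rw [inner_self_eq_norm_sq, ← integral_re (L2.integrable_inner f f)] at h
  simpa only [inner_self_eq_norm_sq] using h

theorem L2_integrable_sq {μ : Measure Plane} (f : Lp (α := Plane) ℂ 2 μ) :
    Integrable (fun x => ‖f x‖ ^ 2) μ :=
  (memLp_two_iff_integrable_sq_norm (Lp.aestronglyMeasurable f)).mp (Lp.memLp f)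

/-- The weight `1 + |p|²` at `p = 2πξ`. -/
def weight (ξ : Plane) : NNReal := 1 + ⟨(2 * Real.pi * ‖ξ‖) ^ 2, sq_nonneg _⟩

theorem continuous_weight : Continuous weight := by
  unfold weight
  fun_prop

theorem H1.ae_weight (u : H1) : (fun ξ : Plane => (weight ξ : ℝ) * ‖(𝓕 (H1.toL2 u) : L2) ξ‖ ^ 2) =ᵐ[volume]
    fun ξ => ‖(𝓕 (H1.toL2 u) : L2) ξ‖ ^ 2 + ∑ k : Fin 2, ‖(𝓕 (H1.deriv k u) : L2) ξ‖ ^ 2 := by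
  have hu : ∀ᵐ ξ : Plane, ∀ k : Fin 2, (𝓕 (H1.deriv k u) : L2) ξ =
      (2 * Real.pi * ξ k * Complex.I : ℂ) * (𝓕 (H1.toL2 u) : L2) ξ :=
    ae_all_iff.mpr u.2
  filter_upwards [hu] with ξ h1
  have hpi : ‖(Real.pi : ℂ)‖ = Real.pi := by simp [abs_of_pos Real.pi_pos]
  have hw : (weight ξ : ℝ) = 1 + (2 * Real.pi * ‖ξ‖) ^ 2 := rfl
  simp only [h1, hw, norm_mul, hpi, Complex.norm_I, Complex.norm_real, Real.norm_eq_abs,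
      Complex.norm_ofNat, mul_one, Fin.sum_univ_two, mul_pow, EuclideanSpace.norm_sq_eq, sq_abs]
  ring

theorem H1.integrable_weight (u : H1) :
    Integrable fun ξ : Plane => (weight ξ : ℝ) * ‖(𝓕 (H1.toL2 u) : L2) ξ‖ ^ 2 :=
  ((L2_integrable_sq _).add (integrable_finsetSum _ fun _ _ => L2_integrable_sq _)).congr
    (H1.ae_weight u).symm

theorem H1.norm_sq (u : H1) :
    ‖u‖ ^ 2 = ∫ ξ : Plane, (weight ξ : ℝ) * ‖(𝓕 (H1.toL2 u) : L2) ξ‖ ^ 2 := by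
  rw [integral_congr_ae (H1.ae_weight u), integral_add (L2_integrable_sq _)
    (integrable_finsetSum _ fun _ _ => L2_integrable_sq _),
    integral_finsetSum _ fun _ _ => L2_integrable_sq _]
  simp only [← L2_norm_sq, Lp.norm_fourier_eq]
  rw [show ‖u‖ = ‖u.1‖ from rfl, WithLp.prod_norm_sq_eq_of_L2, PiLp.norm_sq_eq_of_L2]
  rfl

/-- Schwartz functions are dense in `H¹`. -/
theorem denseRange_schwartzToH1 : DenseRange schwartzToH1 := by
  set μ : Measure Plane := volume.withDensity fun ξ => (weight ξ : ℝ≥0∞) with hμ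
  have : IsLocallyFiniteMeasure μ :=
    IsLocallyFiniteMeasure.withDensity_coe continuous_weight
  have : μ.HasTemperateGrowth := by
    refine ⟨6, ?_⟩
    rw [hμ, integrable_withDensity_iff_integrable_coe_smul continuous_weight.measurable]
    have h0 : Integrable fun x : Plane => ((1 + (2 * Real.pi) ^ 2) * (1 + ‖x‖) ^ (-(4 : ℝ))) :=
      (integrable_one_add_norm (by simp; norm_num)).const_mul _
    refine h0.mono' ?_ (Eventually.of_forall fun x => ?_)
    · refine Continuous.aestronglyMeasurable ?_
      refine (NNReal.continuous_coe.comp continuous_weight).smul ?_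
      exact (continuous_const.add continuous_norm).rpow_const fun x =>
        Or.inl (show (1 : ℝ) + ‖x‖ ≠ 0 from ne_of_gt (by positivity))
    · have hw : (weight x : ℝ) = 1 + (2 * Real.pi * ‖x‖) ^ 2 := rfl
      have hx : 0 < 1 + ‖x‖ := by positivity
      have h6 : (1 + ‖x‖) ^ (-((6 : ℕ) : ℝ)) * (1 + ‖x‖) ^ 2 = (1 + ‖x‖) ^ (-(4 : ℝ)) := by
        rw [← Real.rpow_natCast (1 + ‖x‖) 2, ← Real.rpow_add hx]
        norm_num
      rw [norm_smul, Real.norm_of_nonneg (by positivity), Real.norm_of_nonneg (by positivity), hw,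
        ← h6, mul_comm, mul_left_comm]
      refine mul_le_mul_of_nonneg_left ?_ (by positivity)
      nlinarith [norm_nonneg x, sq_nonneg (2 * Real.pi), mul_nonneg (sq_nonneg (2 * Real.pi)) (norm_nonneg x)]
  intro u
  refine Metric.mem_closure_iff.mpr fun ε hε => ?_
  have hmeas : AEStronglyMeasurable (𝓕 (H1.toL2 u) : L2) μ :=
    (Lp.aestronglyMeasurable _).mono_ac (withDensity_absolutelyContinuous _ _)
  have hmem : MemLp (𝓕 (H1.toL2 u) : L2) 2 μ := by
    rw [memLp_two_iff_integrable_sq_norm hmeas, hμ,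
      integrable_withDensity_iff_integrable_coe_smul continuous_weight.measurable]
    exact H1.integrable_weight u
  have hd : DenseRange (SchwartzMap.toLpCLM ℝ (E := Plane) ℂ 2 μ) :=
    SchwartzMap.denseRange_toLpCLM ENNReal.ofNat_ne_top
  obtain ⟨ψ, hψ⟩ := hd.exists_dist_lt (hmem.toLp _) hε
  refine ⟨_, ⟨𝓕⁻ ψ, rfl⟩, ?_⟩
  refine lt_of_le_of_lt (le_of_eq ?_) hψ
  rw [dist_eq_norm, dist_eq_norm, ← sq_eq_sq₀ (norm_nonneg _) (norm_nonneg _), H1.norm_sq,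
    L2_norm_sq]
  have h1 : ∀ᵐ ξ ∂μ, (hmem.toLp _ - SchwartzMap.toLpCLM ℝ (E := Plane) ℂ 2 μ ψ : Lp (α := Plane) ℂ 2 μ) ξ =
      (𝓕 (H1.toL2 u) : L2) ξ - ψ ξ := by
    filter_upwards [Lp.coeFn_sub (hmem.toLp _) (SchwartzMap.toLpCLM ℝ (E := Plane) ℂ 2 μ ψ),
      hmem.coeFn_toLp, ψ.coeFn_toLp 2 μ] with ξ h2 h3 h4
    rw [h2, Pi.sub_apply, h3, SchwartzMap.toLpCLM_apply, h4]
  have h5 : ∀ᵐ ξ : Plane, (𝓕 (H1.toL2 (u - schwartzToH1 (𝓕⁻ ψ))) : L2) ξ =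
      (𝓕 (H1.toL2 u) : L2) ξ - ψ ξ := by
    have h6 : (𝓕 (H1.toL2 (schwartzToH1 (𝓕⁻ ψ))) : L2) = ψ.toLp 2 := by
      change (𝓕 ((𝓕⁻ ψ : 𝓢(Plane, ℂ)).toLp 2 : L2) : L2) = _
      rw [SchwartzMap.toLp_fourier_eq, FourierTransform.fourier_fourierInv_eq]
    rw [map_sub, show (𝓕 (H1.toL2 u - H1.toL2 (schwartzToH1 (𝓕⁻ ψ))) : L2) = _ from
      (Lp.fourierTransformₗᵢ Plane ℂ).map_sub _ _]
    filter_upwards [Lp.coeFn_sub (𝓕 (H1.toL2 u) : L2) (𝓕 (H1.toL2 (schwartzToH1 (𝓕⁻ ψ)))),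
      ψ.coeFn_toLp 2 volume] with ξ h7 h8
    rw [← h8, ← h6]
    exact h7
  rw [integral_congr_ae (g := fun ξ => ‖(𝓕 (H1.toL2 u) : L2) ξ - ψ ξ‖ ^ 2)
      (h1.mono fun ξ h => by simp only [h]), hμ,
    integral_withDensity_eq_integral_smul continuous_weight.measurable]
  refine integral_congr_ae (h5.mono fun ξ h => ?_)
  simp only [h]
  rfl

/-- The unique bounded linear map `J : H¹(ℝ²) → L²(ℝ², m)` with `J φ = φ` for Schwartz functions:
the continuous extension of `φ ↦ φ` along the dense inclusion `𝓢(ℝ²) → H¹(ℝ²)`. -/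
def J (m : Measure Plane) [IsFiniteMeasure m] : H1 →L[ℂ] Lp (α := Plane) ℂ 2 m :=
  (SchwartzMap.toLpCLM ℂ (E := Plane) ℂ 2 m).toLinearMap.extendOfNorm schwartzToH1

/-! ### The unperturbed operator -/

/-- The off-diagonal entry `A` of the symbol of an unperturbed spin-orbit Hamiltonian: a continuous
complex function with `limsup_{p → ∞} |A(p)| / p² < 1`. -/
structure Coupling where
  A : Plane → ℂ
  continuous : Continuous A
  limsup_lt : limsup (fun p => ‖A p‖ₑ / ‖p‖ₑ ^ 2) (cocompact Plane) < 1

namespace Coupling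

variable (σ : Coupling)

/-- The matrix `Ĥ₀(p)`. -/
def symbol (p : Plane) : Matrix (Fin 2) (Fin 2) ℂ :=
  !![((‖p‖ ^ 2 : ℝ) : ℂ), σ.A p; star (σ.A p), ((‖p‖ ^ 2 : ℝ) : ℂ)]

/-- The lower dispersion law `λ₋(p) = p² - |A(p)|`. -/
def lambdaMinus (p : Plane) : ℝ := ‖p‖ ^ 2 - ‖σ.A p‖

/-- The bottom `κ = inf {p² - |A(p)| : p ∈ ℝ²}` of the spectrum of `H₀`. -/
def kappa : ℝ := ⨅ p : Plane, σ.lambdaMinus p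

/-- The set `S` of the minimum points of `λ₋`. -/
def S : Set Plane := {p | σ.lambdaMinus p = σ.kappa}

/-- `|A|` is of class `C²` in a neighbourhood of `S`. -/
def IsC2NearS : Prop :=
  ∃ U : Set Plane, IsOpen U ∧ σ.S ⊆ U ∧ ContDiffOn ℝ 2 (fun p => ‖σ.A p‖) U

/-- The sesquilinear form of `H₀` on `H¹(ℝ²) ⊗ ℂ²` (antilinear in the first argument):
`q₀(u, v) = ∫ ⟨û(p), Ĥ₀(p) v̂(p)⟩ dp`. The Fourier transform used here has momentum `p = 2πξ`. -/
def form₀ (u v : Fin 2 → H1) : ℂ :=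
  ∫ ξ : Plane, star (fun i => (𝓕 (H1.toL2 (u i)) : L2) ξ) ⬝ᵥ
    (σ.symbol ((2 * Real.pi) • ξ)).mulVec (fun i => (𝓕 (H1.toL2 (v i)) : L2) ξ)

/-- A quadratic bound for the symbol. -/
theorem norm_A_le : ∃ C : ℝ, 0 ≤ C ∧ ∀ p : Plane, ‖σ.A p‖ ≤ C + ‖p‖ ^ 2 := by
  have hev : ∀ᶠ p in cocompact Plane, ‖σ.A p‖ ≤ ‖p‖ ^ 2 := by
    filter_upwards [eventually_lt_of_limsup_lt σ.limsup_lt] with p hp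
    by_contra! hlt
    have h1 : ‖p‖ₑ ^ 2 ≤ ‖σ.A p‖ₑ := by
      rw [← ofReal_norm, ← ofReal_norm, ← ENNReal.ofReal_pow (norm_nonneg _)]
      exact ENNReal.ofReal_le_ofReal hlt.le
    have h0 : ‖σ.A p‖ₑ ≠ 0 := by
      rw [enorm_ne_zero]
      intro h
      rw [h, norm_zero] at hlt
      exact absurd hlt (not_lt.mpr (by positivity))
    have h2 : (1 : ℝ≥0∞) ≤ ‖σ.A p‖ₑ / ‖p‖ₑ ^ 2 := by
      rw [ENNReal.le_div_iff_mul_le (Or.inr h0) (Or.inr enorm_ne_top), one_mul]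
      exact h1
    exact absurd hp (not_lt.mpr h2)
  obtain ⟨K, hK, hKs⟩ := mem_cocompact.mp hev
  obtain ⟨C, hC⟩ := hK.exists_bound_of_continuousOn σ.continuous.continuousOn
  refine ⟨max C 0, le_max_right _ _, fun p => ?_⟩
  by_cases hp : p ∈ K
  · exact (hC p hp).trans ((le_max_left _ _).trans (le_add_of_nonneg_right (by positivity)))
  · exact (hKs hp).trans (le_add_of_nonneg_left (le_max_right _ _))

theorem continuous_symbol (i j : Fin 2) : Continuous fun p => σ.symbol p i j := by
  have hA := σ.continuous
  fin_cases i <;> fin_cases j <;> simp [symbol] <;> fun_prop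

theorem norm_symbol_le : ∃ C : ℝ, 0 ≤ C ∧ ∀ (p : Plane) (i j : Fin 2),
    ‖σ.symbol p i j‖ ≤ C + ‖p‖ ^ 2 := by
  obtain ⟨C, hC0, hC⟩ := σ.norm_A_le
  refine ⟨C, hC0, fun p i j => ?_⟩
  fin_cases i <;> fin_cases j <;> simp [symbol, hC p, hC0]

/-- The integrand of the form of `H₀` is integrable, entry by entry. -/
theorem integrable_entry (u v : H1) (i j : Fin 2) : Integrable fun ξ : Plane =>
    star ((𝓕 (H1.toL2 u) : L2) ξ) *
      (σ.symbol ((2 * Real.pi) • ξ) i j * (𝓕 (H1.toL2 v) : L2) ξ) := by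
  obtain ⟨C, hC0, hC⟩ := σ.norm_symbol_le
  have hint : ∀ f g : L2, Integrable fun ξ : Plane => ‖f ξ‖ * ‖g ξ‖ := fun f g =>
    (Lp.memLp f).norm.integrable_mul (Lp.memLp g).norm
  have hG : Integrable fun ξ : Plane =>
      C * (‖(𝓕 (H1.toL2 u) : L2) ξ‖ * ‖(𝓕 (H1.toL2 v) : L2) ξ‖) +
        ∑ k : Fin 2, ‖(𝓕 (H1.deriv k u) : L2) ξ‖ * ‖(𝓕 (H1.deriv k v) : L2) ξ‖ :=
    ((hint _ _).const_mul C).add (integrable_finsetSum _ fun k _ => hint _ _)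
  refine hG.mono' ?_ ?_
  · have hs : Continuous fun ξ : Plane => σ.symbol ((2 * Real.pi) • ξ) i j :=
      (σ.continuous_symbol i j).comp (continuous_const_smul _)
    exact (continuous_star.comp_aestronglyMeasurable (Lp.aestronglyMeasurable _)).mul
      (hs.aestronglyMeasurable.mul (Lp.aestronglyMeasurable _))
  · have hu : ∀ᵐ ξ : Plane, ∀ k : Fin 2, (𝓕 (H1.deriv k u) : L2) ξ =
        (2 * Real.pi * ξ k * Complex.I : ℂ) * (𝓕 (H1.toL2 u) : L2) ξ :=
      ae_all_iff.mpr u.2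
    have hv : ∀ᵐ ξ : Plane, ∀ k : Fin 2, (𝓕 (H1.deriv k v) : L2) ξ =
        (2 * Real.pi * ξ k * Complex.I : ℂ) * (𝓕 (H1.toL2 v) : L2) ξ :=
      ae_all_iff.mpr v.2
    filter_upwards [hu, hv] with ξ h1 h2
    simp only [h1, h2, norm_mul, norm_star]
    have hn : ‖(2 * Real.pi) • ξ‖ ^ 2 = ∑ k : Fin 2, (2 * Real.pi * |ξ k|) ^ 2 := by
      rw [EuclideanSpace.norm_sq_eq]
      simp [abs_of_pos Real.pi_pos]
    have h3 := hC ((2 * Real.pi) • ξ) i j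
    rw [hn] at h3
    have hpi : ‖(Real.pi : ℂ)‖ = Real.pi := by simp [abs_of_pos Real.pi_pos]
    simp only [Fin.sum_univ_two, hpi, Complex.norm_I, Complex.norm_real, Real.norm_eq_abs,
      Complex.norm_ofNat, mul_one] at h3 ⊢
    set a := ‖(𝓕 (H1.toL2 u) : L2) ξ‖
    set b := ‖(𝓕 (H1.toL2 v) : L2) ξ‖
    have hab : 0 ≤ a * b := mul_nonneg (norm_nonneg _) (norm_nonneg _)
    nlinarith [mul_le_mul_of_nonneg_left h3 hab]

theorem integrable_form₀ (u v : Fin 2 → H1) : Integrable fun ξ : Plane =>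
    star (fun i => (𝓕 (H1.toL2 (u i)) : L2) ξ) ⬝ᵥ
      (σ.symbol ((2 * Real.pi) • ξ)).mulVec (fun i => (𝓕 (H1.toL2 (v i)) : L2) ξ) := by
  simp only [dotProduct, Matrix.mulVec, Finset.mul_sum, Pi.star_apply]
  exact integrable_finsetSum _ fun i _ => integrable_finsetSum _ fun j _ =>
    σ.integrable_entry (u i) (v j) i j

theorem form₀_add (u v w : Fin 2 → H1) : σ.form₀ u (v + w) = σ.form₀ u v + σ.form₀ u w := by
  rw [form₀, form₀, form₀, ← integral_add (σ.integrable_form₀ u v) (σ.integrable_form₀ u w)]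
  refine integral_congr_ae ?_
  have h : ∀ᵐ ξ : Plane, ∀ i : Fin 2, (𝓕 (H1.toL2 ((v + w) i)) : L2) ξ =
      (𝓕 (H1.toL2 (v i)) : L2) ξ + (𝓕 (H1.toL2 (w i)) : L2) ξ := by
    refine ae_all_iff.mpr fun i => ?_
    rw [Pi.add_apply, map_add, FourierTransform.fourier_add]
    exact Lp.coeFn_add _ _
  filter_upwards [h] with ξ hξ
  rw [← dotProduct_add, ← Matrix.mulVec_add]
  simp only [hξ]
  rfl

theorem form₀_smul (c : ℂ) (u v : Fin 2 → H1) : σ.form₀ u (c • v) = c * σ.form₀ u v := by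
  rw [form₀, form₀, ← integral_const_mul]
  refine integral_congr_ae ?_
  have h : ∀ᵐ ξ : Plane, ∀ i : Fin 2, (𝓕 (H1.toL2 ((c • v) i)) : L2) ξ =
      c * (𝓕 (H1.toL2 (v i)) : L2) ξ := by
    refine ae_all_iff.mpr fun i => ?_
    rw [Pi.smul_apply, map_smul, FourierTransform.fourier_smul]
    exact Lp.coeFn_smul _ _
  filter_upwards [h] with ξ hξ
  rw [← smul_eq_mul c, ← dotProduct_smul, ← Matrix.mulVec_smul]
  simp only [hξ]
  rfl

end Coupling

/-! ### The perturbation -/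

/-- The data of a perturbation `ν = h m`: a finite positive measure `m` and a bounded Borel function
`h` for which `m` and `h² m` satisfy the form bound with constants `a ∈ (0, 1)` and `b > 0`. -/
structure Perturbation where
  m : Measure Plane
  finite : IsFiniteMeasure m
  h : Plane → ℝ
  measurable : Measurable h
  bounded : ∃ C : ℝ, ∀ x, |h x| ≤ C
  form_bound : ∃ a b : ℝ, 0 < a ∧ a < 1 ∧ 0 < b ∧ ∀ f : 𝓢(Plane, ℂ),
    (∫ x, (1 + |h x| ^ 2) * ‖f x‖ ^ 2 ∂m) ≤
      a * (∫ x, ∑ i : Fin 2, ‖(∂_{e i} f : 𝓢(Plane, ℂ)) x‖ ^ 2) + b * (∫ x, ‖f x‖ ^ 2)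

namespace Perturbation

attribute [instance] Perturbation.finite

variable (V : Perturbation)

/-- The signed measure `ν = h m`. -/
def nu : SignedMeasure Plane := V.m.withDensityᵥ V.h

/-- The topological support of `ν`. -/
def supp : Set Plane := V.nu.totalVariation.support

/-- The sesquilinear form `ν(u, v) = ∫ ⟨J₂ u(x), J₂ v(x)⟩ h(x) m(dx)` on `H¹(ℝ²) ⊗ ℂ²`, antilinear
in the first argument. -/
def form (u v : Fin 2 → H1) : ℂ :=
  ∫ x, (V.h x : ℂ) * star (fun i => J V.m (u i) x) ⬝ᵥ (fun i => J V.m (v i) x) ∂V.m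

/-- `J φ = φ` for all Schwartz functions `φ`. -/
theorem J_schwartz (φ : 𝓢(Plane, ℂ)) : J V.m (schwartzToH1 φ) = φ.toLp 2 V.m := by
  refine LinearMap.extendOfNorm_eq denseRange_schwartzToH1 ?_ φ
  obtain ⟨a, b, ha, ha1, hb, hab⟩ := V.form_bound
  obtain ⟨C, hC⟩ := V.bounded
  refine ⟨√(a + b), fun f => ?_⟩
  change ‖(f.toLp 2 V.m : Lp (α := Plane) ℂ 2 V.m)‖ ≤ _
  have hsq : ∀ (μ : Measure Plane) [μ.HasTemperateGrowth] (g : 𝓢(Plane, ℂ)),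
      ‖g.toLp 2 μ‖ ^ 2 = ∫ x, ‖g x‖ ^ 2 ∂μ := fun μ _ g => by
    rw [L2_norm_sq]
    exact integral_congr_ae ((g.coeFn_toLp 2 μ).mono fun x hx => by simp only [hx])
  have hint : ∀ (μ : Measure Plane) [μ.HasTemperateGrowth] (g : 𝓢(Plane, ℂ)),
      Integrable (fun x => ‖g x‖ ^ 2) μ := fun μ _ g =>
    (memLp_two_iff_integrable_sq_norm g.continuous.aestronglyMeasurable).mp (g.memLp 2 μ)
  have hH : ‖schwartzToH1 f‖ ^ 2 =
      (∫ x, ‖f x‖ ^ 2) + ∫ x, ∑ i : Fin 2, ‖(∂_{e i} f : 𝓢(Plane, ℂ)) x‖ ^ 2 := by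
    rw [integral_finsetSum _ fun i _ => hint _ _, 
      show ‖schwartzToH1 f‖ = ‖(schwartzToH1 f).1‖ from rfl,
      WithLp.prod_norm_sq_eq_of_L2, PiLp.norm_sq_eq_of_L2]
    simp only [← hsq]
    rfl
  have hm : (∫ x, ‖f x‖ ^ 2 ∂V.m) ≤ ∫ x, (1 + |V.h x| ^ 2) * ‖f x‖ ^ 2 ∂V.m := by
    refine integral_mono (hint _ _) ?_ fun x => ?_
    · refine (hint V.m f).bdd_mul (c := 1 + C ^ 2) ?_ (Eventually.of_forall fun x => ?_)
      · exact ((V.measurable.abs.pow_const 2).const_add 1).aestronglyMeasurable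
      · rw [Real.norm_of_nonneg (by positivity)]
        gcongr
        exact hC x
    · exact le_mul_of_one_le_left (by positivity) (by simp [sq_nonneg])
  rw [← sq_le_sq₀ (norm_nonneg _) (by positivity), mul_pow, Real.sq_sqrt (by positivity), hH, hsq]
  have h1 : 0 ≤ ∫ x, ‖f x‖ ^ 2 := integral_nonneg fun x => by positivity
  have h2 : 0 ≤ ∫ x, ∑ i : Fin 2, ‖(∂_{e i} f : 𝓢(Plane, ℂ)) x‖ ^ 2 :=
    integral_nonneg fun x => by positivity
  nlinarith [hab f, mul_nonneg ha.le h1, mul_nonneg hb.le h2]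

theorem integrable_form (u v : Fin 2 → H1) : Integrable (fun x => (V.h x : ℂ) *
    star (fun i => J V.m (u i) x) ⬝ᵥ (fun i => J V.m (v i) x)) V.m := by
  obtain ⟨C, hC⟩ := V.bounded
  refine Integrable.bdd_mul (c := C) ?_
    (Complex.measurable_ofReal.comp V.measurable).aestronglyMeasurable
    (Eventually.of_forall fun x => by simpa using hC x)
  simp only [dotProduct, Pi.star_apply]
  exact integrable_finsetSum _ fun i _ =>
    (Lp.memLp (J V.m (u i))).star.integrable_mul (Lp.memLp (J V.m (v i)))

theorem form_add (u v w : Fin 2 → H1) : V.form u (v + w) = V.form u v + V.form u w := by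
  rw [form, form, form, ← integral_add (V.integrable_form u v) (V.integrable_form u w)]
  refine integral_congr_ae ?_
  have h : ∀ᵐ x ∂V.m, ∀ i : Fin 2, J V.m ((v + w) i) x = J V.m (v i) x + J V.m (w i) x := by
    refine ae_all_iff.mpr fun i => ?_
    rw [Pi.add_apply, map_add]
    exact Lp.coeFn_add _ _
  filter_upwards [h] with x hx
  rw [← mul_add, ← dotProduct_add]
  simp only [hx]
  rfl

theorem form_smul (c : ℂ) (u v : Fin 2 → H1) : V.form u (c • v) = c * V.form u v := by
  rw [form, form, ← integral_const_mul]
  refine integral_congr_ae ?_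
  have h : ∀ᵐ x ∂V.m, ∀ i : Fin 2, J V.m ((c • v) i) x = c * J V.m (v i) x := by
    refine ae_all_iff.mpr fun i => ?_
    rw [Pi.smul_apply, map_smul]
    exact Lp.coeFn_smul _ _
  filter_upwards [h] with x hx
  rw [mul_left_comm, ← smul_eq_mul c (_ ⬝ᵥ _), ← dotProduct_smul]
  simp only [hx]
  rfl

end Perturbation

/-! ### The perturbed operator -/

/-- The inclusion `H¹(ℝ²) ⊗ ℂ² → L²(ℝ²) ⊗ ℂ²`. -/
def spinorIncl : (Fin 2 → H1) →ₗ[ℂ] Spinor where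
  toFun u := WithLp.toLp 2 fun i => H1.toL2 (u i)
  map_add' _ _ := rfl
  map_smul' _ _ := rfl

/-- The form `q = q₀ + ν` on `H¹(ℝ²) ⊗ ℂ²`. -/
def form (σ : Coupling) (V : Perturbation) (u v : Fin 2 → H1) : ℂ := σ.form₀ u v + V.form u v

/-- The hypothesis of the KLMN theorem for `q = q₀ + ν`: the form `ν` is bounded relative to `q₀` with
relative bound less than `1`. For `ν ≤ 0` it holds if and only if `q` is semibounded from below and
closed on `H¹(ℝ²) ⊗ ℂ²`. -/
def IsRelativelyBounded (σ : Coupling) (V : Perturbation) : Prop :=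
  ∃ a b : ℝ, a < 1 ∧ ∀ u : Fin 2 → H1,
    ‖V.form u u‖ ≤ a * (σ.form₀ u u).re + b * ‖spinorIncl u‖ ^ 2

/-- The graph of the operator associated with `q`: the pairs `(u, g)` with `u ∈ H¹(ℝ²) ⊗ ℂ²`,
`g ∈ L²(ℝ²) ⊗ ℂ²` and `q(v, u) = ⟨v, g⟩` for all `v ∈ H¹(ℝ²) ⊗ ℂ²`. -/
def hamiltonianGraph (σ : Coupling) (V : Perturbation) : Submodule ℂ (Spinor × Spinor) where
  carrier := {x | ∃ u : Fin 2 → H1, spinorIncl u = x.1 ∧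
    ∀ v : Fin 2 → H1, form σ V v u = inner ℂ (spinorIncl v) x.2}
  zero_mem' := ⟨0, map_zero _, fun v => by
    have h1 := σ.form₀_smul 0 v 0
    have h2 := V.form_smul 0 v 0
    rw [smul_zero, zero_mul] at h1 h2
    rw [form, h1, h2, Prod.snd_zero, inner_zero_right, add_zero]⟩
  add_mem' := by
    rintro x y ⟨u, hu, hu'⟩ ⟨w, hw, hw'⟩
    refine ⟨u + w, by rw [map_add, hu, hw, Prod.fst_add], fun v => ?_⟩
    rw [Prod.snd_add, inner_add_right, ← hu', ← hw', form, form, form, σ.form₀_add, V.form_add]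
    ring
  smul_mem' := by
    rintro c x ⟨u, hu, hu'⟩
    refine ⟨c • u, by rw [map_smul, hu, Prod.smul_fst], fun v => ?_⟩
    rw [Prod.smul_snd, inner_smul_right, ← hu', form, form, σ.form₀_smul, V.form_smul]
    ring

/-- The graph is single-valued, since `H¹` is dense in `L²`. -/
theorem hamiltonianGraph_functional (σ : Coupling) (V : Perturbation) (x : Spinor × Spinor)
    (hx : x ∈ hamiltonianGraph σ V) (h0 : x.1 = 0) : x.2 = 0 := by
  obtain ⟨u, hu, hq⟩ := hx
  have hu0 : ∀ i, H1.toL2 (u i) = 0 := fun i => by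
    have : spinorIncl u i = 0 := by rw [hu, h0]; rfl
    exact this
  have hzero : u = 0 := by
    funext i
    apply Subtype.ext
    have hfst : (u i).1.fst = 0 := hu0 i
    have hsnd : ∀ k, (u i).1.snd k = 0 := by
      intro k
      have hF : (𝓕 ((u i).1.snd k) : L2) = 0 := by
        have hFz : (𝓕 (u i).1.fst : L2) = 0 := by
          rw [hfst]
          exact (Lp.fourierTransformₗᵢ Plane ℂ).map_zero
        apply Lp.ext
        filter_upwards [(u i).2 k, Lp.coeFn_zero ℂ 2 (volume : Measure Plane)] with ξ h1 h2
        rw [h1, hFz, h2, Pi.zero_apply, mul_zero]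
      exact (Lp.fourierTransformₗᵢ Plane ℂ).map_eq_zero_iff.mp hF
    apply (WithLp.equiv 2 _).injective
    refine Prod.ext hfst ?_
    apply PiLp.ext
    exact hsnd
  have hform : ∀ v, inner ℂ (spinorIncl v) x.2 = 0 := fun v => by
    have h1 := σ.form₀_smul 0 v 0
    have h2 := V.form_smul 0 v 0
    rw [smul_zero, zero_mul] at h1 h2
    rw [← hq, hzero, form, h1, h2, add_zero]
  apply PiLp.ext
  intro i
  have hd : DenseRange (SchwartzMap.toLpCLM ℝ (E := Plane) ℂ 2 (volume : Measure Plane)) :=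
    SchwartzMap.denseRange_toLpCLM ENNReal.ofNat_ne_top
  refine hd.eq_zero_of_inner_right ℂ fun φ => ?_
  have h := hform (Pi.single i (schwartzToH1 φ))
  rw [PiLp.inner_apply, Finset.sum_eq_single i] at h
  · change inner ℂ (H1.toL2 ((Pi.single i (schwartzToH1 φ) : Fin 2 → H1) i)) (x.2 i) = 0 at h
    rw [Pi.single_eq_same] at h
    exact h
  · intro j _ hj
    change inner ℂ (H1.toL2 ((Pi.single i (schwartzToH1 φ) : Fin 2 → H1) j)) (x.2 j) = 0
    rw [Pi.single_eq_of_ne hj, map_zero, inner_zero_left]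
  · intro h
    exact absurd (Finset.mem_univ i) h

/-- The operator `H = H₀ + ν` associated with the form `q` (self-adjoint and semibounded from below
when `q` is closed and semibounded). -/
def hamiltonian (σ : Coupling) (V : Perturbation) : Spinor →ₗ.[ℂ] Spinor :=
  (hamiltonianGraph σ V).toLinearPMap

/-- The defining property of `H`. -/
theorem mem_graph_hamiltonian_iff (σ : Coupling) (V : Perturbation) (f g : Spinor) :
    (f, g) ∈ (hamiltonian σ V).graph ↔ ∃ u : Fin 2 → H1, spinorIncl u = f ∧
      ∀ v : Fin 2 → H1, form σ V v u = inner ℂ (spinorIncl v) g := by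
  rw [hamiltonian, Submodule.toLinearPMap_graph_eq _ (hamiltonianGraph_functional σ V)]
  rfl

/-! ### Counting eigenvalues -/

/-- The eigenspace `{f ∈ dom T : T f = E f}`. -/
def eigenspace (T : Spinor →ₗ.[ℂ] Spinor) (E : ℝ) : Submodule ℂ Spinor :=
  T.graph.comap (LinearMap.id.prod ((E : ℂ) • LinearMap.id))

/-- The set of the (real) eigenvalues of `T` below `E₀`. -/
def eigenvaluesBelow (T : Spinor →ₗ.[ℂ] Spinor) (E₀ : ℝ) : Set ℝ :=
  {E | E < E₀ ∧ eigenspace T E ≠ ⊥}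

/-- The number of eigenvalues of `T` below `E₀`, counted with multiplicity: the dimension of the sum
of the eigenspaces, `∞` if it is infinite. -/
def countBelow (T : Spinor →ₗ.[ℂ] Spinor) (E₀ : ℝ) : ℕ∞ :=
  Cardinal.toENat (Module.rank ℂ (⨆ E ∈ Set.Iio E₀, eigenspace T E : Submodule ℂ Spinor))

/-! ### The Rashba and Dresselhaus Hamiltonians -/

/-- A continuous `A` with `|A(p)| = c |p|` is a coupling function. -/
theorem limsup_lt_of_linear {A : Plane → ℂ} (c : ℝ) (hA : ∀ p, ‖A p‖ = c * ‖p‖) :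
    limsup (fun p => ‖A p‖ₑ / ‖p‖ₑ ^ 2) (cocompact Plane) < 1 := by
  refine lt_of_le_of_lt (b := ((2 : ℝ≥0∞)⁻¹)) ?_ (by simp)
  refine limsup_le_of_le (by isBoundedDefault) ?_
  filter_upwards [(tendsto_norm_cocompact_atTop (E := Plane)).eventually_ge_atTop (max (2 * c) 1)]
    with p hp
  have hp1 : 1 ≤ ‖p‖ := (le_max_right _ _).trans hp
  have hp2 : 2 * c ≤ ‖p‖ := (le_max_left _ _).trans hp
  have h2 : ((2 : ℝ≥0∞)⁻¹) = ENNReal.ofReal (2⁻¹) := by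
    rw [ENNReal.ofReal_inv_of_pos two_pos, ENNReal.ofReal_ofNat]
  rw [← ofReal_norm, ← ofReal_norm, ← ENNReal.ofReal_pow (norm_nonneg _),
    ← ENNReal.ofReal_div_of_pos (by positivity), hA, h2]
  refine ENNReal.ofReal_le_ofReal ?_
  rw [div_le_iff₀ (by positivity)]
  nlinarith

/-- The Rashba coupling `A(p) = α (p_y + i p_x)`. -/
def rashba (α : ℝ) : Coupling where
  A p := α * (p 1 + Complex.I * p 0)
  continuous := by fun_prop
  limsup_lt := limsup_lt_of_linear |α| fun p => by
    rw [norm_mul, Complex.norm_real, Real.norm_eq_abs, mul_comm Complex.I, Complex.norm_add_mul_I,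
      EuclideanSpace.norm_eq, Fin.sum_univ_two, Real.norm_eq_abs, Real.norm_eq_abs, sq_abs, sq_abs,
      add_comm]

/-- The Dresselhaus coupling `A(p) = -α (p_x + i p_y)`. -/
def dresselhaus (α : ℝ) : Coupling where
  A p := -α * (p 0 + Complex.I * p 1)
  continuous := by fun_prop
  limsup_lt := limsup_lt_of_linear |α| fun p => by
    rw [norm_mul, norm_neg, Complex.norm_real, Real.norm_eq_abs, mul_comm Complex.I,
      Complex.norm_add_mul_I, EuclideanSpace.norm_eq, Fin.sum_univ_two, Real.norm_eq_abs,
      Real.norm_eq_abs, sq_abs, sq_abs]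

end SpinOrbit

end

/-! The proof combines a variational principle for eigenvalues below `κ` with trial spinors that are
nearly plane waves.

Variational principle. Relative boundedness makes `q + c` coercive on `H¹ ⊗ ℂ²` for some `c` with `κ
+ c > 0`. Lax–Milgram then gives the symmetric solution operator `T = (H + c)⁻¹`, and the
eigenvalues `E < κ` of `H` correspond to the eigenvalues `(E + c)⁻¹ > (κ + c)⁻¹` of `T`. No spectral
theorem is used. The fact that `T` has no essential spectrum above `(κ + c)⁻¹` is expressed by
`EssBounded`: `re ⟨T f, f⟩ ≤ ((κ + c)⁻¹ + ε) ‖f‖² + ‖f‖ ‖P f‖` with `P` compact. Above such a bound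
a supremum of Rayleigh quotients is attained, eigenspaces are finite dimensional, and an
`N`-dimensional space of trial vectors yields `N` eigenvectors
(`EssBounded.le_rank_iSup_eigenspace`). The bound itself is `essBounded_form_resolvent`. High
momenta of `T f` have small `L²` norm. On bounded momenta `J` is compact, because `J* J` is there
the integral, over the finite measure `m`, of continuous and uniformly bounded rank-one operators.

Trial spinors. At a minimum point `p ∈ S` the `C²` hypothesis gives `λ₋(q) - κ ≤ C |q - p|²`, unless
`A p = 0`; in that case `p = 0`, `κ = 0`, and a constant spinor has energy exactly `|q|²`. Multiply
a field of lowest eigenvectors of `Ĥ₀` by a bump at `p` in momentum space. In two dimensions there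
are bumps `φ` of integral one, supported in a ball of radius `ε`, with `∫ |ξ|² φ² ≤ ε`: take `φ`
proportional to `|ξ|⁻²` on a logarithmically thick annulus (`exists_isLogBump`). Hence the energy
above `κ` tends to zero, while in position space the spinors converge boundedly to a plane wave
times a fixed spinor (`Coupling.exists_trial_sequence`).

Conclusion. For distinct points `p₁, …, p_N` of `S` the momentum supports are eventually disjoint,
so the matrix of `q - κ` on the trial spinors converges to the Gram matrix of plane waves with
respect to `ν`. This limit is negative definite: `ν ≤ 0`, and a combination of plane waves vanishing
`ν`-almost everywhere would confine `supp ν` to the zero set of a nontrivial trigonometric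
polynomial, which is a closed Lebesgue null set. Negative definiteness is an open condition, so `q <
κ` on the span of the trial spinors at some finite stage. If `S` is infinite, finite multiplicities
force infinitely many distinct eigenvalues. For the Rashba and Dresselhaus couplings `|A(p)| = |α|
|p|`, so `S` is the circle of radius `|α| / 2`. -/

open MeasureTheory Filter Topology
open scoped FourierTransform LineDeriv SchwartzMap ENNReal

noncomputable section

/-! ### Variational principle for symmetric operators above an essential bound -/

section Rayleigh

open scoped InnerProductSpace

variable {E F : Type*} [NormedAddCommGroup E] [InnerProductSpace ℂ E]
  [NormedAddCommGroup F] [NormedSpace ℂ F]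

/-- `re ⟨T x, x⟩ ≤ μ ‖x‖²` up to compact perturbations. -/
def EssBounded (F : Type*) [NormedAddCommGroup F] [NormedSpace ℂ F] (T : E →L[ℂ] E) (μ : ℝ) :
    Prop :=
  ∀ ε > 0, ∃ P : E →L[ℂ] F, IsCompactOperator P ∧
    ∀ x, (⟪T x, x⟫_ℂ).re ≤ (μ + ε) * ‖x‖ ^ 2 + ‖x‖ * ‖P x‖

/-- Positivity of the form at `x - s • S x` with `s = (‖S‖ + 1)⁻¹`: the cross term `-2 s ‖S x‖²`
beats the quadratic term. This turns a small value of the form at `x` into a small vector `S x`. -/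
theorem norm_sq_apply_le_of_re_inner_nonneg {S : E →L[ℂ] E}
    (hS : (S : E →ₗ[ℂ] E).IsSymmetric) (hpos : ∀ x, 0 ≤ (⟪S x, x⟫_ℂ).re) (x : E) :
    ‖S x‖ ^ 2 ≤ (‖S‖ + 1) * (⟪S x, x⟫_ℂ).re := by
  set s : ℝ := (‖S‖ + 1)⁻¹ with hs
  have hS0 : 0 < ‖S‖ + 1 := by positivity
  have h1 := hpos (x - (s : ℂ) • S x)
  have e1 : (⟪S (x - (s : ℂ) • S x), x - (s : ℂ) • S x⟫_ℂ).re =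
      (⟪S x, x⟫_ℂ).re - 2 * s * ‖S x‖ ^ 2 + s ^ 2 * (⟪S (S x), S x⟫_ℂ).re := by
    have h2 : ⟪S (S x), x⟫_ℂ = ⟪S x, S x⟫_ℂ := hS (S x) x
    have h3 : (⟪S x, S x⟫_ℂ).re = ‖S x‖ ^ 2 := inner_self_eq_norm_sq (𝕜 := ℂ) (S x)
    rw [map_sub, map_smul, inner_sub_left, inner_sub_right, inner_sub_right, inner_smul_left,
      inner_smul_left, inner_smul_right, inner_smul_right, h2, Complex.conj_ofReal, ← mul_assoc,
      ← Complex.ofReal_mul]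
    simp only [Complex.sub_re, Complex.re_ofReal_mul, h3]
    ring
  have h4 : (⟪S (S x), S x⟫_ℂ).re ≤ ‖S‖ * ‖S x‖ ^ 2 := by
    refine (Complex.re_le_norm _).trans ((norm_inner_le_norm _ _).trans ?_)
    rw [sq, ← mul_assoc]
    exact mul_le_mul_of_nonneg_right (S.le_opNorm _) (norm_nonneg _)
  have h5 : s * (‖S‖ + 1) = 1 := inv_mul_cancel₀ hS0.ne'
  have hs0 : 0 < s := inv_pos.mpr hS0
  have h6 : s ^ 2 * (⟪S (S x), S x⟫_ℂ).re ≤ s * ‖S x‖ ^ 2 := by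
    have h7 : s * ‖S‖ ≤ 1 := by nlinarith
    calc s ^ 2 * (⟪S (S x), S x⟫_ℂ).re ≤ s ^ 2 * (‖S‖ * ‖S x‖ ^ 2) := by gcongr
      _ = s * (s * ‖S‖) * ‖S x‖ ^ 2 := by ring
      _ ≤ s * 1 * ‖S x‖ ^ 2 := by gcongr
      _ = _ := by ring
  have h8 : s * ‖S x‖ ^ 2 ≤ (⟪S x, x⟫_ℂ).re := by linarith
  calc ‖S x‖ ^ 2 = (‖S‖ + 1) * (s * ‖S x‖ ^ 2) := by rw [← mul_assoc, mul_comm _ s, h5, one_mul]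
    _ ≤ _ := by gcongr

/-- A bounded sequence of approximate eigenvectors above the essential bound has a convergent
subsequence. -/
theorem EssBounded.exists_tendsto_subseq [CompleteSpace E] {T : E →L[ℂ] E} {μ : ℝ}
    (hT : EssBounded F T μ) {l : ℝ} (hl : μ < l) {x : ℕ → E} {C : ℝ} (hx : ∀ n, ‖x n‖ ≤ C)
    (h : Tendsto (fun n => T (x n) - (l : ℂ) • x n) atTop (𝓝 0)) :
    ∃ (y : E) (φ : ℕ → ℕ), StrictMono φ ∧ Tendsto (x ∘ φ) atTop (𝓝 y) := by
  -- Half of the gap `l - μ` is spent as `ε`; the other half, `d`, remains as the coercivity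
  -- constant in `b4`.
  obtain ⟨P, hP, hbd⟩ := hT ((l - μ) / 2) (by linarith)
  have hC0 : 0 ≤ C := (norm_nonneg _).trans (hx 0)
  obtain ⟨K, hK, hKs⟩ := hP.image_closedBall_subset_compact C
  obtain ⟨z, -, φ, hφ, hz⟩ := hK.tendsto_subseq (x := fun n => P (x n))
    fun n => hKs ⟨x n, mem_closedBall_zero_iff.mpr (hx n), rfl⟩
  have hc : CauchySeq (x ∘ φ) := by
    have hPc : CauchySeq fun n => P (x (φ n)) := hz.cauchySeq
    have hRc : CauchySeq fun n => T (x (φ n)) - (l : ℂ) • x (φ n) :=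
      (h.comp hφ.tendsto_atTop).cauchySeq
    rw [Metric.cauchySeq_iff] at hPc hRc ⊢
    intro ε hε
    set d : ℝ := (l - μ) / 2 with hd
    have hd0 : 0 < d := by rw [hd]; linarith
    obtain ⟨N₁, h₁⟩ := hPc (d * ε / 2) (by positivity)
    obtain ⟨N₂, h₂⟩ := hRc (d * ε / 2) (by positivity)
    refine ⟨max N₁ N₂, fun m hm n hn => ?_⟩
    have a1 := h₁ m ((le_max_left _ _).trans hm) n ((le_max_left _ _).trans hn)
    have a2 := h₂ m ((le_max_right _ _).trans hm) n ((le_max_right _ _).trans hn)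
    rw [dist_eq_norm] at a1 a2
    rw [dist_eq_norm]
    -- The essential bound is applied to differences of the sequence: `P w` and `(T - l) w` are both
    -- small, and together they control `d ‖w‖`.
    set w := x (φ m) - x (φ n) with hw
    have e1 : P (x (φ m)) - P (x (φ n)) = P w := (map_sub _ _ _).symm
    have e2 : T (x (φ m)) - (l : ℂ) • x (φ m) - (T (x (φ n)) - (l : ℂ) • x (φ n)) =
        T w - (l : ℂ) • w := by rw [hw, map_sub, smul_sub]; abel
    rw [e1] at a1
    rw [e2] at a2
    have b1 := hbd w
    have b2 : (⟪T w - (l : ℂ) • w, w⟫_ℂ).re = (⟪T w, w⟫_ℂ).re - l * ‖w‖ ^ 2 := by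
      rw [inner_sub_left, inner_smul_left, Complex.conj_ofReal, Complex.sub_re,
        Complex.re_ofReal_mul]
      congr 2
      exact inner_self_eq_norm_sq (𝕜 := ℂ) w
    have b3 : -(‖T w - (l : ℂ) • w‖ * ‖w‖) ≤ (⟪T w - (l : ℂ) • w, w⟫_ℂ).re :=
      neg_le_of_abs_le ((Complex.abs_re_le_norm _).trans (norm_inner_le_norm _ _))
    have b4 : d * ‖w‖ ^ 2 ≤ ‖w‖ * (‖P w‖ + ‖T w - (l : ℂ) • w‖) := by
      have : l = μ + d + d := by rw [hd]; ring
      nlinarith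
    change ‖w‖ < ε
    by_contra! hcon
    have hwpos : 0 < ‖w‖ := hε.trans_le hcon
    have b5 : d * ‖w‖ ≤ ‖P w‖ + ‖T w - (l : ℂ) • w‖ := by
      rw [sq, mul_left_comm] at b4
      exact le_of_mul_le_mul_left b4 hwpos
    nlinarith
  obtain ⟨y, hy⟩ := cauchySeq_tendsto_of_complete hc
  exact ⟨y, φ, hφ, hy⟩

/-- Eigenvalues above the essential bound have finite multiplicity. -/
theorem EssBounded.finiteDimensional_eigenspace [CompleteSpace E] {T : E →L[ℂ] E} {μ : ℝ}
    (hT : EssBounded F T μ) {l : ℝ} (hl : μ < l) :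
    FiniteDimensional ℂ (Module.End.eigenspace (T : E →ₗ[ℂ] E) l) := by
  set M := Module.End.eigenspace (T : E →ₗ[ℂ] E) l with hM
  have hcl : IsClosed (M : Set E) := by
    have : (M : Set E) = {x | T x = (l : ℂ) • x} := by
      ext x
      exact Module.End.mem_eigenspace_iff
    rw [this]
    exact isClosed_eq T.continuous (continuous_const_smul _)
  -- Riesz's criterion: eigenvectors are exact approximate eigenvectors, so the unit ball of the
  -- eigenspace is sequentially compact.
  refine FiniteDimensional.of_isCompact_closedBall₀ ℂ (r := 1) one_pos ?_
  refine IsSeqCompact.isCompact fun x hx => ?_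
  obtain ⟨y, φ, hφ, hy⟩ := hT.exists_tendsto_subseq hl (x := fun n => (x n : E)) (C := 1)
    (fun n => mem_closedBall_zero_iff.mp (hx n)) (by
      refine tendsto_const_nhds.congr fun n => ?_
      exact (sub_eq_zero.mpr (Module.End.mem_eigenspace_iff.mp (x n).2)).symm)
  have hyM : y ∈ M := hcl.mem_of_tendsto hy (Eventually.of_forall fun n => (x (φ n)).2)
  have hty : Tendsto (x ∘ φ) atTop (𝓝 ⟨y, hyM⟩) := tendsto_subtype_rng.mpr hy
  exact ⟨⟨y, hyM⟩, Metric.isClosed_closedBall.mem_of_tendsto hty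
    (Eventually.of_forall fun n => hx _), φ, hφ, hty⟩

/-- If the Rayleigh quotient exceeds the essential bound somewhere, its supremum is attained at an
eigenvector. -/
theorem EssBounded.exists_eigenvector [CompleteSpace E] {T : E →L[ℂ] E} {μ : ℝ}
    (hT : EssBounded F T μ) (hsym : (T : E →ₗ[ℂ] E).IsSymmetric) {x₀ : E}
    (hx₀ : μ * ‖x₀‖ ^ 2 < (⟪T x₀, x₀⟫_ℂ).re) :
    ∃ l : ℝ, μ < l ∧ ∃ x : E, x ≠ 0 ∧ T x = (l : ℂ) • x := by
  have hx0 : x₀ ≠ 0 := by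
    rintro rfl
    simp at hx₀
  set A : Set ℝ := {r | ∃ x : E, ‖x‖ = 1 ∧ r = (⟪T x, x⟫_ℂ).re} with hA
  have hbdd : BddAbove A := by
    refine ⟨‖T‖, ?_⟩
    rintro r ⟨x, hx, rfl⟩
    refine (Complex.re_le_norm _).trans ((norm_inner_le_norm _ _).trans ?_)
    have := T.le_opNorm x
    rw [hx] at this ⊢
    linarith
  have hscale : ∀ x : E, x ≠ 0 → (⟪T x, x⟫_ℂ).re / ‖x‖ ^ 2 ∈ A := by
    intro x hx
    have hn : ‖x‖ ≠ 0 := norm_ne_zero_iff.mpr hx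
    refine ⟨((‖x‖⁻¹ : ℝ) : ℂ) • x, ?_, ?_⟩
    · rw [norm_smul, Complex.norm_real, norm_inv, norm_norm, inv_mul_cancel₀ hn]
    · rw [map_smul, inner_smul_left, inner_smul_right, Complex.conj_ofReal, Complex.re_ofReal_mul,
        Complex.re_ofReal_mul]
      field_simp
  set l := sSup A with hl
  have hne : A.Nonempty := ⟨_, hscale x₀ hx0⟩
  have hle : ∀ x : E, (⟪T x, x⟫_ℂ).re ≤ l * ‖x‖ ^ 2 := by
    intro x
    by_cases hx : x = 0
    · simp [hx]
    · have h1 := le_csSup hbdd (hscale x hx)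
      have hn : 0 < ‖x‖ := norm_pos_iff.mpr hx
      rwa [div_le_iff₀ (by positivity)] at h1
  have hn0 : 0 < ‖x₀‖ := norm_pos_iff.mpr hx0
  have hμl : μ < l := by
    have h1 := hle x₀
    have h2 := hx₀.trans_le h1
    exact lt_of_mul_lt_mul_right h2 (by positivity)
  refine ⟨l, hμl, ?_⟩
  obtain ⟨r, -, hr, hrA⟩ := exists_seq_tendsto_sSup hne hbdd
  choose x hx1 hxr using hrA
  set S : E →L[ℂ] E := (l : ℂ) • ContinuousLinearMap.id ℂ E - T with hS
  have hSx : ∀ y, S y = (l : ℂ) • y - T y := fun y => rfl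
  have hSi : ∀ y, (⟪S y, y⟫_ℂ).re = l * ‖y‖ ^ 2 - (⟪T y, y⟫_ℂ).re := by
    intro y
    rw [hSx, inner_sub_left, inner_smul_left, Complex.conj_ofReal, Complex.sub_re,
        Complex.re_ofReal_mul]
    congr 2
    exact inner_self_eq_norm_sq (𝕜 := ℂ) y
  have hSsym : (S : E →ₗ[ℂ] E).IsSymmetric := by
    intro y z
    change ⟪(l : ℂ) • y - T y, z⟫_ℂ = ⟪y, (l : ℂ) • z - T z⟫_ℂ
    rw [inner_sub_left, inner_sub_right, inner_smul_left, inner_smul_right, Complex.conj_ofReal]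
    congr 1
    exact hsym y z
  have hSpos : ∀ y, 0 ≤ (⟪S y, y⟫_ℂ).re := fun y => by
    rw [hSi]
    linarith [hle y]
  -- Along a maximising sequence the nonnegative form of `S = l - T` tends to zero, and therefore so
  -- does `S (x n)`.
  have hS0 : Tendsto (fun n => (⟪S (x n), x n⟫_ℂ).re) atTop (𝓝 0) := by
    have : (fun n => (⟪S (x n), x n⟫_ℂ).re) = fun n => l - r n := by
      funext n
      rw [hSi, hx1, ← hxr]
      ring
    rw [this]
    have h1 := hr.const_sub l
    rwa [← hl, sub_self] at h1
  have hT0 : Tendsto (fun n => T (x n) - (l : ℂ) • x n) atTop (𝓝 0) := by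
    rw [tendsto_zero_iff_norm_tendsto_zero]
    have h1 : Tendsto (fun n => √((‖S‖ + 1) * (⟪S (x n), x n⟫_ℂ).re)) atTop (𝓝 0) := by
      have := (hS0.const_mul (‖S‖ + 1)).sqrt
      simpa using this
    refine squeeze_zero (fun n => norm_nonneg _) (fun n => ?_) h1
    rw [← norm_neg, neg_sub, ← hSx]
    exact Real.le_sqrt_of_sq_le (norm_sq_apply_le_of_re_inner_nonneg hSsym hSpos (x n))
  obtain ⟨y, φ, hφ, hy⟩ := hT.exists_tendsto_subseq hμl (fun n => (hx1 n).le) hT0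
  refine ⟨y, ?_, ?_⟩
  · intro h
    have h1 : Tendsto (fun n => ‖x (φ n)‖) atTop (𝓝 ‖y‖) := hy.norm
    simp only [hx1, h, norm_zero] at h1
    exact one_ne_zero (tendsto_nhds_unique tendsto_const_nhds h1)
  · have h1 : Tendsto (fun n => T (x (φ n)) - (l : ℂ) • x (φ n)) atTop
        (𝓝 (T y - (l : ℂ) • y)) :=
      ((T.continuous.tendsto y).comp hy).sub (hy.const_smul _)
    exact sub_eq_zero.mp (tendsto_nhds_unique h1 (hT0.comp hφ.tendsto_atTop))

/-- A subspace on which the Rayleigh quotient exceeds the essential bound gives as many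
eigenvectors. -/
theorem EssBounded.le_rank_iSup_eigenspace [CompleteSpace E] {T : E →L[ℂ] E} {μ : ℝ}
    (hT : EssBounded F T μ) (hsym : (T : E →ₗ[ℂ] E).IsSymmetric) {N : ℕ}
    (f : (Fin N → ℂ) →ₗ[ℂ] E)
    (hf : ∀ c, c ≠ 0 → μ * ‖f c‖ ^ 2 < (⟪T (f c), f c⟫_ℂ).re) :
    (N : Cardinal) ≤ Module.rank ℂ
      (⨆ l ∈ Set.Ioi μ, Module.End.eigenspace (T : E →ₗ[ℂ] E) ((l : ℝ) : ℂ) : Submodule ℂ E) := by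
  set M : Submodule ℂ E :=
    ⨆ l ∈ Set.Ioi μ, Module.End.eigenspace (T : E →ₗ[ℂ] E) ((l : ℝ) : ℂ) with hM
  by_contra! hlt
  have hfin : FiniteDimensional ℂ M :=
    Module.rank_lt_aleph0_iff.mp (hlt.trans (Cardinal.natCast_lt_aleph0))
  have hlt' : Module.finrank ℂ M < N := by
    rw [← Module.finrank_eq_rank] at hlt
    exact_mod_cast hlt
  have hMT : ∀ x ∈ M, T x ∈ M := by
    have : M ≤ M.comap (T : E →ₗ[ℂ] E) := by
      rw [hM]
      refine iSup₂_le fun l hl x hx => ?_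
      have h1 : T x = (l : ℂ) • x := Module.End.mem_eigenspace_iff.mp hx
      rw [Submodule.mem_comap]
      change T x ∈ _
      rw [h1]
      exact Submodule.smul_mem _ _ (Submodule.mem_iSup_of_mem l (Submodule.mem_iSup_of_mem hl hx))
    exact this
  have hoT : ∀ x ∈ Mᗮ, T x ∈ Mᗮ := by
    intro x hx
    rw [Submodule.mem_orthogonal] at hx ⊢
    intro u hu
    have h1 : ⟪T u, x⟫_ℂ = ⟪u, T x⟫_ℂ := hsym u x
    rw [← h1]
    exact hx _ (hMT u hu)
  -- `T` restricts to `Mᗮ` with the same essential bound. An eigenvector found there above `μ` would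
  -- also lie in `M`, which is absurd.
  set T' : Mᗮ →L[ℂ] Mᗮ := (T.comp Mᗮ.subtypeL).codRestrict Mᗮ (fun x => hoT x x.2) with hT'
  have hin : ∀ x y : Mᗮ, ⟪T' x, y⟫_ℂ = ⟪T x, (y : E)⟫_ℂ := fun x y => rfl
  have hT'ess : EssBounded F T' μ := by
    intro ε hε
    obtain ⟨P, hP, hb⟩ := hT ε hε
    exact ⟨P.comp Mᗮ.subtypeL, hP.comp_clm _, fun x => hb x⟩
  have hT'sym : (T' : Mᗮ →ₗ[ℂ] Mᗮ).IsSymmetric := fun x y => hsym x y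
  -- Since `dim M < N`, the projection of the trial space to `M` has a kernel.
  obtain ⟨c, hc0, hc⟩ : ∃ c, c ≠ 0 ∧ f c ∈ Mᗮ := by
    set g : (Fin N → ℂ) →ₗ[ℂ] M := (M.orthogonalProjectionOnto : E →ₗ[ℂ] M).comp f with hg
    have hker : LinearMap.ker g ≠ ⊥ := by
      apply LinearMap.ker_ne_bot_of_finrank_lt
      simpa using hlt'
    obtain ⟨c, hc, hc0⟩ := Submodule.exists_mem_ne_zero_of_ne_bot hker
    exact ⟨c, hc0, Submodule.orthogonalProjectionOnto_eq_zero_iff.mp (LinearMap.mem_ker.mp hc)⟩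
  obtain ⟨l, hl, y, hy0, hy⟩ := hT'ess.exists_eigenvector hT'sym (x₀ := ⟨f c, hc⟩) (hf c hc0)
  have hyM : (y : E) ∈ M := by
    refine Submodule.mem_iSup_of_mem l (Submodule.mem_iSup_of_mem hl ?_)
    exact Module.End.mem_eigenspace_iff.mpr (congrArg Subtype.val hy)
  have : (y : E) = 0 := by
    have h1 := y.2
    rw [Submodule.mem_orthogonal] at h1
    exact inner_self_eq_zero.mp (h1 _ hyM)
  exact hy0 (Subtype.ext this)

end Rayleigh

namespace SpinOrbit

/-! ### Fourier multipliers on `L²` and `H¹` -/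

/-- Multiplication by a bounded function on `L²`. -/
def mulL (s : Plane → ℂ) (hs : MemLp s ∞ volume) : L2 →L[ℂ] L2 :=
  (ContinuousLinearMap.mul ℂ ℂ).holderL volume ∞ 2 2 (hs.toLp s)

theorem coeFn_mulL {s : Plane → ℂ} (hs : MemLp s ∞ volume) (g : L2) :
    mulL s hs g =ᵐ[volume] fun ξ => s ξ * g ξ := by
  filter_upwards [(ContinuousLinearMap.mul ℂ ℂ).coeFn_holder (r := 2) (hs.toLp s) g, hs.coeFn_toLp]
    with ξ h1 h2
  change ((ContinuousLinearMap.mul ℂ ℂ).holder 2 (hs.toLp s) g) ξ = _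
  rw [h1, h2]
  rfl

/-- The inverse Fourier transform on `L²` as a continuous linear map. -/
def fourierInvL : L2 →L[ℂ] L2 :=
  ((Lp.fourierTransformₗᵢ Plane ℂ).symm : L2 ≃L[ℂ] L2)

/-- The Fourier transform on `L²` as a continuous linear map. -/
def fourierL : L2 →L[ℂ] L2 := ((Lp.fourierTransformₗᵢ Plane ℂ) : L2 ≃L[ℂ] L2)

theorem fourierL_apply (g : L2) : fourierL g = 𝓕 g := rfl

theorem fourier_fourierInvL (g : L2) : (𝓕 (fourierInvL g) : L2) = g :=
  (Lp.fourierTransformₗᵢ Plane ℂ).apply_symm_apply g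

theorem fourierL_injective : Function.Injective fourierL :=
  (Lp.fourierTransformₗᵢ Plane ℂ).injective

theorem H1.toL2_injective : Function.Injective H1.toL2 := by
  intro u v h
  have h0 : H1.toL2 (u - v) = 0 := by rw [map_sub, h, sub_self]
  rw [← sub_eq_zero]
  set w := u - v
  have h1 : ‖w‖ ^ 2 = 0 := by
    rw [H1.norm_sq, h0, ← fourierL_apply, map_zero]
    refine integral_eq_zero_of_ae ?_
    filter_upwards [Lp.coeFn_zero ℂ 2 (volume : Measure Plane)] with ξ hξ
    simp
  exact norm_eq_zero.mp (pow_eq_zero_iff two_ne_zero |>.mp h1)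

theorem H1.ext_fourier {u v : H1}
    (h : (𝓕 (H1.toL2 u) : L2) =ᵐ[volume] (𝓕 (H1.toL2 v) : L2)) : u = v :=
  H1.toL2_injective (fourierL_injective (Lp.ext h))

theorem fourier_toL2_schwartzToH1_fourierInv (ψ : 𝓢(Plane, ℂ)) :
    (𝓕 (H1.toL2 (schwartzToH1 (𝓕⁻ ψ))) : L2) = ψ.toLp 2 := by
  change (𝓕 ((𝓕⁻ ψ : 𝓢(Plane, ℂ)).toLp 2 : L2) : L2) = _
  rw [SchwartzMap.toLp_fourier_eq, FourierTransform.fourier_fourierInv_eq]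

theorem memLp_top_div_one_add_abs (k : Fin 2) :
    MemLp (fun ξ : Plane => (2 * Real.pi * ξ k * Complex.I / (1 + |ξ k| : ℝ) : ℂ)) ∞ volume := by
  refine memLp_top_of_bound (C := 2 * Real.pi) (Measurable.aestronglyMeasurable (by fun_prop))
    (Eventually.of_forall fun ξ => ?_)
  have h0 : 0 < 1 + |ξ k| := by positivity
  rw [norm_div, Complex.norm_real, Real.norm_of_nonneg h0.le, div_le_iff₀ h0]
  simp only [norm_mul, Complex.norm_I, Complex.norm_real, Real.norm_eq_abs, Complex.norm_ofNat,
    mul_one, abs_of_pos Real.pi_pos]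
  have := Real.pi_pos
  gcongr
  linarith

theorem memLp_top_inv_one_add_abs (k : Fin 2) :
    MemLp (fun ξ : Plane => (((1 + |ξ k| : ℝ)⁻¹ : ℝ) : ℂ)) ∞ volume := by
  refine memLp_top_of_bound (C := 1) (Measurable.aestronglyMeasurable (by fun_prop))
    (Eventually.of_forall fun ξ => ?_)
  have h0 : 0 ≤ |ξ k| := abs_nonneg _
  rw [Complex.norm_real, Real.norm_of_nonneg (by positivity)]
  exact inv_le_one_of_one_le₀ (by linarith)

/-- Dividing the defining relation by `1 + |ξ k|` makes both multipliers bounded, so that `H1`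
becomes the equaliser of continuous maps and hence closed. -/
theorem mem_H1_iff (u : WithLp 2 (L2 × PiLp 2 (fun _ : Fin 2 => L2))) :
    u ∈ H1 ↔ ∀ k : Fin 2, mulL _ (memLp_top_inv_one_add_abs k) (fourierL (u.snd k)) =
      mulL _ (memLp_top_div_one_add_abs k) (fourierL u.fst) := by
  refine forall_congr' fun k => ?_
  have h0 : ∀ ξ : Plane, ((1 + |ξ k| : ℝ) : ℂ) ≠ 0 := fun ξ =>
    Complex.ofReal_ne_zero.mpr (by positivity)
  constructor
  · intro h
    apply Lp.ext
    filter_upwards [h, coeFn_mulL (memLp_top_inv_one_add_abs k) (fourierL (u.snd k)),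
      coeFn_mulL (memLp_top_div_one_add_abs k) (fourierL u.fst)] with ξ h1 h2 h3
    rw [h2, h3, fourierL_apply, fourierL_apply, h1, Complex.ofReal_inv]
    field_simp
  · intro h
    have h' := Lp.ext_iff.mp h
    filter_upwards [h', coeFn_mulL (memLp_top_inv_one_add_abs k) (fourierL (u.snd k)),
      coeFn_mulL (memLp_top_div_one_add_abs k) (fourierL u.fst)] with ξ h1 h2 h3
    rw [h2, h3, fourierL_apply, fourierL_apply, Complex.ofReal_inv] at h1
    have := h0 ξ
    field_simp at h1
    rw [h1]

theorem isClosed_H1 : IsClosed (H1 : Set (WithLp 2 (L2 × PiLp 2 (fun _ : Fin 2 => L2)))) := by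
  have : (H1 : Set (WithLp 2 (L2 × PiLp 2 (fun _ : Fin 2 => L2)))) =
      ⋂ k : Fin 2, {u | mulL _ (memLp_top_inv_one_add_abs k) (fourierL (u.snd k)) =
      mulL _ (memLp_top_div_one_add_abs k) (fourierL u.fst)} := by
    ext u
    rw [Set.mem_iInter]
    exact mem_H1_iff u
  rw [this]
  refine isClosed_iInter fun k => isClosed_eq ?_ ?_
  · refine (ContinuousLinearMap.continuous _).comp ((ContinuousLinearMap.continuous _).comp ?_)
    fun_prop
  · refine (ContinuousLinearMap.continuous _).comp ((ContinuousLinearMap.continuous _).comp ?_)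
    fun_prop

instance : CompleteSpace H1 := isClosed_H1.completeSpace_coe

theorem norm_fourier_toL2 (u : H1) : ‖(𝓕 (H1.toL2 u) : L2)‖ = ‖H1.toL2 u‖ := Lp.norm_fourier_eq _

theorem H1.norm_toL2_le (u : H1) : ‖H1.toL2 u‖ ≤ ‖u‖ := by
  rw [← sq_le_sq₀ (norm_nonneg _) (norm_nonneg _), H1.norm_sq, ← norm_fourier_toL2, L2_norm_sq]
  refine integral_mono (L2_integrable_sq _) (H1.integrable_weight u) fun ξ => ?_
  refine le_mul_of_one_le_left (by positivity) ?_
  exact_mod_cast (le_self_add : (1 : NNReal) ≤ weight ξ)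

/-- The inclusion `H¹ → L²` as a continuous linear map. -/
def H1.toL2L : H1 →L[ℂ] L2 :=
  H1.toL2.mkContinuous 1 fun u => by
    rw [one_mul]
    exact H1.norm_toL2_le u

/-! ### Band-limiting and plane-wave packets -/

variable (χ : ContDiffBump (0 : Plane))

theorem norm_coe_bump_le (ξ : Plane) : ‖((χ ξ : ℝ) : ℂ)‖ ≤ 1 := by
  rw [Complex.norm_real, Real.norm_of_nonneg χ.nonneg]
  exact χ.le_one

theorem memLp_top_bump : MemLp (fun ξ : Plane => ((χ ξ : ℝ) : ℂ)) ∞ volume :=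
  memLp_top_of_bound (C := 1)
    (Complex.continuous_ofReal.comp χ.continuous).aestronglyMeasurable
    (Eventually.of_forall (norm_coe_bump_le χ))

theorem hasCompactSupport_coe_bump : HasCompactSupport fun ξ : Plane => ((χ ξ : ℝ) : ℂ) :=
  χ.hasCompactSupport.comp_left (g := fun t : ℝ => (t : ℂ)) Complex.ofReal_zero

theorem memLp_top_bump_deriv (k : Fin 2) :
    MemLp (fun ξ : Plane => (2 * Real.pi * ξ k * Complex.I : ℂ) * ((χ ξ : ℝ) : ℂ)) ∞ volume := by
  have hc : Continuous fun ξ : Plane =>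
      (2 * Real.pi * ξ k * Complex.I : ℂ) * ((χ ξ : ℝ) : ℂ) := by
    have := χ.continuous
    fun_prop
  obtain ⟨C, hC⟩ := (hasCompactSupport_coe_bump χ).mul_left
    (f := fun ξ : Plane => (2 * Real.pi * ξ k * Complex.I : ℂ)) |>.exists_bound_of_continuous hc
  exact memLp_top_of_bound (C := C) hc.aestronglyMeasurable (Eventually.of_forall hC)

/-- The triple `(f, ∂₀ f, ∂₁ f)` for `𝓕 f = χ g`. -/
def bandlimitAux : L2 →L[ℂ] WithLp 2 (L2 × PiLp 2 (fun _ : Fin 2 => L2)) :=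
  ((WithLp.prodContinuousLinearEquiv 2 ℂ L2 (PiLp 2 (fun _ : Fin 2 => L2))).symm :
      (L2 × PiLp 2 (fun _ : Fin 2 => L2)) →L[ℂ] _).comp
    ((fourierInvL.comp (mulL _ (memLp_top_bump χ))).prod
      (((PiLp.continuousLinearEquiv 2 ℂ (fun _ : Fin 2 => L2)).symm :
        (Fin 2 → L2) →L[ℂ] _).comp
          (ContinuousLinearMap.pi fun k => fourierInvL.comp (mulL _ (memLp_top_bump_deriv χ k)))))

theorem bandlimitAux_mem (g : L2) : bandlimitAux χ g ∈ H1 := by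
  intro k
  change ∀ᵐ ξ : Plane, (𝓕 (fourierInvL (mulL _ (memLp_top_bump_deriv χ k) g)) : L2) ξ =
    (2 * Real.pi * ξ k * Complex.I : ℂ) * (𝓕 (fourierInvL (mulL _ (memLp_top_bump χ) g)) : L2) ξ
  rw [fourier_fourierInvL, fourier_fourierInvL]
  filter_upwards [coeFn_mulL (memLp_top_bump_deriv χ k) g, coeFn_mulL (memLp_top_bump χ) g]
    with ξ h1 h2
  rw [h1, h2, mul_assoc]

/-- The map `g ↦ 𝓕⁻ (χ g)` from `L²` to `H¹`. -/
def bandlimit : L2 →L[ℂ] H1 := (bandlimitAux χ).codRestrict H1 (bandlimitAux_mem χ)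

theorem fourier_bandlimit (g : L2) :
    (𝓕 (H1.toL2 (bandlimit χ g)) : L2) =ᵐ[volume] fun ξ => ((χ ξ : ℝ) : ℂ) * g ξ := by
  change (𝓕 (fourierInvL (mulL _ (memLp_top_bump χ) g)) : L2) =ᵐ[volume] _
  rw [fourier_fourierInvL]
  exact coeFn_mulL (memLp_top_bump χ) g

/-- The plane wave `ξ ↦ exp (-2πi ⟨ξ, x⟩)`. -/
def wave (x ξ : Plane) : ℂ := Complex.exp (-(2 * Real.pi * inner ℝ ξ x : ℝ) * Complex.I)

theorem norm_wave (x ξ : Plane) : ‖wave x ξ‖ = 1 := by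
  rw [wave, ← Complex.ofReal_neg, Complex.norm_exp_ofReal_mul_I]

theorem continuous_wave : Continuous fun z : Plane × Plane => wave z.1 z.2 := by
  unfold wave
  fun_prop

theorem norm_wave_sub_le (x y ξ : Plane) :
    ‖wave x ξ - wave y ξ‖ ≤ 2 * Real.pi * ‖ξ‖ * ‖x - y‖ := by
  have h : ∀ a b : ℝ, ‖Complex.exp (-(a : ℂ) * Complex.I) - Complex.exp (-(b : ℂ) * Complex.I)‖
      ≤ |a - b| := by
    intro a b
    have h1 : Complex.exp (-(a : ℂ) * Complex.I) - Complex.exp (-(b : ℂ) * Complex.I) =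
        Complex.exp (-(b : ℂ) * Complex.I) * (Complex.exp (Complex.I * ((b - a : ℝ) : ℂ)) - 1) := by
      rw [mul_sub, mul_one, ← Complex.exp_add]
      congr 2
      push_cast
      ring
    rw [h1, norm_mul, ← Complex.ofReal_neg, Complex.norm_exp_ofReal_mul_I, one_mul, abs_sub_comm]
    exact Real.norm_exp_I_mul_ofReal_sub_one_le
  refine (h _ _).trans ?_
  rw [← mul_sub, ← inner_sub_right (𝕜 := ℝ) ξ x y, abs_mul, abs_of_pos Real.two_pi_pos,
    mul_assoc _ ‖ξ‖]
  exact mul_le_mul_of_nonneg_left (abs_real_inner_le_norm ξ (x - y)) Real.two_pi_pos.le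

theorem memLp_wavePacket (x : Plane) :
    MemLp (fun ξ : Plane => ((χ ξ : ℝ) : ℂ) * wave x ξ) 2 volume := by
  have h1 : Continuous fun ξ : Plane => wave x ξ := by
    unfold wave
    fun_prop
  have h2 : Continuous fun ξ : Plane => ((χ ξ : ℝ) : ℂ) :=
    Complex.continuous_ofReal.comp χ.continuous
  have h4 : Continuous fun ξ : Plane => ((χ ξ : ℝ) : ℂ) * wave x ξ := h2.mul h1
  exact h4.memLp_of_hasCompactSupport (hasCompactSupport_coe_bump χ).mul_right

/-- The function `ξ ↦ χ(ξ) exp (-2πi ⟨ξ, x⟩)` in `L²`. -/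
def wavePacket (x : Plane) : L2 := (memLp_wavePacket χ x).toLp _

theorem inner_wavePacket (x : Plane) (g : L2) :
    inner ℂ (wavePacket χ x) g = ∫ ξ, star (wave x ξ) * (((χ ξ : ℝ) : ℂ) * g ξ) := by
  rw [L2.inner_def]
  refine integral_congr_ae ?_
  filter_upwards [(memLp_wavePacket χ x).coeFn_toLp] with ξ h
  rw [wavePacket, h, RCLike.inner_apply, map_mul, Complex.conj_ofReal]
  change _ = (starRingEnd ℂ) (wave x ξ) * _
  ring

/-- Plane waves at `x` and `y` differ by at most `2π ‖ξ‖ ‖x - y‖`, and `‖ξ‖ < χ.rOut` wherever the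
packet does not vanish. -/
theorem exists_lipschitzWith_wavePacket : ∃ K, LipschitzWith K (wavePacket χ) := by
  refine ⟨_, LipschitzWith.of_dist_le' (K := 2 * Real.pi * χ.rOut * ‖wavePacket χ 0‖)
    fun x y => ?_⟩
  rw [dist_eq_norm, dist_eq_norm, mul_right_comm]
  refine Lp.norm_le_mul_norm_of_ae_le_mul ?_
  filter_upwards [(memLp_wavePacket χ x).coeFn_toLp, (memLp_wavePacket χ y).coeFn_toLp,
    (memLp_wavePacket χ 0).coeFn_toLp, Lp.coeFn_sub (wavePacket χ x) (wavePacket χ y)]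
    with ξ h1 h2 h3 h4
  rw [h4, Pi.sub_apply, wavePacket, wavePacket, wavePacket, h1, h2, h3, ← mul_sub, norm_mul,
    norm_mul, norm_wave, mul_one, mul_comm]
  by_cases hξ : ‖ξ‖ < χ.rOut
  · refine mul_le_mul_of_nonneg_right ((norm_wave_sub_le x y ξ).trans ?_) (norm_nonneg _)
    have := Real.two_pi_pos
    gcongr
  · have h0 : χ ξ = 0 := χ.zero_of_le_dist (by rw [dist_zero_right]; exact not_lt.mp hξ)
    simp [h0]

theorem continuous_wavePacket : Continuous (wavePacket χ) := by
  obtain ⟨K, hK⟩ := exists_lipschitzWith_wavePacket χ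
  exact hK.continuous

theorem norm_wavePacket (x : Plane) : ‖wavePacket χ x‖ = ‖wavePacket χ 0‖ := by
  rw [← sq_eq_sq₀ (norm_nonneg _) (norm_nonneg _), L2_norm_sq, L2_norm_sq]
  refine integral_congr_ae ?_
  filter_upwards [(memLp_wavePacket χ x).coeFn_toLp, (memLp_wavePacket χ 0).coeFn_toLp]
    with ξ h1 h2
  rw [wavePacket, wavePacket, h1, h2, norm_mul, norm_mul, norm_wave, norm_wave]

/-- The quotient map modulo `S` commutes with the integral and kills every value of `f`. It is used
with `S` the closed space of compact operators. -/
theorem integral_mem_of_isClosed {X E : Type*} [MeasurableSpace X] {μ : Measure X}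
    [NormedAddCommGroup E] [NormedSpace ℂ E] [CompleteSpace E] {S : Submodule ℂ E}
    (hS : IsClosed (S : Set E)) {f : X → E} (hf : Integrable f μ) (h : ∀ x, f x ∈ S) :
    ∫ x, f x ∂μ ∈ S := by
  have : IsClosed (S : Set E) := hS
  have h1 := S.mkQL.integral_comp_comm hf
  have h2 : ∀ x, S.mkQL (f x) = 0 := fun x => (Submodule.Quotient.mk_eq_zero S).mpr (h x)
  simp only [h2, integral_zero] at h1
  exact (Submodule.Quotient.mk_eq_zero S).mp h1.symm

/-! ### Compactness of the trace map on band-limited functions -/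

section Trace

variable (V : Perturbation)

theorem memLp_inner_wavePacket (g : L2) :
    MemLp (fun x => inner ℂ (wavePacket χ x) g) 2 V.m := by
  refine MemLp.of_bound (C := ‖wavePacket χ 0‖ * ‖g‖) ?_ (Eventually.of_forall fun x => ?_)
  · exact ((continuous_wavePacket χ).inner continuous_const).aestronglyMeasurable
  · rw [← norm_wavePacket χ x]
    exact norm_inner_le_norm _ _

/-- The map `g ↦ (x ↦ ∫ exp (2πi ⟨ξ, x⟩) χ(ξ) g(ξ) dξ)` from `L²` to `L²(m)`. -/
def bandlimitTrace : L2 →L[ℂ] Lp (α := Plane) ℂ 2 V.m :=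
  LinearMap.mkContinuous
    { toFun := fun g => (memLp_inner_wavePacket χ V g).toLp _
      map_add' := fun f g => by
        rw [← MemLp.toLp_add]
        congr 1
        funext x
        rw [inner_add_right]
        rfl
      map_smul' := fun c g => by
        rw [RingHom.id_apply, ← MemLp.toLp_const_smul]
        congr 1
        funext x
        rw [inner_smul_right]
        rfl }
    (measureUnivNNReal V.m ^ ((2 : ℝ≥0∞).toReal)⁻¹ * ‖wavePacket χ 0‖) fun g => by
      rw [mul_assoc]
      refine Lp.norm_le_of_ae_bound (by positivity) ?_
      filter_upwards [(memLp_inner_wavePacket χ V g).coeFn_toLp] with x hx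
      rw [LinearMap.coe_mk, AddHom.coe_mk, hx, ← norm_wavePacket χ x]
      exact norm_inner_le_norm _ _

/-- Both sides are continuous in `g`, so Schwartz functions suffice. There `χ φ` is again Schwartz,
`J` is restriction, and the values are given by pointwise Fourier inversion. -/
theorem J_bandlimit_eq (g : L2) : J V.m (bandlimit χ g) = bandlimitTrace χ V g := by
  have hd : DenseRange (SchwartzMap.toLpCLM ℝ (E := Plane) ℂ 2 (volume : Measure Plane)) :=
    SchwartzMap.denseRange_toLpCLM ENNReal.ofNat_ne_top
  refine hd.induction_on (p := fun g : L2 => J V.m (bandlimit χ g) = bandlimitTrace χ V g) g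
    (isClosed_eq ((J V.m).continuous.comp (bandlimit χ).continuous)
      (bandlimitTrace χ V).continuous) fun φ => ?_
  have hχs : ContDiff ℝ (⊤ : ℕ∞) fun ξ : Plane => ((χ ξ : ℝ) : ℂ) :=
    Complex.ofRealCLM.contDiff.comp χ.contDiff
  have hχt : Function.HasTemperateGrowth fun ξ : Plane => ((χ ξ : ℝ) : ℂ) :=
    ((hasCompactSupport_coe_bump χ).toSchwartzMap hχs).hasTemperateGrowth
  set ψ : 𝓢(Plane, ℂ) := SchwartzMap.smulLeftCLM ℂ (fun ξ : Plane => ((χ ξ : ℝ) : ℂ)) φ with hψ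
  have hψx : ∀ ξ, ψ ξ = ((χ ξ : ℝ) : ℂ) * φ ξ := fun ξ => by
    rw [hψ, SchwartzMap.smulLeftCLM_apply_apply hχt, smul_eq_mul]
  rw [SchwartzMap.toLpCLM_apply]
  have h1 : bandlimit χ (φ.toLp 2) = schwartzToH1 (𝓕⁻ ψ) := by
    apply H1.ext_fourier
    rw [fourier_toL2_schwartzToH1_fourierInv]
    filter_upwards [fourier_bandlimit χ (φ.toLp 2), φ.coeFn_toLp 2 volume, ψ.coeFn_toLp 2 volume]
      with ξ h1 h2 h3
    rw [h1, h2, h3, hψx]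
  rw [h1, V.J_schwartz]
  apply Lp.ext
  filter_upwards [(𝓕⁻ ψ : 𝓢(Plane, ℂ)).coeFn_toLp 2 V.m,
    (memLp_inner_wavePacket χ V (φ.toLp 2)).coeFn_toLp] with x h2 h3
  rw [h2, bandlimitTrace, LinearMap.mkContinuous_apply, LinearMap.coe_mk, AddHom.coe_mk, h3,
    inner_wavePacket, SchwartzMap.fourierInv_coe, Real.fourierInv_eq']
  refine integral_congr_ae ?_
  filter_upwards [φ.coeFn_toLp 2 volume] with ξ h4
  rw [h4, hψx, smul_eq_mul]
  congr 1
  change _ = (starRingEnd ℂ) (wave x ξ)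
  rw [wave, ← Complex.exp_conj, map_mul, Complex.conj_I, ← Complex.ofReal_neg, Complex.conj_ofReal]
  congr 1
  push_cast
  ring

theorem coeFn_J_bandlimit (g : L2) :
    J V.m (bandlimit χ g) =ᵐ[V.m] fun x => inner ℂ (wavePacket χ x) g := by
  rw [J_bandlimit_eq]
  exact (memLp_inner_wavePacket χ V g).coeFn_toLp

/-- The map `J` is compact on band-limited functions. -/
theorem exists_isCompactOperator_J_bandlimit : ∃ P : L2 →L[ℂ] L2, IsCompactOperator P ∧
    ∀ g, ‖J V.m (bandlimit χ g)‖ ^ 2 ≤ ‖g‖ * ‖P g‖ := by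
  -- The composition `J* J` on band-limited functions is `∫ R x dm`. The integrand is rank one and
  -- norm continuous, with constant norm, so the integral exists in operator norm and is compact.
  set R : Plane → L2 →L[ℂ] L2 := fun x =>
    InnerProductSpace.rankOne ℂ (wavePacket χ x) (wavePacket χ x) with hR
  set S : Submodule ℂ (L2 →L[ℂ] L2) :=
    { carrier := {P | IsCompactOperator P}
      add_mem' := fun h1 h2 => h1.add h2
      zero_mem' := isCompactOperator_zero
      smul_mem' := fun c P h => h.smul c } with hS
  have hcl : IsClosed (S : Set (L2 →L[ℂ] L2)) := isClosed_setOfPred_isCompactOperator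
  have hRc : Continuous R := by
    rw [hR]
    have h1 := continuous_wavePacket χ
    exact (ContinuousLinearMap.smulRightL ℂ L2 L2).continuous₂.comp
      (((innerSL ℂ (E := L2)).continuous.comp h1).prodMk h1)
  have hRS : ∀ x, R x ∈ S := fun x =>
    have h1 : IsCompactOperator (ContinuousLinearMap.toSpanSingleton ℂ (wavePacket χ x)) :=
      isCompactOperator_of_locallyCompactSpace_rng _
    h1.comp_clm (innerSL ℂ (wavePacket χ x))
  have hint : Integrable R V.m := by
    refine Integrable.of_bound hRc.aestronglyMeasurable (‖wavePacket χ 0‖ * ‖wavePacket χ 0‖)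
      (Eventually.of_forall fun x => ?_)
    rw [hR, InnerProductSpace.norm_rankOne, norm_wavePacket]
  have hmem : (∫ x, R x ∂V.m) ∈ S := integral_mem_of_isClosed hcl hint hRS
  refine ⟨∫ x, R x ∂V.m, hmem, fun g => ?_⟩
  have h1 : inner ℂ g ((∫ x, R x ∂V.m) g) =
      ((∫ x, ‖inner ℂ (wavePacket χ x) g‖ ^ 2 ∂V.m : ℝ) : ℂ) := by
    rw [ContinuousLinearMap.integral_apply hint, ← integral_inner (hint.apply_continuousLinearMap g), ← integral_complex_ofReal]
    refine integral_congr_ae (Eventually.of_forall fun x => ?_)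
    change inner ℂ g (inner ℂ (wavePacket χ x) g • wavePacket χ x) = _
    rw [inner_smul_right, ← inner_conj_symm g, Complex.mul_conj, Complex.normSq_eq_norm_sq]
  have h2 : ‖J V.m (bandlimit χ g)‖ ^ 2 = ∫ x, ‖inner ℂ (wavePacket χ x) g‖ ^ 2 ∂V.m := by
    rw [L2_norm_sq]
    refine integral_congr_ae ?_
    filter_upwards [coeFn_J_bandlimit χ V g] with x hx
    rw [hx]
  have h3 : ‖J V.m (bandlimit χ g)‖ ^ 2 = ‖inner ℂ g ((∫ x, R x ∂V.m) g)‖ := by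
    rw [h1, ← h2, Complex.norm_real, Real.norm_of_nonneg (by positivity)]
  rw [h3]
  -- `‖J g‖² = ⟨g, P g⟩` by `h3`; Cauchy–Schwarz leaves a bound linear in `‖P g‖`.
  exact norm_inner_le_norm _ _

end Trace

end SpinOrbit

/-! ### Solution operators of coercive forms -/

section FormResolvent

variable {Q K : Type*} [NormedAddCommGroup Q] [InnerProductSpace ℂ Q]
  [NormedAddCommGroup K] [InnerProductSpace ℂ K]

/-- Lax–Milgram: the solution operator of `B v u = ⟨ι v, f⟩` for a coercive form `B`. -/
theorem exists_form_resolvent [CompleteSpace Q] [CompleteSpace K] (ι : Q →L[ℂ] K) (B : Q →L⋆[ℂ] Q →L[ℂ] ℂ)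
    (hsym : ∀ u v, B u v = star (B v u)) {δ : ℝ} (hδ : 0 < δ)
    (hB : ∀ u, δ * ‖u‖ ^ 2 ≤ (B u u).re) :
    ∃ T : K →L[ℂ] Q, (∀ f v, B v (T f) = inner ℂ (ι v) f) ∧
      ∀ f u, (∀ v, B v u = inner ℂ (ι v) f) → u = T f := by
  set G : Q →L[ℂ] Q := InnerProductSpace.continuousLinearMapOfBilin B with hG
  have hGi : ∀ u v, inner ℂ (G u) v = B u v := fun u v =>
    InnerProductSpace.continuousLinearMapOfBilin_apply B u v
  have hGs : ∀ u v, inner ℂ v (G u) = B v u := fun u v => by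
    rw [← inner_conj_symm, hGi, hsym v u]
    rfl
  have hunit : IsUnit G := by
    refine ContinuousLinearMap.isUnit_of_forall_le_norm_inner_map G (c := ⟨δ, hδ.le⟩) hδ fun u => ?_
    rw [hGi, mul_comm]
    exact (hB u).trans (Complex.re_le_norm _)
  obtain ⟨g, hg⟩ := hunit
  have hgi : ∀ u, G ((g⁻¹ : (Q →L[ℂ] Q)ˣ).val u) = u := fun u => by
    have : (g.val * (g⁻¹ : (Q →L[ℂ] Q)ˣ).val) u = u := by rw [Units.mul_inv]; rfl
    rw [← hg]
    exact this
  refine ⟨(g⁻¹ : (Q →L[ℂ] Q)ˣ).val.comp (ContinuousLinearMap.adjoint ι), ?_, ?_⟩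
  · intro f v
    rw [← hGs, ContinuousLinearMap.comp_apply, hgi, ContinuousLinearMap.adjoint_inner_right]
  · intro f u h
    set u' := (g⁻¹ : (Q →L[ℂ] Q)ˣ).val.comp (ContinuousLinearMap.adjoint ι) f with hu'
    have h' : ∀ v, B v u' = inner ℂ (ι v) f := fun v => by
      rw [← hGs, hu', ContinuousLinearMap.comp_apply, hgi, ContinuousLinearMap.adjoint_inner_right]
    have h0 : B (u - u') (u - u') = 0 := by rw [map_sub (B (u - u')), h, h', sub_self]
    have h1 := hB (u - u')
    rw [h0, Complex.zero_re] at h1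
    have h2 : ‖u - u'‖ ^ 2 = 0 := le_antisymm (by nlinarith [sq_nonneg ‖u - u'‖]) (sq_nonneg _)
    exact sub_eq_zero.mp (norm_eq_zero.mp (pow_eq_zero_iff two_ne_zero |>.mp h2))

theorem isSymmetric_form_resolvent {ι : Q →L[ℂ] K} {B : Q →L⋆[ℂ] Q →L[ℂ] ℂ}
    (hsym : ∀ u v, B u v = star (B v u)) {T : K →L[ℂ] Q}
    (hT : ∀ f v, B v (T f) = inner ℂ (ι v) f) :
    ((ι.comp T : K →L[ℂ] K) : K →ₗ[ℂ] K).IsSymmetric := by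
  intro f g
  change inner ℂ (ι (T f)) g = inner ℂ f (ι (T g))
  rw [← hT, hsym, hT]
  exact inner_conj_symm _ _

/-- A vector on which the form is small has a large Rayleigh quotient for the solution operator. -/
theorem lt_re_inner_form_resolvent {ι : Q →L[ℂ] K} {B : Q →L⋆[ℂ] Q →L[ℂ] ℂ}
    (hsym : ∀ u v, B u v = star (B v u)) (hB : ∀ u, 0 ≤ (B u u).re) {T : K →L[ℂ] Q}
    (hT : ∀ f v, B v (T f) = inner ℂ (ι v) f) {s : ℝ} (hs : 0 < s) {u : Q}
    (hu : (B u u).re < s * ‖ι u‖ ^ 2) :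
    s⁻¹ * ‖ι u‖ ^ 2 < (inner ℂ (ι (T (ι u))) (ι u)).re := by
  set w := T (ι u) with hw
  -- Since `B u w = ‖ι u‖²`, positivity of `B` at `u - s • w` reads `0 ≤ B u u - 2 s ‖ι u‖² + s² ⟨ι
  -- w, ι u⟩` in real parts; this is the duality between a form and its inverse.
  have h1 := hB (u - (s : ℂ) • w)
  have h2 : B u w = ((‖ι u‖ ^ 2 : ℝ) : ℂ) := by
    rw [hw, hT, inner_self_eq_norm_sq_to_K]
    norm_cast
  have h3 : B w u = ((‖ι u‖ ^ 2 : ℝ) : ℂ) := by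
    rw [hsym, h2]
    exact Complex.conj_ofReal _
  have h4 : B w w = inner ℂ (ι w) (ι u) := by rw [hw, hT]
  have h5 : (B (u - (s : ℂ) • w) (u - (s : ℂ) • w)).re =
      (B u u).re - 2 * s * ‖ι u‖ ^ 2 + s ^ 2 * (inner ℂ (ι w) (ι u)).re := by
    have : B (u - (s : ℂ) • w) (u - (s : ℂ) • w) =
        B u u - (s : ℂ) * B u w - ((s : ℂ) * B w u - (s : ℂ) * ((s : ℂ) * B w w)) := by
      rw [map_sub B, map_smulₛₗ B]
      simp [mul_sub]
    rw [this, h2, h3, h4]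
    simp only [Complex.sub_re, Complex.re_ofReal_mul, Complex.ofReal_re]
    ring
  rw [h5] at h1
  rw [inv_mul_lt_iff₀ hs]
  have h6 : s * (s * (inner ℂ (ι w) (ι u)).re) > s * ‖ι u‖ ^ 2 := by nlinarith
  exact lt_of_mul_lt_mul_left h6 hs.le

end FormResolvent

namespace SpinOrbit

/-! ### Bounds for the symbol and the forms -/

namespace Coupling

variable (σ : Coupling)

/-- A number strictly between the limsup and 1 serves as `θ`, and continuity of `A` bounds it on the
remaining compact set. The strict gap below 1 is what makes the form of `H₀` coercive on `H¹`. -/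
theorem exists_norm_A_le : ∃ θ C : ℝ, 0 ≤ θ ∧ θ < 1 ∧ 0 ≤ C ∧ ∀ p, ‖σ.A p‖ ≤ θ * ‖p‖ ^ 2 + C := by
  obtain ⟨t, ht, ht1⟩ := exists_between σ.limsup_lt
  have htop : t ≠ ⊤ := ht1.ne_top
  set θ := t.toReal with hθ
  have hθ1 : θ < 1 := by
    rw [hθ, ← ENNReal.toReal_one]
    exact (ENNReal.toReal_lt_toReal htop ENNReal.one_ne_top).mpr ht1
  have hev : ∀ᶠ p in cocompact Plane, ‖σ.A p‖ ≤ θ * ‖p‖ ^ 2 := by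
    filter_upwards [eventually_lt_of_limsup_lt ht,
      (tendsto_norm_cocompact_atTop (E := Plane)).eventually_ge_atTop 1] with p hp hp1
    have h0 : ‖p‖ₑ ^ 2 ≠ 0 := by
      simp only [ne_eq, pow_eq_zero_iff two_ne_zero, enorm_eq_zero]
      rintro rfl
      simp at hp1
      linarith
    have h1 : ‖σ.A p‖ₑ ≤ t * ‖p‖ₑ ^ 2 := by
      have := (ENNReal.div_le_iff h0 (by finiteness)).mp hp.le
      exact this
    have h2 := ENNReal.toReal_mono (by finiteness) h1
    rw [ENNReal.toReal_mul, ENNReal.toReal_pow, toReal_enorm, toReal_enorm] at h2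
    exact h2
  obtain ⟨K, hK, hKs⟩ := mem_cocompact.mp hev
  obtain ⟨C, hC⟩ := hK.exists_bound_of_continuousOn σ.continuous.continuousOn
  have hθ0 : 0 ≤ θ := ENNReal.toReal_nonneg
  refine ⟨θ, max C 0, hθ0, hθ1, le_max_right _ _, fun p => ?_⟩
  by_cases hp : p ∈ K
  · exact (hC p hp).trans ((le_max_left _ _).trans (le_add_of_nonneg_left (by positivity)))
  · exact (hKs hp).trans (le_add_of_nonneg_right (le_max_right _ _))

theorem bddBelow_lambdaMinus : BddBelow (Set.range σ.lambdaMinus) := by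
  obtain ⟨C, -, hC⟩ := σ.norm_A_le
  refine ⟨-C, ?_⟩
  rintro _ ⟨p, rfl⟩
  rw [lambdaMinus]
  linarith [hC p]

theorem kappa_le (p : Plane) : σ.kappa ≤ σ.lambdaMinus p := ciInf_le σ.bddBelow_lambdaMinus p

/-- The quadratic form of `Ĥ₀(p)`. -/
def quad (p : Plane) (z w : Fin 2 → ℂ) : ℂ := star z ⬝ᵥ (σ.symbol p).mulVec w

theorem quad_eq (p : Plane) (z w : Fin 2 → ℂ) : σ.quad p z w =
    star (z 0) * (((‖p‖ ^ 2 : ℝ) : ℂ) * w 0 + σ.A p * w 1) +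
      star (z 1) * (star (σ.A p) * w 0 + ((‖p‖ ^ 2 : ℝ) : ℂ) * w 1) := by
  simp [quad, symbol, dotProduct, Matrix.mulVec, Fin.sum_univ_two]

theorem quad_symm (p : Plane) (z w : Fin 2 → ℂ) : σ.quad p z w = star (σ.quad p w z) := by
  rw [quad_eq, quad_eq]
  simp only [star_add, star_mul', Complex.star_def, Complex.conj_ofReal, Complex.conj_conj]
  ring

/-- `λ₋(p)` is the lower eigenvalue of the symbol; the off-diagonal term is absorbed by `2 |z₀| |z₁|
≤ |z₀|² + |z₁|²`. -/
theorem lambdaMinus_le_quad (p : Plane) (z : Fin 2 → ℂ) :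
    σ.lambdaMinus p * ∑ i, ‖z i‖ ^ 2 ≤ (σ.quad p z z).re := by
  have h1 : (σ.quad p z z).re = ‖p‖ ^ 2 * ∑ i, ‖z i‖ ^ 2 +
      2 * (star (z 0) * (σ.A p * z 1)).re := by
    rw [quad_eq, Fin.sum_univ_two]
    simp only [Complex.star_def, ← Complex.normSq_eq_norm_sq, Complex.normSq_apply,
      Complex.add_re, Complex.mul_re, Complex.mul_im, Complex.conj_re, Complex.conj_im,
      Complex.ofReal_re, Complex.ofReal_im, Complex.add_im]
    ring
  have h2 : -(‖z 0‖ * (‖σ.A p‖ * ‖z 1‖)) ≤ (star (z 0) * (σ.A p * z 1)).re := by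
    refine neg_le_of_abs_le ((Complex.abs_re_le_norm _).trans (le_of_eq ?_))
    rw [norm_mul, norm_mul, norm_star]
  rw [h1, lambdaMinus, Fin.sum_univ_two]
  nlinarith [mul_nonneg (norm_nonneg (σ.A p)) (sq_nonneg (‖z 0‖ - ‖z 1‖))]

theorem norm_quad_le {C : ℝ} {p : Plane} (hC : ∀ i j, ‖σ.symbol p i j‖ ≤ C) (z w : Fin 2 → ℂ) :
    ‖σ.quad p z w‖ ≤ C * ∑ i, (‖z i‖ ^ 2 + ‖w i‖ ^ 2) := by
  have hC0 : 0 ≤ C := (norm_nonneg _).trans (hC 0 0)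
  calc ‖σ.quad p z w‖ ≤ ∑ i, ∑ j, ‖z i‖ * (C * ‖w j‖) := by
        simp only [quad, dotProduct, Matrix.mulVec, Pi.star_apply, Finset.mul_sum]
        refine (norm_sum_le _ _).trans (Finset.sum_le_sum fun i _ => (norm_sum_le _ _).trans
          (Finset.sum_le_sum fun j _ => ?_))
        rw [norm_mul, norm_mul, norm_star]
        gcongr
        exact hC i j
    _ ≤ _ := by
        simp only [Fin.sum_univ_two]
        nlinarith [mul_nonneg hC0 (sq_nonneg (‖z 0‖ - ‖w 0‖)),
          mul_nonneg hC0 (sq_nonneg (‖z 0‖ - ‖w 1‖)), mul_nonneg hC0 (sq_nonneg (‖z 1‖ - ‖w 0‖)),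
          mul_nonneg hC0 (sq_nonneg (‖z 1‖ - ‖w 1‖))]

/-- The Fourier transform of a spinor in `H¹(ℝ²) ⊗ ℂ²`. -/
def _root_.SpinOrbit.hat (u : Fin 2 → H1) (ξ : Plane) : Fin 2 → ℂ :=
  fun i => (𝓕 (H1.toL2 (u i)) : L2) ξ

theorem form₀_eq (u v : Fin 2 → H1) :
    σ.form₀ u v = ∫ ξ, σ.quad ((2 * Real.pi) • ξ) (hat u ξ) (hat v ξ) := rfl

theorem integrable_quad (u v : Fin 2 → H1) :
    Integrable fun ξ => σ.quad ((2 * Real.pi) • ξ) (hat u ξ) (hat v ξ) := σ.integrable_form₀ u v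

theorem form₀_symm (u v : Fin 2 → H1) : σ.form₀ u v = star (σ.form₀ v u) := by
  rw [form₀_eq, form₀_eq, Complex.star_def, ← integral_conj]
  exact integral_congr_ae (Eventually.of_forall fun ξ => σ.quad_symm _ _ _)

theorem norm_form₀_le : ∃ C, 0 ≤ C ∧ ∀ u v : Fin 2 → H1,
    ‖σ.form₀ u v‖ ≤ C * ∑ i, (‖u i‖ ^ 2 + ‖v i‖ ^ 2) := by
  obtain ⟨C, hC0, hC⟩ := σ.norm_symbol_le
  refine ⟨C + 1, by positivity, fun u v => ?_⟩
  have hw : ∀ ξ i j, ‖σ.symbol ((2 * Real.pi) • ξ) i j‖ ≤ (C + 1) * (weight ξ : ℝ) := by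
    intro ξ i j
    refine (hC _ i j).trans ?_
    have h1 : (weight ξ : ℝ) = 1 + (2 * Real.pi * ‖ξ‖) ^ 2 := rfl
    rw [norm_smul, Real.norm_of_nonneg Real.two_pi_pos.le, h1]
    nlinarith [sq_nonneg (2 * Real.pi * ‖ξ‖), mul_nonneg hC0 (sq_nonneg (2 * Real.pi * ‖ξ‖))]
  have hint : ∀ i, Integrable fun ξ : Plane =>
      (C + 1) * ((weight ξ : ℝ) * ‖hat u ξ i‖ ^ 2 + (weight ξ : ℝ) * ‖hat v ξ i‖ ^ 2) := fun i =>
    ((H1.integrable_weight (u i)).add (H1.integrable_weight (v i))).const_mul _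
  calc ‖σ.form₀ u v‖ ≤ ∫ ξ, ∑ i, (C + 1) *
        ((weight ξ : ℝ) * ‖hat u ξ i‖ ^ 2 + (weight ξ : ℝ) * ‖hat v ξ i‖ ^ 2) := by
        rw [form₀_eq]
        refine norm_integral_le_of_norm_le (integrable_finsetSum _ fun i _ => hint i)
          (Eventually.of_forall fun ξ => (σ.norm_quad_le (hw ξ) _ _).trans (le_of_eq ?_))
        rw [Finset.mul_sum]
        refine Finset.sum_congr rfl fun i _ => ?_
        ring
    _ = _ := by
        rw [integral_finsetSum _ fun i _ => hint i, Finset.mul_sum]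
        refine Finset.sum_congr rfl fun i _ => ?_
        rw [integral_const_mul, H1.norm_sq, H1.norm_sq,
          ← integral_add (H1.integrable_weight (u i)) (H1.integrable_weight (v i))]
        rfl

theorem _root_.SpinOrbit.inner_spinorIncl (u v : Fin 2 → H1) :
    inner ℂ (spinorIncl u) (spinorIncl v) = ∫ ξ, star (hat u ξ) ⬝ᵥ hat v ξ := by
  have hi : ∀ i, inner ℂ (H1.toL2 (u i)) (H1.toL2 (v i)) =
      ∫ ξ, star (hat u ξ i) * hat v ξ i := fun i => by
    rw [← Lp.inner_fourier_eq, L2.inner_def]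
    refine integral_congr_ae (Eventually.of_forall fun ξ => ?_)
    change inner ℂ (hat u ξ i) (hat v ξ i) = _
    rw [RCLike.inner_apply, mul_comm]
    rfl
  have hint : ∀ i, Integrable fun ξ => star (hat u ξ i) * hat v ξ i := fun i =>
    (Lp.memLp (𝓕 (H1.toL2 (u i)) : L2)).star.integrable_mul (Lp.memLp (𝓕 (H1.toL2 (v i)) : L2))
  rw [PiLp.inner_apply]
  simp only [dotProduct, Pi.star_apply]
  rw [integral_finsetSum _ fun i _ => hint i]
  exact Finset.sum_congr rfl fun i _ => hi i

theorem _root_.SpinOrbit.integrable_dotProduct_hat (u v : Fin 2 → H1) :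
    Integrable fun ξ => star (hat u ξ) ⬝ᵥ hat v ξ := by
  simp only [dotProduct, Pi.star_apply]
  exact integrable_finsetSum _ fun i _ =>
    (Lp.memLp (𝓕 (H1.toL2 (u i)) : L2)).star.integrable_mul (Lp.memLp (𝓕 (H1.toL2 (v i)) : L2))

theorem _root_.SpinOrbit.norm_spinorIncl_sq (u : Fin 2 → H1) :
    ‖spinorIncl u‖ ^ 2 = ∑ i, ‖H1.toL2 (u i)‖ ^ 2 := by
  rw [PiLp.norm_sq_eq_of_L2]
  rfl

theorem _root_.SpinOrbit.norm_spinorIncl_sq_eq_integral (u : Fin 2 → H1) :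
    ‖spinorIncl u‖ ^ 2 = ∫ ξ, ∑ i, ‖hat u ξ i‖ ^ 2 := by
  have hint : ∀ i, Integrable fun ξ => ‖hat u ξ i‖ ^ 2 := fun i => L2_integrable_sq _
  rw [norm_spinorIncl_sq, integral_finsetSum _ fun i _ => hint i]
  refine Finset.sum_congr rfl fun i _ => ?_
  rw [← norm_fourier_toL2, L2_norm_sq]
  rfl

/-- Pointwise in momentum, `(1 - θ)(1 + |p|²) ≤ λ₋(p) + C + 1`, and `1 + |p|²` is the weight of the
`H¹` norm. -/
theorem le_re_form₀ {θ C : ℝ} (hθ0 : 0 ≤ θ) (hC : ∀ p, ‖σ.A p‖ ≤ θ * ‖p‖ ^ 2 + C)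
    (u : Fin 2 → H1) :
    (1 - θ) * ∑ i, ‖u i‖ ^ 2 ≤ (σ.form₀ u u).re + (C + 1) * ‖spinorIncl u‖ ^ 2 := by
  have hi1 : ∀ i, Integrable fun ξ : Plane => (weight ξ : ℝ) * ‖hat u ξ i‖ ^ 2 := fun i =>
    H1.integrable_weight (u i)
  have hi2 : Integrable fun ξ : Plane => ∑ i, ‖hat u ξ i‖ ^ 2 :=
    integrable_finsetSum _ fun i _ => L2_integrable_sq _
  have hi3 : Integrable fun ξ : Plane => ∑ i, (weight ξ : ℝ) * ‖hat u ξ i‖ ^ 2 :=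
    integrable_finsetSum _ fun i _ => hi1 i
  have h1 : ∑ i, ‖u i‖ ^ 2 = ∫ ξ, ∑ i, (weight ξ : ℝ) * ‖hat u ξ i‖ ^ 2 := by
    rw [integral_finsetSum _ fun i _ => hi1 i]
    exact Finset.sum_congr rfl fun i _ => H1.norm_sq _
  have hq : Integrable fun ξ => (σ.quad ((2 * Real.pi) • ξ) (hat u ξ) (hat u ξ)).re :=
    (σ.integrable_quad u u).re
  have h2 : (σ.form₀ u u).re = ∫ ξ, (σ.quad ((2 * Real.pi) • ξ) (hat u ξ) (hat u ξ)).re := by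
    rw [form₀_eq]
    exact (integral_re (σ.integrable_quad u u)).symm
  rw [h1, h2, norm_spinorIncl_sq_eq_integral, ← integral_const_mul, ← integral_const_mul,
    ← integral_add hq (hi2.const_mul _)]
  refine integral_mono (hi3.const_mul _) (hq.add (hi2.const_mul _)) fun ξ => ?_
  have h3 := σ.lambdaMinus_le_quad ((2 * Real.pi) • ξ) (hat u ξ)
  have h4 := hC ((2 * Real.pi) • ξ)
  have h5 : (weight ξ : ℝ) = 1 + ‖(2 * Real.pi) • ξ‖ ^ 2 := by
    rw [norm_smul, Real.norm_of_nonneg Real.two_pi_pos.le]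
    rfl
  have h6 : 0 ≤ ∑ i, ‖hat u ξ i‖ ^ 2 := Finset.sum_nonneg fun i _ => by positivity
  rw [lambdaMinus] at h3
  simp only [← Finset.mul_sum]
  rw [h5]
  set s := ∑ i, ‖hat u ξ i‖ ^ 2
  nlinarith [mul_le_mul_of_nonneg_right h4 h6]

theorem form₀_coercive : ∃ δ C : ℝ, 0 < δ ∧ 0 ≤ C ∧ ∀ u : Fin 2 → H1,
    δ * ∑ i, ‖u i‖ ^ 2 ≤ (σ.form₀ u u).re + C * ‖spinorIncl u‖ ^ 2 := by
  obtain ⟨θ, C, hθ0, hθ1, hC0, hC⟩ := σ.exists_norm_A_le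
  exact ⟨1 - θ, C + 1, by linarith, by positivity, σ.le_re_form₀ hθ0 hC⟩

end Coupling

namespace Perturbation

variable (V : Perturbation)

theorem form_symm (u v : Fin 2 → H1) : V.form u v = star (V.form v u) := by
  rw [form, form, Complex.star_def, ← integral_conj]
  refine integral_congr_ae (Eventually.of_forall fun x => ?_)
  simp only [dotProduct, Pi.star_apply, Complex.star_def, map_mul, map_sum, Complex.conj_ofReal,
    Complex.conj_conj]
  congr 1
  exact Finset.sum_congr rfl fun i _ => mul_comm _ _

theorem _root_.SpinOrbit.integral_norm_mul_norm_le {μ : Measure Plane}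
    (f g : Lp (α := Plane) ℂ 2 μ) : ∫ x, ‖f x‖ * ‖g x‖ ∂μ ≤ ‖f‖ * ‖g‖ := by
  have h := integral_mul_norm_le_Lp_mul_Lq (μ := μ) (p := 2) (q := 2) (f := f) (g := g)
    Real.HolderConjugate.two_two (by simpa using Lp.memLp f) (by simpa using Lp.memLp g)
  refine h.trans (le_of_eq ?_)
  have h2 : ∀ f : Lp (α := Plane) ℂ 2 μ, (∫ x, ‖f x‖ ^ (2 : ℝ) ∂μ) ^ ((1 : ℝ) / 2) = ‖f‖ := by
    intro f
    rw [← Real.sqrt_eq_rpow]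
    simp only [Real.rpow_two]
    rw [← L2_norm_sq, Real.sqrt_sq (norm_nonneg _)]
  rw [h2, h2]

theorem norm_form_le : ∃ C, 0 ≤ C ∧ ∀ u v : Fin 2 → H1,
    ‖V.form u v‖ ≤ C * ∑ i, ‖J V.m (u i)‖ * ‖J V.m (v i)‖ := by
  obtain ⟨C, hC⟩ := V.bounded
  have hC0 : 0 ≤ C := (abs_nonneg _).trans (hC 0)
  refine ⟨C, hC0, fun u v => ?_⟩
  have hint : ∀ i, Integrable (fun x => C * (‖J V.m (u i) x‖ * ‖J V.m (v i) x‖)) V.m := fun i =>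
    ((Lp.memLp (J V.m (u i))).norm.integrable_mul (Lp.memLp (J V.m (v i))).norm).const_mul C
  calc ‖V.form u v‖ ≤ ∫ x, ∑ i, C * (‖J V.m (u i) x‖ * ‖J V.m (v i) x‖) ∂V.m := by
        rw [form]
        refine norm_integral_le_of_norm_le (integrable_finsetSum _ fun i _ => hint i)
          (Eventually.of_forall fun x => ?_)
        rw [norm_mul, Complex.norm_real, ← Finset.mul_sum]
        refine mul_le_mul (hC x) ?_ (norm_nonneg _) hC0
        simp only [dotProduct, Pi.star_apply]
        refine (norm_sum_le _ _).trans (Finset.sum_le_sum fun i _ => ?_)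
        rw [norm_mul, norm_star]
    _ ≤ _ := by
        rw [integral_finsetSum _ fun i _ => hint i, Finset.mul_sum]
        refine Finset.sum_le_sum fun i _ => ?_
        rw [integral_const_mul]
        exact mul_le_mul_of_nonneg_left (integral_norm_mul_norm_le _ _) hC0

end Perturbation


/-! ### The form domain and the resolvent of `H₀ + ν` -/

/-- The form domain `H¹(ℝ²) ⊗ ℂ²` as a Hilbert space. -/
def FormDomain : Type := PiLp 2 (fun _ : Fin 2 => H1)

namespace FormDomain

instance : NormedAddCommGroup FormDomain :=
  inferInstanceAs (NormedAddCommGroup (PiLp 2 (fun _ : Fin 2 => H1)))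

instance : InnerProductSpace ℂ FormDomain :=
  inferInstanceAs (InnerProductSpace ℂ (PiLp 2 (fun _ : Fin 2 => H1)))

instance : CompleteSpace FormDomain :=
  inferInstanceAs (CompleteSpace (PiLp 2 (fun _ : Fin 2 => H1)))

/-- The form domain as a space of pairs. -/
def equiv : FormDomain ≃ₗ[ℂ] (Fin 2 → H1) := WithLp.linearEquiv 2 ℂ (Fin 2 → H1)

/-- The components of an element of the form domain. -/
def fn (u : FormDomain) : Fin 2 → H1 := equiv u

/-- The element of the form domain with given components. -/
def mk (u : Fin 2 → H1) : FormDomain := equiv.symm u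

theorem fn_mk (u : Fin 2 → H1) : (mk u).fn = u := equiv.apply_symm_apply u

theorem fn_add (u v : FormDomain) : (u + v).fn = u.fn + v.fn := map_add equiv u v

theorem fn_smul (c : ℂ) (u : FormDomain) : (c • u).fn = c • u.fn := map_smul equiv c u

theorem norm_sq (u : FormDomain) : ‖u‖ ^ 2 = ∑ i, ‖u.fn i‖ ^ 2 :=
  PiLp.norm_sq_eq_of_L2 (fun _ : Fin 2 => H1) u

theorem norm_apply_le (u : FormDomain) (i : Fin 2) : ‖u.fn i‖ ≤ ‖u‖ :=
  PiLp.norm_apply_le (β := fun _ : Fin 2 => H1) u i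

/-- The components as continuous linear maps. -/
def proj (i : Fin 2) : FormDomain →L[ℂ] H1 :=
  ((LinearMap.proj i).comp equiv.toLinearMap).mkContinuous 1 fun u => by
    rw [one_mul]
    exact u.norm_apply_le i

end FormDomain

theorem norm_spinorIncl_le (u : FormDomain) : ‖spinorIncl u.fn‖ ≤ ‖u‖ := by
  rw [← sq_le_sq₀ (norm_nonneg _) (norm_nonneg _), norm_spinorIncl_sq, FormDomain.norm_sq]
  exact Finset.sum_le_sum fun i _ =>
    pow_le_pow_left₀ (norm_nonneg _) (H1.norm_toL2_le _) 2

/-- The inclusion of the form domain into `L²(ℝ²) ⊗ ℂ²`. -/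
def formIncl : FormDomain →L[ℂ] Spinor :=
  LinearMap.mkContinuous (spinorIncl ∘ₗ FormDomain.equiv.toLinearMap) 1
    fun u => by
      rw [one_mul]
      exact norm_spinorIncl_le u

theorem formIncl_apply (u : FormDomain) : formIncl u = spinorIncl u.fn := rfl

variable (σ : Coupling) (V : Perturbation)

/-- The shifted form `q + c`. -/
def shiftedForm (c : ℝ) (u v : FormDomain) : ℂ :=
  form σ V u.fn v.fn + c * inner ℂ (spinorIncl u.fn) (spinorIncl v.fn)

theorem shiftedForm_symm (c : ℝ) (u v : FormDomain) :
    shiftedForm σ V c u v = star (shiftedForm σ V c v u) := by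
  rw [shiftedForm, shiftedForm, form, form, σ.form₀_symm, V.form_symm, ← inner_conj_symm]
  simp

theorem shiftedForm_add_right (c : ℝ) (u v w : FormDomain) :
    shiftedForm σ V c u (v + w) = shiftedForm σ V c u v + shiftedForm σ V c u w := by
  simp only [shiftedForm, form, FormDomain.fn_add, σ.form₀_add, V.form_add, map_add, inner_add_right]
  ring

theorem shiftedForm_smul_right (c : ℝ) (a : ℂ) (u v : FormDomain) :
    shiftedForm σ V c u (a • v) = a * shiftedForm σ V c u v := by
  simp only [shiftedForm, form, FormDomain.fn_smul, σ.form₀_smul, V.form_smul, map_smul,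
    inner_smul_right]
  ring

theorem shiftedForm_add_left (c : ℝ) (u v w : FormDomain) :
    shiftedForm σ V c (u + v) w = shiftedForm σ V c u w + shiftedForm σ V c v w := by
  rw [shiftedForm_symm, shiftedForm_add_right, star_add, ← shiftedForm_symm, ← shiftedForm_symm]

theorem shiftedForm_smul_left (c : ℝ) (a : ℂ) (u v : FormDomain) :
    shiftedForm σ V c (a • u) v = star a * shiftedForm σ V c u v := by
  rw [shiftedForm_symm, shiftedForm_smul_right, star_mul', ← shiftedForm_symm]

theorem norm_J_apply_le (u : FormDomain) (i : Fin 2) : ‖J V.m (u.fn i)‖ ≤ ‖J V.m‖ * ‖u‖ :=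
  ((J V.m).le_opNorm _).trans (mul_le_mul_of_nonneg_left (u.norm_apply_le i) (J V.m).opNorm_nonneg)

theorem sum_norm_J_le (u v : FormDomain) :
    ∑ i, ‖J V.m (u.fn i)‖ * ‖J V.m (v.fn i)‖ ≤ ‖J V.m‖ ^ 2 * (‖u‖ ^ 2 + ‖v‖ ^ 2) := by
  have h : ∀ i, ‖J V.m (u.fn i)‖ * ‖J V.m (v.fn i)‖ ≤ (‖J V.m‖ * ‖u‖) * (‖J V.m‖ * ‖v‖) := fun i =>
    mul_le_mul (norm_J_apply_le V u i) (norm_J_apply_le V v i) (norm_nonneg _)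
      (mul_nonneg (J V.m).opNorm_nonneg (norm_nonneg _))
  rw [Fin.sum_univ_two]
  refine (add_le_add (h 0) (h 1)).trans ?_
  generalize ‖J V.m‖ = j
  generalize ‖u‖ = a
  generalize ‖v‖ = b
  nlinarith [mul_nonneg (sq_nonneg j) (sq_nonneg (a - b))]

theorem norm_inner_spinorIncl_le (u v : FormDomain) :
    ‖inner ℂ (spinorIncl u.fn) (spinorIncl v.fn)‖ ≤ ‖u‖ ^ 2 + ‖v‖ ^ 2 := by
  have a1 := mul_le_mul (norm_spinorIncl_le u) (norm_spinorIncl_le v) (norm_nonneg _)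
    (norm_nonneg u)
  refine (norm_inner_le_norm _ _).trans (a1.trans ?_)
  generalize ‖u‖ = a
  generalize ‖v‖ = b
  nlinarith [sq_nonneg (a - b), sq_nonneg a, sq_nonneg b]

theorem exists_norm_shiftedForm_le_add (c : ℝ) :
    ∃ C, ∀ u v : FormDomain, ‖shiftedForm σ V c u v‖ ≤ C * (‖u‖ ^ 2 + ‖v‖ ^ 2) := by
  obtain ⟨C₁, h₁0, h₁⟩ := σ.norm_form₀_le
  obtain ⟨C₂, h₂0, h₂⟩ := V.norm_form_le
  refine ⟨C₁ + C₂ * ‖J V.m‖ ^ 2 + |c|, fun u v => ?_⟩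
  have e1 : ‖σ.form₀ u.fn v.fn‖ ≤ C₁ * (‖u‖ ^ 2 + ‖v‖ ^ 2) := by
    rw [FormDomain.norm_sq, FormDomain.norm_sq, ← Finset.sum_add_distrib]
    exact h₁ _ _
  have e2 : ‖V.form u.fn v.fn‖ ≤ C₂ * (‖J V.m‖ ^ 2 * (‖u‖ ^ 2 + ‖v‖ ^ 2)) :=
    (h₂ _ _).trans (mul_le_mul_of_nonneg_left (sum_norm_J_le V u v) h₂0)
  have e3 : ‖(c : ℂ) * inner ℂ (spinorIncl u.fn) (spinorIncl v.fn)‖ ≤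
      |c| * (‖u‖ ^ 2 + ‖v‖ ^ 2) := by
    rw [norm_mul, Complex.norm_real, Real.norm_eq_abs]
    exact mul_le_mul_of_nonneg_left (norm_inner_spinorIncl_le u v) (abs_nonneg _)
  have e4 := (norm_add_le _ _).trans (add_le_add ((norm_add_le _ _).trans (add_le_add e1 e2)) e3)
  refine le_trans e4 (le_of_eq ?_)
  ring

theorem FormDomain.exists_smul_eq (u : FormDomain) : ∃ w : FormDomain, ‖w‖ ≤ 1 ∧ u = (‖u‖ : ℂ) • w := by
  by_cases hu : ‖u‖ = 0
  · exact ⟨0, by simp, by rw [norm_eq_zero.mp hu, smul_zero]⟩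
  · refine ⟨((‖u‖⁻¹ : ℝ) : ℂ) • u, ?_, ?_⟩
    · rw [norm_smul, Complex.norm_real, norm_inv, norm_norm, inv_mul_cancel₀ hu]
    · rw [smul_smul, ← Complex.ofReal_mul, mul_inv_cancel₀ hu, Complex.ofReal_one, one_smul]

theorem exists_norm_shiftedForm_le (c : ℝ) :
    ∃ C, ∀ u v : FormDomain, ‖shiftedForm σ V c u v‖ ≤ C * ‖u‖ * ‖v‖ := by
  obtain ⟨D, hD⟩ := exists_norm_shiftedForm_le_add σ V c
  refine ⟨2 * max D 0, fun u v => ?_⟩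
  -- Homogeneity turns the additive bound by `‖u‖² + ‖v‖²` into a bound by the product `‖u‖ ‖v‖`.
  obtain ⟨u', hu', hu⟩ := u.exists_smul_eq
  obtain ⟨v', hv', hv⟩ := v.exists_smul_eq
  have h1 : ‖shiftedForm σ V c u' v'‖ ≤ 2 * max D 0 := by
    refine (hD u' v').trans ?_
    have h2 : ‖u'‖ ^ 2 + ‖v'‖ ^ 2 ≤ 2 := by
      linarith [pow_le_one₀ (n := 2) (norm_nonneg _) hu', pow_le_one₀ (n := 2) (norm_nonneg _) hv']
    calc D * (‖u'‖ ^ 2 + ‖v'‖ ^ 2) ≤ max D 0 * 2 := by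
          gcongr
          exact le_max_left _ _
      _ = _ := mul_comm _ _
  have h3 : shiftedForm σ V c u v = star (‖u‖ : ℂ) * ((‖v‖ : ℂ) * shiftedForm σ V c u' v') := by
    rw [← shiftedForm_smul_right, ← shiftedForm_smul_left, ← hu, ← hv]
  rw [h3, norm_mul, norm_mul, norm_star, Complex.norm_real, Complex.norm_real, norm_norm, norm_norm]
  calc ‖u‖ * (‖v‖ * ‖shiftedForm σ V c u' v'‖) ≤ ‖u‖ * (‖v‖ * (2 * max D 0)) := by gcongr
    _ = _ := by ring

/-- The shifted form as a bounded sesquilinear form. -/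
def shiftedFormL (c : ℝ) : FormDomain →L⋆[ℂ] FormDomain →L[ℂ] ℂ :=
  (LinearMap.mk₂'ₛₗ (starRingEnd ℂ) (RingHom.id ℂ) (shiftedForm σ V c)
    (shiftedForm_add_left σ V c) (shiftedForm_smul_left σ V c) (shiftedForm_add_right σ V c)
    (shiftedForm_smul_right σ V c)).mkContinuousOfExistsBound₂ (exists_norm_shiftedForm_le σ V c)

theorem shiftedFormL_apply (c : ℝ) (u v : FormDomain) :
    shiftedFormL σ V c u v = shiftedForm σ V c u v := rfl

variable {σ V}

/-- A fraction `1 - a` of the coercive form of `H₀` survives the perturbation. The shift is also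
taken at least `1 - κ`, so that `κ + c` is positive and can be inverted. -/
theorem IsRelativelyBounded.exists_coercive (h : IsRelativelyBounded σ V) :
    ∃ δ c : ℝ, 0 < δ ∧ 0 < σ.kappa + c ∧ ∀ u, δ * ‖u‖ ^ 2 ≤ (shiftedForm σ V c u u).re := by
  obtain ⟨a, b, ha, hab⟩ := h
  obtain ⟨δ, C, hδ, hC0, hC⟩ := σ.form₀_coercive
  have ha' : 0 < 1 - a := by linarith
  refine ⟨(1 - a) * δ, max ((1 - a) * C + b) (1 - σ.kappa), mul_pos ha' hδ, ?_, fun u => ?_⟩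
  · linarith [le_max_right ((1 - a) * C + b) (1 - σ.kappa)]
  set c := max ((1 - a) * C + b) (1 - σ.kappa) with hc
  have h1 := hC u.fn
  rw [← FormDomain.norm_sq] at h1
  have h2 : -(a * (σ.form₀ u.fn u.fn).re + b * ‖spinorIncl u.fn‖ ^ 2) ≤
      (V.form u.fn u.fn).re :=
    (neg_le_neg (hab u.fn)).trans (neg_le_of_abs_le (Complex.abs_re_le_norm _))
  have h3 : (inner ℂ (spinorIncl u.fn) (spinorIncl u.fn)).re = ‖spinorIncl u.fn‖ ^ 2 :=
    inner_self_eq_norm_sq (𝕜 := ℂ) (spinorIncl u.fn)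
  rw [shiftedForm, form, Complex.add_re, Complex.add_re, Complex.re_ofReal_mul, h3]
  have h4 : ((1 - a) * C + b) * ‖spinorIncl u.fn‖ ^ 2 ≤ c * ‖spinorIncl u.fn‖ ^ 2 :=
    mul_le_mul_of_nonneg_right (le_max_left _ _) (sq_nonneg _)
  nlinarith [mul_le_mul_of_nonneg_left h1 ha'.le]

/-! ### Band-limiting -/

section Bandlimit

variable (χ : ContDiffBump (0 : Plane))

/-- Band-limiting of spinors. -/
def bandlimitSpinor (u : FormDomain) : FormDomain :=
  FormDomain.mk fun i => bandlimit χ (𝓕 (H1.toL2 (u.fn i)))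

theorem hat_bandlimitSpinor (u : FormDomain) : ∀ᵐ ξ : Plane,
    hat (bandlimitSpinor χ u).fn ξ = ((χ ξ : ℝ) : ℂ) • hat u.fn ξ := by
  have h : ∀ᵐ ξ : Plane, ∀ i, hat (bandlimitSpinor χ u).fn ξ i =
      ((χ ξ : ℝ) : ℂ) * hat u.fn ξ i := ae_all_iff.mpr fun i => fourier_bandlimit χ _
  filter_upwards [h] with ξ hξ
  funext i
  exact hξ i

theorem re_dotProduct_self (z : Fin 2 → ℂ) : (star z ⬝ᵥ z).re = ∑ i, ‖z i‖ ^ 2 := by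
  simp only [dotProduct, Pi.star_apply, Complex.re_sum]
  refine Finset.sum_congr rfl fun i _ => ?_
  rw [Complex.star_def, mul_comm, Complex.mul_conj, Complex.ofReal_re, Complex.normSq_eq_norm_sq]

theorem star_smul_dotProduct (t : ℝ) (z w : Fin 2 → ℂ) :
    (star ((t : ℂ) • z) ⬝ᵥ w).re = t * (star z ⬝ᵥ w).re := by
  rw [star_smul, smul_dotProduct, Complex.star_def, Complex.conj_ofReal, smul_eq_mul,
    Complex.re_ofReal_mul]

/-- In momentum space this is `χ² ≤ χ`. -/
theorem norm_sq_bandlimitSpinor_le (u : FormDomain) : ‖spinorIncl (bandlimitSpinor χ u).fn‖ ^ 2 ≤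
    (inner ℂ (spinorIncl (bandlimitSpinor χ u).fn) (spinorIncl u.fn)).re := by
  rw [norm_spinorIncl_sq_eq_integral, inner_spinorIncl]
  refine le_trans (integral_mono_ae (integrable_finsetSum _ fun i _ => L2_integrable_sq _)
    (integrable_dotProduct_hat _ _).re ?_) (le_of_eq (integral_re (integrable_dotProduct_hat _ _)))
  filter_upwards [hat_bandlimitSpinor χ u] with ξ hξ
  rw [hξ]
  change _ ≤ (_ : ℂ).re
  rw [star_smul_dotProduct, re_dotProduct_self, Finset.mul_sum]
  refine Finset.sum_le_sum fun i _ => ?_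
  rw [Pi.smul_apply, smul_eq_mul, norm_mul, Complex.norm_real, Real.norm_of_nonneg χ.nonneg,
    mul_pow]
  refine mul_le_mul_of_nonneg_right ?_ (sq_nonneg _)
  nlinarith [χ.le_one (x := ξ), χ.nonneg (x := ξ)]

/-- The cutoff is a nonnegative scalar in momentum space, so it multiplies the pointwise inequality
`κ |û|² ≤ ⟨û, Ĥ₀ û⟩` without producing commutators. -/
theorem kappa_mul_le_form₀_bandlimitSpinor (u : FormDomain) :
    σ.kappa * (inner ℂ (spinorIncl (bandlimitSpinor χ u).fn) (spinorIncl u.fn)).re ≤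
      (σ.form₀ (bandlimitSpinor χ u).fn u.fn).re := by
  rw [inner_spinorIncl, σ.form₀_eq]
  have e1 := integral_re (𝕜 := ℂ) (integrable_dotProduct_hat (bandlimitSpinor χ u).fn u.fn)
  have e2 := integral_re (𝕜 := ℂ) (σ.integrable_quad (bandlimitSpinor χ u).fn u.fn)
  simp only [RCLike.re_to_complex] at e1 e2
  rw [← e1, ← e2, ← integral_const_mul]
  refine integral_mono_ae ((integrable_dotProduct_hat _ _).re.const_mul _)
    (σ.integrable_quad _ _).re ?_
  filter_upwards [hat_bandlimitSpinor χ u] with ξ hξ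
  have h1 := σ.lambdaMinus_le_quad ((2 * Real.pi) • ξ) (hat u.fn ξ)
  have h2 := σ.kappa_le ((2 * Real.pi) • ξ)
  have h3 : 0 ≤ ∑ i, ‖hat u.fn ξ i‖ ^ 2 := Finset.sum_nonneg fun i _ => by positivity
  rw [hξ, Coupling.quad, star_smul_dotProduct, star_smul_dotProduct, re_dotProduct_self,
    mul_left_comm]
  exact mul_le_mul_of_nonneg_left ((mul_le_mul_of_nonneg_right h2 h3).trans h1) χ.nonneg

/-- The removed part lives on `‖ξ‖ > χ.rIn`, where the `H¹` weight exceeds `χ.rIn²`. A large cutoff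
therefore loses little in `L²`. -/
theorem norm_sub_bandlimitSpinor_le (u : FormDomain) :
    χ.rIn * ‖spinorIncl u.fn - spinorIncl (bandlimitSpinor χ u).fn‖ ≤ ‖u‖ := by
  have hr := χ.rIn_pos
  rw [← sq_le_sq₀ (by positivity) (norm_nonneg _), mul_pow, ← map_sub, FormDomain.norm_sq,
    norm_spinorIncl_sq, Finset.mul_sum]
  refine Finset.sum_le_sum fun i _ => ?_
  rw [← norm_fourier_toL2, L2_norm_sq, H1.norm_sq, ← integral_const_mul]
  refine integral_mono_ae ((L2_integrable_sq _).const_mul _) (H1.integrable_weight _) ?_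
  have h1 : (𝓕 (H1.toL2 ((u.fn - (bandlimitSpinor χ u).fn) i)) : L2) =
      𝓕 (H1.toL2 (u.fn i)) - 𝓕 (H1.toL2 ((bandlimitSpinor χ u).fn i)) := by
    rw [Pi.sub_apply, map_sub]
    exact fourierL.map_sub _ _
  rw [h1]
  filter_upwards [fourier_bandlimit χ (𝓕 (H1.toL2 (u.fn i))),
    Lp.coeFn_sub (𝓕 (H1.toL2 (u.fn i)) : L2) (𝓕 (H1.toL2 ((bandlimitSpinor χ u).fn i)))] with ξ h2 h3
  change (𝓕 (H1.toL2 ((bandlimitSpinor χ u).fn i)) : L2) ξ = _ at h2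
  rw [h3, Pi.sub_apply, h2]
  have h4 : (weight ξ : ℝ) = 1 + (2 * Real.pi * ‖ξ‖) ^ 2 := rfl
  by_cases hξ : ‖ξ‖ ≤ χ.rIn
  · rw [χ.one_of_mem_closedBall (mem_closedBall_zero_iff.mpr hξ), Complex.ofReal_one, one_mul,
      sub_self, norm_zero]
    simp only [ne_eq, OfNat.ofNat_ne_zero, not_false_eq_true, zero_pow, mul_zero]
    positivity
  · have h5 : (𝓕 (H1.toL2 (u.fn i)) : L2) ξ - ((χ ξ : ℝ) : ℂ) * (𝓕 (H1.toL2 (u.fn i)) : L2) ξ =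
        ((1 - χ ξ : ℝ) : ℂ) * (𝓕 (H1.toL2 (u.fn i)) : L2) ξ := by
      push_cast
      ring
    have h6 : 0 ≤ 1 - χ ξ := sub_nonneg.mpr χ.le_one
    have h7 : 1 - χ ξ ≤ 1 := by linarith [χ.nonneg (x := ξ)]
    rw [h5, norm_mul, Complex.norm_real, Real.norm_of_nonneg h6, mul_pow, ← mul_assoc, h4]
    refine mul_le_mul_of_nonneg_right ?_ (sq_nonneg _)
    have h8 : χ.rIn ≤ 2 * Real.pi * ‖ξ‖ := by
      nlinarith [Real.pi_gt_three, norm_nonneg ξ]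
    calc χ.rIn ^ 2 * (1 - χ ξ) ^ 2 ≤ (2 * Real.pi * ‖ξ‖) ^ 2 * 1 ^ 2 := by gcongr
      _ ≤ _ := by linarith

end Bandlimit


/-! ### The spectrum below `κ` -/

variable {σ : Coupling} {V : Perturbation}

/-- The components of the Fourier transform of a spinor in the form domain. -/
def fourierComp (i : Fin 2) : FormDomain →L[ℂ] L2 :=
  fourierL.comp (H1.toL2L.comp (FormDomain.proj i))

theorem fourierComp_apply (i : Fin 2) (u : FormDomain) :
    fourierComp i u = 𝓕 (H1.toL2 (u.fn i)) := rfl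

theorem isCompactOperator_pair {E F : Type*} [NormedAddCommGroup E] [NormedSpace ℂ E]
    [NormedAddCommGroup F] [NormedSpace ℂ F] {P R : E →L[ℂ] F} (hP : IsCompactOperator P)
    (hR : IsCompactOperator R) : IsCompactOperator (P.prod R) := by
  have h1 : IsCompactOperator ((ContinuousLinearMap.inl ℂ F F).comp P) :=
    hP.clm_comp (ContinuousLinearMap.inl ℂ F F)
  have h2 : IsCompactOperator ((ContinuousLinearMap.inr ℂ F F).comp R) :=
    hR.clm_comp (ContinuousLinearMap.inr ℂ F F)
  have h : P.prod R = (ContinuousLinearMap.inl ℂ F F).comp P +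
      (ContinuousLinearMap.inr ℂ F F).comp R := by
    ext x <;> simp
  rw [h]
  exact h1.add h2

/-- If it failed, `x` would exceed both summands separately, giving `s x > f + s ε f` and `k < s ε
x`, which contradicts the hypothesis. The quadratic inequality thus becomes linear, with leading
coefficient as close to `s⁻¹` as desired. -/
theorem le_of_sq_mul_le {s x f k ε : ℝ} (hs : 0 < s) (hε : 0 < ε) (hx : 0 ≤ x) (hk : 0 ≤ k)
    (hf : 0 ≤ f) (h : s * x ^ 2 ≤ x * f + f * k) : x ≤ (s⁻¹ + ε) * f + (s * ε)⁻¹ * k := by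
  by_contra! hlt
  have h1 : (s⁻¹ + ε) * f < x := lt_of_le_of_lt (le_add_of_nonneg_right (by positivity)) hlt
  have h2 : (s * ε)⁻¹ * k < x := lt_of_le_of_lt (le_add_of_nonneg_left (by positivity)) hlt
  have h3 : f + s * ε * f < s * x := by
    have := mul_lt_mul_of_pos_left h1 hs
    rwa [← mul_assoc, mul_add, mul_inv_cancel₀ hs.ne', add_mul, one_mul] at this
  have h4 : k < s * ε * x := by rwa [inv_mul_lt_iff₀ (by positivity)] at h2
  have h5 : x * (f + s * ε * f) ≤ x * (s * x) := mul_le_mul_of_nonneg_left h3.le hx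
  have h6 : f * (s * ε * x) ≤ f * k := by nlinarith
  rcases hf.eq_or_lt with rfl | hf
  · have : 0 < x := lt_of_le_of_lt (by positivity) h1
    nlinarith [mul_pos hs (mul_pos this this)]
  · nlinarith [mul_lt_mul_of_pos_left h4 hf]

-- The reason why `ν` creates no essential spectrum below `κ`. Test the equation for `u = T f` with
-- the band-limited spinor `w = χ u`: since `χ² ≤ χ` and `Ĥ₀ ≥ κ`, it yields `(κ + c) ‖w‖² ≤ ‖w‖ ‖f‖
-- + |ν(w, u)|`. The last term is controlled by `‖J w‖`, hence by a compact operator applied to `f`;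
-- the remainder `u - w` is small.
set_option maxHeartbeats 1000000 in
theorem essBounded_form_resolvent {c : ℝ} (hc : 0 < σ.kappa + c)
    {T : Spinor →L[ℂ] FormDomain}
    (hT : ∀ f v, shiftedForm σ V c v (T f) = inner ℂ (formIncl v) f) :
    EssBounded (L2 × L2) (formIncl.comp T) (σ.kappa + c)⁻¹ := by
  intro ε hε
  set s := σ.kappa + c with hs
  obtain ⟨C, hC0, hC⟩ := V.norm_form_le
  set t := ‖T‖ with ht
  have ht0 : 0 ≤ t := T.opNorm_nonneg
  set j := ‖J V.m‖ with hj
  have hj0 : 0 ≤ j := (J V.m).opNorm_nonneg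
  -- The cutoff radius makes `‖u - w‖ ≤ (ε / 4) ‖f‖`. The rest of `ε` is spent as `ε / 4` in `hxle`
  -- and `ε / 4` for each of the two components in `hDk`.
  set r : ℝ := 4 * (t + 1) / ε with hr
  have hr0 : 0 < r := by positivity
  let χ : ContDiffBump (0 : Plane) := ⟨r, r + 1, hr0, by linarith⟩
  obtain ⟨P, hP, hPb⟩ := exists_isCompactOperator_J_bandlimit χ V
  set D : ℝ := (s * (ε / 4))⁻¹ * (C * (j * t)) with hD
  have hD0 : 0 ≤ D := by positivity
  set M : ℝ := 2 * (D ^ 2 * t / ε * 2) with hM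
  have hM0 : 0 ≤ M := by positivity
  have hcomp : ∀ i, IsCompactOperator (P.comp ((fourierComp i).comp T)) := fun i => hP.comp_clm _
  refine ⟨(M : ℂ) • (P.comp ((fourierComp 0).comp T)).prod (P.comp ((fourierComp 1).comp T)),
    (isCompactOperator_pair (hcomp 0) (hcomp 1)).smul (M : ℂ), fun f => ?_⟩
  set u := T f with hu
  set w := bandlimitSpinor χ u with hw
  have hun : ‖u‖ ≤ t * ‖f‖ := T.le_opNorm f
  set x := ‖spinorIncl w.fn‖ with hx
  set k : Fin 2 → ℝ := fun i => ‖J V.m (w.fn i)‖ with hk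
  set y : Fin 2 → ℝ := fun i => ‖P (fourierComp i u)‖ with hy
  have hky : ∀ i, k i ^ 2 ≤ t * ‖f‖ * y i := by
    intro i
    refine (hPb (fourierComp i u)).trans (mul_le_mul_of_nonneg_right ?_ (norm_nonneg _))
    rw [fourierComp_apply, norm_fourier_toL2]
    exact (H1.norm_toL2_le _).trans ((u.norm_apply_le i).trans hun)
  have hform : ‖V.form w.fn u.fn‖ ≤ ‖f‖ * (C * (j * t) * (k 0 + k 1)) := by
    refine (hC _ _).trans ?_
    have h1 : ∀ i, ‖J V.m (w.fn i)‖ * ‖J V.m (u.fn i)‖ ≤ k i * (j * (t * ‖f‖)) := fun i =>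
      mul_le_mul_of_nonneg_left ((norm_J_apply_le V u i).trans
        (mul_le_mul_of_nonneg_left hun hj0)) (norm_nonneg _)
    rw [Fin.sum_univ_two]
    calc C * (‖J V.m (w.fn 0)‖ * ‖J V.m (u.fn 0)‖ + ‖J V.m (w.fn 1)‖ * ‖J V.m (u.fn 1)‖) ≤
        C * (k 0 * (j * (t * ‖f‖)) + k 1 * (j * (t * ‖f‖))) :=
          mul_le_mul_of_nonneg_left (add_le_add (h1 0) (h1 1)) hC0
      _ = _ := by ring
  have hmain : s * x ^ 2 ≤ x * ‖f‖ + ‖f‖ * (C * (j * t) * (k 0 + k 1)) := by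
    have h1 := congrArg Complex.re (hT f w)
    rw [← hu, shiftedForm, form, Complex.add_re, Complex.add_re, Complex.re_ofReal_mul,
      formIncl_apply] at h1
    have h2 := kappa_mul_le_form₀_bandlimitSpinor (σ := σ) χ u
    have h3 := norm_sq_bandlimitSpinor_le χ u
    have h4 : (inner ℂ (spinorIncl w.fn) f).re ≤ x * ‖f‖ :=
      (Complex.re_le_norm _).trans (norm_inner_le_norm _ _)
    have h5 : -(‖f‖ * (C * (j * t) * (k 0 + k 1))) ≤ (V.form w.fn u.fn).re :=
      (neg_le_neg hform).trans (neg_le_of_abs_le (Complex.abs_re_le_norm _))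
    have h6 := mul_le_mul_of_nonneg_left h3 hc.le
    rw [← hw] at h2 h6
    linarith
  have hk0 : ∀ i, 0 ≤ k i := fun i => norm_nonneg _
  have hxle := le_of_sq_mul_le hc (show 0 < ε / 4 by positivity) (norm_nonneg (spinorIncl w.fn))
    (by have := hk0 0; have := hk0 1; positivity) (norm_nonneg f) hmain
  have hsub : ‖spinorIncl u.fn - spinorIncl w.fn‖ ≤ ε / 4 * ‖f‖ := by
    have h1 := (norm_sub_bandlimitSpinor_le χ u).trans hun
    change r * _ ≤ _ at h1
    rw [← hw] at h1
    have h2 : r * (ε / 4 * ‖f‖) = (t + 1) * ‖f‖ := by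
      rw [hr]
      field_simp
    have h3 : r * ‖spinorIncl u.fn - spinorIncl w.fn‖ ≤ r * (ε / 4 * ‖f‖) := by
      rw [h2]
      linarith [norm_nonneg f]
    exact le_of_mul_le_mul_left h3 hr0
  -- Only `k i ^ 2` is linear in `y i`; the inequality between geometric and arithmetic means
  -- separates the factors `‖f‖` and `y i`.
  have hDk : ∀ i, D * k i ≤ ε / 4 * ‖f‖ + D ^ 2 * t / ε * y i := by
    intro i
    have h1 := hky i
    have hy0 : 0 ≤ y i := norm_nonneg _
    have h2 : (D * k i) ^ 2 ≤ (ε / 4 * ‖f‖ + D ^ 2 * t / ε * y i) ^ 2 := by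
      have h3 : (D * k i) ^ 2 ≤ D ^ 2 * (t * ‖f‖ * y i) := by
        rw [mul_pow]
        exact mul_le_mul_of_nonneg_left h1 (sq_nonneg _)
      have h4 : D ^ 2 * (t * ‖f‖ * y i) = 4 * (ε / 4 * ‖f‖) * (D ^ 2 * t / ε * y i) := by
        field_simp
      rw [h4] at h3
      nlinarith [sq_nonneg (ε / 4 * ‖f‖ - D ^ 2 * t / ε * y i)]
    exact le_of_sq_le_sq h2 (by positivity)
  have hfin : (inner ℂ (spinorIncl u.fn) f).re ≤
      (x + ‖spinorIncl u.fn - spinorIncl w.fn‖) * ‖f‖ := by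
    refine (Complex.re_le_norm _).trans ((norm_inner_le_norm _ _).trans ?_)
    refine mul_le_mul_of_nonneg_right ?_ (norm_nonneg _)
    have := norm_add_le (spinorIncl w.fn) (spinorIncl u.fn - spinorIncl w.fn)
    rwa [add_sub_cancel] at this
  have hz : y 0 + y 1 ≤ 2 * ‖(P (fourierComp 0 u), P (fourierComp 1 u))‖ := by
    have h1 := norm_fst_le (P (fourierComp 0 u), P (fourierComp 1 u))
    have h2 := norm_snd_le (P (fourierComp 0 u), P (fourierComp 1 u))
    simp only at h1 h2
    change ‖P (fourierComp 0 u)‖ + ‖P (fourierComp 1 u)‖ ≤ _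
    exact (add_le_add h1 h2).trans (two_mul _).ge
  change (inner ℂ (spinorIncl u.fn) f).re ≤ (s⁻¹ + ε) * ‖f‖ ^ 2 +
    ‖f‖ * ‖(M : ℂ) • (P (fourierComp 0 u), P (fourierComp 1 u))‖
  rw [norm_smul, Complex.norm_real, Real.norm_of_nonneg hM0]
  set z := ‖(P (fourierComp 0 u), P (fourierComp 1 u))‖
  have hx2 : x ≤ (s⁻¹ + ε * (3 / 4)) * ‖f‖ + M / 2 * z := by
    have h1 : (s * (ε / 4))⁻¹ * (C * (j * t) * (k 0 + k 1)) = D * k 0 + D * k 1 := by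
      rw [hD]
      ring
    rw [h1] at hxle
    have h2 : D ^ 2 * t / ε * (y 0 + y 1) ≤ D ^ 2 * t / ε * (2 * z) :=
      mul_le_mul_of_nonneg_left hz (by positivity)
    have h3 : M / 2 * z = D ^ 2 * t / ε * (2 * z) := by
      rw [hM]
      ring
    rw [h3]
    linarith [hDk 0, hDk 1]
  have hz0 : 0 ≤ z := norm_nonneg _
  have hMz : 0 ≤ M / 2 * z := by positivity
  calc _ ≤ _ := hfin
    _ ≤ ((s⁻¹ + ε) * ‖f‖ + M * z) * ‖f‖ := by
        refine mul_le_mul_of_nonneg_right ?_ (norm_nonneg _)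
        linarith
    _ = _ := by ring

theorem mem_eigenspace_hamiltonian_iff {E : ℝ} {f : Spinor} :
    f ∈ eigenspace (hamiltonian σ V) E ↔ ∃ u : FormDomain, formIncl u = f ∧
      ∀ v : FormDomain, form σ V v.fn u.fn = E * inner ℂ (formIncl v) f := by
  change (f, (E : ℂ) • f) ∈ (hamiltonian σ V).graph ↔ _
  rw [mem_graph_hamiltonian_iff]
  simp only [inner_smul_right]
  constructor
  · rintro ⟨u, hu, h⟩
    exact ⟨FormDomain.mk u, hu, fun v => h v.fn⟩
  · rintro ⟨u, hu, h⟩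
    exact ⟨u.fn, hu, fun v => h (FormDomain.mk v)⟩

/-- `T` inverts `H + c`, so an eigenvalue `l` of `T` becomes `l⁻¹ - c` for `H`; division by `l` puts
the eigenvector into the form domain. -/
theorem eigenspace_resolvent_le {c l : ℝ} (hl : l ≠ 0) {T : Spinor →L[ℂ] FormDomain}
    (hT : ∀ f v, shiftedForm σ V c v (T f) = inner ℂ (formIncl v) f) :
    Module.End.eigenspace ((formIncl.comp T : Spinor →L[ℂ] Spinor) : Spinor →ₗ[ℂ] Spinor) l ≤
      eigenspace (hamiltonian σ V) (l⁻¹ - c) := by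
  intro f hf
  have hf' : formIncl (T f) = (l : ℂ) • f := Module.End.mem_eigenspace_iff.mp hf
  have hl' : (l : ℂ) ≠ 0 := Complex.ofReal_ne_zero.mpr hl
  refine mem_eigenspace_hamiltonian_iff.mpr ⟨(l : ℂ)⁻¹ • T f, ?_, fun v => ?_⟩
  · rw [map_smul, hf', smul_smul, inv_mul_cancel₀ hl', one_smul]
  · have h1 := hT f v
    rw [shiftedForm, ← formIncl_apply, ← formIncl_apply, hf', inner_smul_right] at h1
    have h2 : form σ V v.fn ((l : ℂ)⁻¹ • T f).fn = (l : ℂ)⁻¹ * form σ V v.fn (T f).fn := by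
      rw [form, FormDomain.fn_smul, σ.form₀_smul, V.form_smul, form, mul_add]
    rw [h2, eq_sub_of_add_eq h1]
    push_cast
    field_simp

/-- An eigenvector `u` solves the weak equation with right-hand side `(E + c) u`, so uniqueness
gives `u = T ((E + c) u)`. Coercivity at a nonzero eigenvector forces `E + c > 0`. -/
theorem eigenspace_hamiltonian_le {δ c E : ℝ} (hδ : 0 < δ)
    (hB : ∀ u, δ * ‖u‖ ^ 2 ≤ (shiftedForm σ V c u u).re) {T : Spinor →L[ℂ] FormDomain}
    (hT : ∀ f u, (∀ v, shiftedForm σ V c v u = inner ℂ (formIncl v) f) → u = T f)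
    (hE : eigenspace (hamiltonian σ V) E ≠ ⊥) : 0 < E + c ∧
    eigenspace (hamiltonian σ V) E ≤ Module.End.eigenspace
      ((formIncl.comp T : Spinor →L[ℂ] Spinor) : Spinor →ₗ[ℂ] Spinor) ((E + c)⁻¹ : ℝ) := by
  have key : ∀ u : FormDomain, (∀ v : FormDomain, form σ V v.fn u.fn =
      E * inner ℂ (formIncl v) (formIncl u)) →
      ∀ v, shiftedForm σ V c v u = (E + c : ℝ) * inner ℂ (formIncl v) (formIncl u) := by
    intro u hu v
    rw [shiftedForm, hu, ← formIncl_apply, ← formIncl_apply]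
    push_cast
    ring
  have hpos : 0 < E + c := by
    obtain ⟨f, hf, hf0⟩ := Submodule.exists_mem_ne_zero_of_ne_bot hE
    obtain ⟨u, rfl, hu⟩ := mem_eigenspace_hamiltonian_iff.mp hf
    have h1 := hB u
    have h2 : (inner ℂ (formIncl u) (formIncl u)).re = ‖formIncl u‖ ^ 2 :=
      inner_self_eq_norm_sq (𝕜 := ℂ) (formIncl u)
    rw [key u hu u, Complex.re_ofReal_mul, h2] at h1
    have hu0 : u ≠ 0 := by
      rintro rfl
      exact hf0 (map_zero _)
    have h3 : 0 < ‖u‖ := norm_pos_iff.mpr hu0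
    have h4 : 0 < (E + c) * ‖formIncl u‖ ^ 2 := lt_of_lt_of_le (by positivity) h1
    exact pos_of_mul_pos_left h4 (sq_nonneg _)
  refine ⟨hpos, fun f hf => ?_⟩
  obtain ⟨u, rfl, hu⟩ := mem_eigenspace_hamiltonian_iff.mp hf
  rw [Module.End.mem_eigenspace_iff]
  change formIncl (T (formIncl u)) = _
  have h1 : u = T (((E + c : ℝ) : ℂ) • formIncl u) := by
    refine hT _ _ fun v => ?_
    rw [key u hu, inner_smul_right]
  have h2 : u = ((E + c : ℝ) : ℂ) • T (formIncl u) := by rwa [map_smul] at h1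
  have h0 : ((E + c : ℝ) : ℂ) ≠ 0 := Complex.ofReal_ne_zero.mpr hpos.ne'
  have h3 := congrArg formIncl h2
  rw [map_smul] at h3
  rw [Complex.ofReal_inv]
  calc formIncl (T (formIncl u)) = ((E + c : ℝ) : ℂ)⁻¹ • ((E + c : ℝ) : ℂ) •
        formIncl (T (formIncl u)) := by rw [smul_smul, inv_mul_cancel₀ h0, one_smul]
    _ = _ := by rw [← h3]

/-- Eigenvalues below `κ` have finite multiplicity. -/
theorem finiteDimensional_eigenspace (h : IsRelativelyBounded σ V) {E : ℝ} (hE : E < σ.kappa) :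
    FiniteDimensional ℂ (eigenspace (hamiltonian σ V) E) := by
  by_cases hbot : eigenspace (hamiltonian σ V) E = ⊥
  · rw [hbot]
    infer_instance
  obtain ⟨δ, c, hδ, hc, hB⟩ := h.exists_coercive
  obtain ⟨T, hT, hT'⟩ := exists_form_resolvent formIncl (shiftedFormL σ V c)
    (shiftedForm_symm σ V c) hδ hB
  obtain ⟨hpos, hle⟩ := eigenspace_hamiltonian_le hδ hB hT' hbot
  have hess := essBounded_form_resolvent hc hT
  -- Inversion reverses the order: `E < κ` becomes `(E + c)⁻¹ > (κ + c)⁻¹`, which is above the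
  -- essential bound.
  have := hess.finiteDimensional_eigenspace (l := (E + c)⁻¹)
    (inv_strictAnti₀ hpos (by linarith))
  exact Submodule.finiteDimensional_of_le hle

/-- A subspace of the form domain on which `q < κ` gives as many eigenvectors below `κ`. -/
theorem le_rank_iSup_eigenspace_hamiltonian (h : IsRelativelyBounded σ V) {N : ℕ}
    (U : (Fin N → ℂ) →ₗ[ℂ] FormDomain)
    (hU : ∀ c, c ≠ 0 → (form σ V (U c).fn (U c).fn).re < σ.kappa * ‖formIncl (U c)‖ ^ 2) :
    (N : Cardinal) ≤ Module.rank ℂ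
      (⨆ E ∈ Set.Iio σ.kappa, eigenspace (hamiltonian σ V) E : Submodule ℂ Spinor) := by
  obtain ⟨δ, c, hδ, hc, hB⟩ := h.exists_coercive
  obtain ⟨T, hT, hT'⟩ := exists_form_resolvent formIncl (shiftedFormL σ V c)
    (shiftedForm_symm σ V c) hδ hB
  have hess := essBounded_form_resolvent hc hT
  have hB0 : ∀ u, 0 ≤ (shiftedFormL σ V c u u).re := fun u =>
    le_trans (by positivity) (hB u)
  refine (hess.le_rank_iSup_eigenspace
    (isSymmetric_form_resolvent (B := shiftedFormL σ V c) (shiftedForm_symm σ V c) hT)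
    ((formIncl : FormDomain →ₗ[ℂ] Spinor).comp U) fun a ha => ?_).trans ?_
  · refine lt_re_inner_form_resolvent (B := shiftedFormL σ V c) (shiftedForm_symm σ V c) hB0 hT hc
      (u := U a) ?_
    have h2 : (inner ℂ (formIncl (U a)) (formIncl (U a))).re = ‖formIncl (U a)‖ ^ 2 :=
      inner_self_eq_norm_sq (𝕜 := ℂ) (formIncl (U a))
    rw [shiftedFormL_apply, shiftedForm, Complex.add_re, Complex.re_ofReal_mul, ← formIncl_apply,
      h2, add_mul]
    linarith [hU a ha]
  · refine Submodule.rank_mono (iSup₂_le fun l hl => ?_)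
    have hl0 : 0 < l := lt_trans (inv_pos.mpr hc) hl
    refine (eigenspace_resolvent_le hl0.ne' hT).trans ?_
    have hlt : l⁻¹ - c < σ.kappa := by
      have := inv_strictAnti₀ (inv_pos.mpr hc) hl
      rw [inv_inv] at this
      linarith
    exact le_iSup₂_of_le (l⁻¹ - c) hlt le_rfl


/-! ### Trigonometric polynomials -/

/-- The character `t ↦ exp (2πi s t)`. -/
def realChar (s : ℝ) : Multiplicative ℝ →* ℂ where
  toFun t := Complex.exp ((2 * Real.pi * s * t.toAdd : ℝ) * Complex.I)
  map_one' := by simp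
  map_mul' t t' := by
    rw [← Complex.exp_add, toAdd_mul]
    congr 1
    push_cast
    ring

theorem realChar_injective : Function.Injective realChar := by
  intro s s' h
  by_contra hne
  have h0 : s - s' ≠ 0 := sub_ne_zero.mpr hne
  -- At `t = 1 / (2 (s - s'))` the two phases differ by exactly `π`.
  have h1 := DFunLike.congr_fun h (Multiplicative.ofAdd ((2 * (s - s'))⁻¹))
  change Complex.exp ((2 * Real.pi * s * (2 * (s - s'))⁻¹ : ℝ) * Complex.I) =
    Complex.exp ((2 * Real.pi * s' * (2 * (s - s'))⁻¹ : ℝ) * Complex.I) at h1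
  have h2 : ((2 * Real.pi * s * (2 * (s - s'))⁻¹ : ℝ) : ℂ) * Complex.I =
      ((2 * Real.pi * s' * (2 * (s - s'))⁻¹ : ℝ) : ℂ) * Complex.I + Real.pi * Complex.I := by
    rw [← add_mul, ← Complex.ofReal_add]
    congr 2
    field_simp
    ring
  rw [h2, Complex.exp_add, Complex.exp_pi_mul_I, mul_neg_one] at h1
  exact Complex.exp_ne_zero _ (self_eq_neg.mp h1.symm)

/-- Distinct characters are linearly independent, so the sum is not identically zero; being real
analytic, it has a discrete and hence null zero set. -/
theorem volume_zeros_exp_sum_real {N : ℕ} {s : Fin N → ℝ} (hs : Function.Injective s)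
    {b : Fin N → ℂ} (hb : b ≠ 0) :
    volume {t : ℝ | ∑ k, b k * Complex.exp ((2 * Real.pi * s k * t : ℝ) * Complex.I) = 0} = 0 := by
  set f : ℝ → ℂ := fun t => ∑ k, b k * Complex.exp ((2 * Real.pi * s k * t : ℝ) * Complex.I) with hf
  obtain ⟨t₀, ht₀⟩ : ∃ t, f t ≠ 0 := by
    by_contra! hall
    have hli : LinearIndependent ℂ (fun k => (realChar (s k) : Multiplicative ℝ → ℂ)) :=
      (linearIndependent_monoidHom (Multiplicative ℝ) ℂ).comp (fun k => realChar (s k))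
        (realChar_injective.comp hs)
    refine hb (funext fun k => Fintype.linearIndependent_iff.mp hli b ?_ k)
    funext t
    rw [Finset.sum_apply]
    exact hall t.toAdd
  have han : AnalyticOnNhd ℝ f Set.univ := by
    intro t _
    have h1 : ∀ k, AnalyticAt ℝ
        (fun t : ℝ => ((2 * Real.pi * s k * t : ℝ) : ℂ) * Complex.I) t := fun k =>
      ((Complex.ofRealCLM.analyticAt _).comp (analyticAt_const.mul analyticAt_id)).mul
        analyticAt_const
    have h2 : ∀ k, AnalyticAt ℝ
        (fun t : ℝ => b k * Complex.exp (((2 * Real.pi * s k * t : ℝ) : ℂ) * Complex.I)) t :=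
      fun k => analyticAt_const.mul ((analyticAt_cexp.restrictScalars).comp (h1 k))
    exact Finset.analyticAt_fun_sum _ fun k _ => h2 k
  have h1 := han.preimage_zero_mem_codiscrete ht₀
  have h2 := ae_restrict_le_codiscreteWithin (μ := (volume : Measure ℝ)) MeasurableSet.univ h1
  rw [Measure.restrict_univ, mem_ae_iff] at h2
  refine measure_mono_null (t := (f ⁻¹' {0}ᶜ)ᶜ) (fun t ht => ?_) h2
  exact fun hn : t ∈ f ⁻¹' {0}ᶜ => hn ht

theorem star_wave (x ξ : Plane) :
    star (wave x ξ) = Complex.exp ((2 * Real.pi * inner ℝ ξ x : ℝ) * Complex.I) := by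
  rw [wave, Complex.star_def, ← Complex.exp_conj, map_mul, Complex.conj_I, ← Complex.ofReal_neg,
    Complex.conj_ofReal]
  congr 1
  push_cast
  ring

/-- The zero set of a nontrivial trigonometric polynomial is a null set. -/
theorem volume_zeros_trigPolynomial {N : ℕ} {p : Fin N → Plane} (hp : Function.Injective p)
    {a : Fin N → ℂ} (ha : a ≠ 0) :
    volume {x : Plane | ∑ k, a k * star (wave x (p k)) = 0} = 0 := by
  -- A direction `d` orthogonal to none of the finitely many differences `p j - p k`. On every line
  -- parallel to `d` the polynomial is a one-dimensional exponential sum with distinct frequencies.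
  obtain ⟨d, hd⟩ := Module.Dual.exists_forall_ne_zero_of_forall_exists
    (fun i : {i : Fin N × Fin N // i.1 ≠ i.2} => innerₗ Plane (p i.1.1 - p i.1.2)) (by
      rintro ⟨⟨j, k⟩, hjk⟩
      exact ⟨p j - p k, inner_self_ne_zero.mpr (sub_ne_zero.mpr (hp.ne hjk))⟩)
  set s : Fin N → ℝ := fun k => inner ℝ (p k) d with hs
  have hsinj : Function.Injective s := by
    intro j k hjk
    by_contra hne
    have h1 : inner ℝ (p j - p k) d ≠ 0 := hd ⟨(j, k), hne⟩
    rw [inner_sub_left] at h1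
    exact h1 (sub_eq_zero.mpr hjk)
  set E : Set Plane := {x : Plane | ∑ k, a k * star (wave x (p k)) = 0} with hE
  have hEm : MeasurableSet E := by
    refine (isClosed_eq ?_ continuous_const).measurableSet
    refine continuous_finsetSum _ fun k _ => continuous_const.mul (continuous_star.comp ?_)
    unfold wave
    fun_prop
  have hline : ∀ y : Plane, volume {t : ℝ | y + t • d ∈ E} = 0 := by
    intro y
    have hb : (fun k => a k * star (wave y (p k))) ≠ 0 := by
      obtain ⟨k, hk⟩ := Function.ne_iff.mp ha
      refine Function.ne_iff.mpr ⟨k, mul_ne_zero hk ?_⟩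
      rw [star_wave]
      exact Complex.exp_ne_zero _
    rw [← volume_zeros_exp_sum_real hsinj hb]
    congr 1
    ext t
    simp only [hE, Set.mem_ofPred_eq, star_wave, mul_assoc (a _), ← Complex.exp_add,
      inner_add_right, inner_smul_right]
    refine Eq.congr (Finset.sum_congr rfl fun k _ => ?_) rfl
    congr 2
    rw [hs]
    push_cast
    ring
  have hcont : Measurable fun z : Plane × ℝ => z.1 + z.2 • d := by fun_prop
  -- Fubini in `(y, t)`: every slice over `y` is null, so the slice over some `t` is null, and that
  -- slice is a translate of `E`.
  have h1 : ((volume : Measure Plane).prod (volume : Measure ℝ))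
      ((fun z : Plane × ℝ => z.1 + z.2 • d) ⁻¹' E) = 0 := by
    rw [Measure.measure_prod_null (hcont hEm)]
    exact Eventually.of_forall hline
  have h2 : ((volume : Measure ℝ).prod (volume : Measure Plane))
      ((fun z : ℝ × Plane => z.2 + z.1 • d) ⁻¹' E) = 0 := by
    rw [← (Measure.measurePreserving_swap (μ := (volume : Measure ℝ))
      (ν := (volume : Measure Plane))).measure_preimage (hcont hEm).nullMeasurableSet] at h1
    exact h1
  have h3 := Measure.measure_ae_null_of_prod_null h2
  obtain ⟨t, ht⟩ := h3.exists
  have h4 : (volume : Measure Plane) ((fun y : Plane => y + t • d) ⁻¹' E) = 0 := ht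
  rwa [measure_preimage_add_right] at h4

/-! ### Sign and support of the perturbation -/

namespace Perturbation

variable {V : Perturbation}

theorem integrable_h (V : Perturbation) : Integrable V.h V.m := by
  obtain ⟨C, hC⟩ := V.bounded
  exact Integrable.of_bound V.measurable.aestronglyMeasurable C (Eventually.of_forall hC)

theorem h_nonpos (hneg : V.nu ≤ 0) : ∀ᵐ x ∂V.m, V.h x ≤ 0 := by
  have h1 : 0 ≤ᵐ[V.m] fun x => -V.h x := by
    refine ae_nonneg_of_forall_setIntegral_nonneg V.integrable_h.neg fun s hs _ => ?_
    have h2 : V.nu s ≤ 0 := hneg s hs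
    rw [nu, withDensityᵥ_apply V.integrable_h hs] at h2
    rw [integral_neg]
    linarith
  filter_upwards [h1] with x hx
  simpa using hx

/-- `ν` does not live on a closed null set. -/
theorem not_ae_mem_or_eq_zero (hsupp : 0 < volume V.supp) {Z : Set Plane} (hZ : IsClosed Z)
    (hZ0 : volume Z = 0) : ¬ ∀ᵐ x ∂V.m, x ∈ Z ∨ V.h x = 0 := by
  intro hae
  have hZm := hZ.measurableSet
  -- If `h` vanishes almost everywhere off `Z`, then `ν` is carried by `Z`. Since `Z` is closed, the
  -- topological support lies in `Z` and would be null.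
  have hnu : V.nu = (V.m.restrict Z).withDensityᵥ V.h := by
    ext s hs
    rw [nu, withDensityᵥ_apply V.integrable_h hs, withDensityᵥ_apply V.integrable_h.restrict hs,
      Measure.restrict_restrict hs, ← integral_indicator hs, ← integral_indicator (hs.inter hZm)]
    refine integral_congr_ae ?_
    filter_upwards [hae] with x hx
    by_cases hxs : x ∈ s
    · by_cases hxZ : x ∈ Z
      · rw [Set.indicator_of_mem hxs, Set.indicator_of_mem (Set.mem_inter hxs hxZ)]
      · rw [Set.indicator_of_mem hxs, Set.indicator_of_notMem (fun h => hxZ h.2)]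
        exact hx.resolve_left hxZ
    · rw [Set.indicator_of_notMem hxs, Set.indicator_of_notMem (fun h => hxs h.1)]
  have h1 : V.nu.totalVariation ≪ V.m.restrict Z := by
    have h2 := Measure.withDensityᵥ_absolutelyContinuous (V.m.restrict Z) V.h
    rw [← hnu, SignedMeasure.absolutelyContinuous_ennreal_iff,
      VectorMeasure.ennrealToMeasure_toENNRealVectorMeasure] at h2
    exact h2
  have h3 : V.nu.totalVariation Zᶜ = 0 := by
    refine h1 ?_
    rw [Measure.restrict_apply hZm.compl, Set.compl_inter_self, measure_empty]
  have h4 : V.supp ⊆ Z := Measure.support_subset_of_isClosed hZ h3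
  exact hsupp.ne' (measure_mono_null h4 hZ0)

end Perturbation


/-! ### Test functions concentrated in momentum space -/

/-- An approximate identity at scale `ε` with small second moment of its square. -/
structure IsLogBump (ε : ℝ) (φ : Plane → ℝ) : Prop where
  measurable : Measurable φ
  nonneg : ∀ ξ, 0 ≤ φ ξ
  bounded : ∃ C, ∀ ξ, φ ξ ≤ C
  eq_zero : ∀ ξ, ε ≤ ‖ξ‖ → φ ξ = 0
  integral_eq : ∫ ξ, φ ξ = 1
  integral_sq_le : ∫ ξ, ‖ξ‖ ^ 2 * φ ξ ^ 2 ≤ ε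

theorem exists_isLogBump {ε : ℝ} (hε : 0 < ε) : ∃ φ, IsLogBump ε φ := by
  set b : ℝ := volume.real (Metric.ball (0 : Plane) 1) with hb
  have hb0 : 0 < b := by
    rw [hb, measureReal_def]
    exact ENNReal.toReal_pos (Metric.measure_ball_pos _ _ one_pos).ne' measure_ball_lt_top.ne
  -- The inner radius is chosen so that `∫ |ξ|⁻² = 2 b log (ε / r) = ε⁻¹` over the annulus `r ≤ |ξ|
  -- < ε`. It is available because this integral diverges logarithmically at the origin in dimension
  -- two.
  set r : ℝ := ε * Real.exp (-(2 * b * ε)⁻¹) with hr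
  have hr0 : 0 < r := by positivity
  have hrε : r < ε := by
    have : Real.exp (-(2 * b * ε)⁻¹) < 1 := Real.exp_lt_one_iff.mpr (neg_neg_iff_pos.mpr (by positivity))
    rw [hr]
    nlinarith
  set k : ℝ → ℝ := (Set.Ico r ε).indicator fun y => (y ^ 2)⁻¹ with hk
  have hkm : Measurable k := (by fun_prop : Measurable fun y : ℝ => (y ^ 2)⁻¹).indicator
    measurableSet_Ico
  have hk0 : ∀ y, 0 ≤ k y := fun y => Set.indicator_nonneg (fun y _ => by positivity) y
  have hkint : ∫ ξ : Plane, k ‖ξ‖ = ε⁻¹ := by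
    rw [integral_fun_norm_addHaar volume k, finrank_euclideanSpace_fin, ← hb]
    have h1 : ∫ y in Set.Ioi (0 : ℝ), y ^ (2 - 1) • k y = Real.log (ε / r) := by
      have h2 : (fun y : ℝ => y ^ (2 - 1) • k y) = (Set.Ico r ε).indicator fun y => y⁻¹ := by
        funext y
        by_cases hy : y ∈ Set.Ico r ε
        · rw [hk, Set.indicator_of_mem hy, Set.indicator_of_mem hy, smul_eq_mul]
          have : y ≠ 0 := (hr0.trans_le hy.1).ne'
          rw [pow_one]
          field_simp
        · rw [hk, Set.indicator_of_notMem hy, Set.indicator_of_notMem hy, smul_zero]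
      have h3 : Set.Ioi (0 : ℝ) ∩ Set.Ico r ε = Set.Ico r ε :=
        Set.inter_eq_right.mpr fun y hy => hr0.trans_le hy.1
      rw [h2, setIntegral_indicator measurableSet_Ico, h3, integral_Ico_eq_integral_Ioc,
        ← intervalIntegral.integral_of_le hrε.le, integral_inv_of_pos hr0 hε]
    have h4 : ε / r = Real.exp ((2 * b * ε)⁻¹) := by
      rw [hr, Real.exp_neg]
      field_simp
    rw [h1, h4, Real.log_exp, nsmul_eq_mul, smul_eq_mul]
    push_cast
    field_simp
  -- With `φ = ε |ξ|⁻²` on the annulus, `|ξ|² φ² = ε φ`, so one integral settles both the mass and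
  -- the second moment.
  refine ⟨fun ξ => ε * k ‖ξ‖, (hkm.comp measurable_norm).const_mul _,
    fun ξ => mul_nonneg hε.le (hk0 _), ⟨ε * (r ^ 2)⁻¹, fun ξ => ?_⟩, fun ξ hξ => ?_, ?_, ?_⟩
  · refine mul_le_mul_of_nonneg_left ?_ hε.le
    by_cases hy : ‖ξ‖ ∈ Set.Ico r ε
    · rw [hk, Set.indicator_of_mem hy]
      exact inv_anti₀ (by positivity) (pow_le_pow_left₀ hr0.le hy.1 2)
    · rw [hk, Set.indicator_of_notMem hy]
      positivity
  · rw [hk, Set.indicator_of_notMem fun h => absurd h.2 (not_lt.mpr hξ), mul_zero]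
  · rw [integral_const_mul, hkint, mul_inv_cancel₀ hε.ne']
  · have h1 : ∀ ξ : Plane, ‖ξ‖ ^ 2 * (ε * k ‖ξ‖) ^ 2 = ε ^ 2 * k ‖ξ‖ := by
      intro ξ
      by_cases hy : ‖ξ‖ ∈ Set.Ico r ε
      · have : ‖ξ‖ ≠ 0 := (hr0.trans_le hy.1).ne'
        rw [hk, Set.indicator_of_mem hy]
        field_simp
      · rw [hk, Set.indicator_of_notMem hy]
        ring
    simp only [h1]
    rw [integral_const_mul, hkint, sq, mul_assoc, mul_inv_cancel₀ hε.ne', mul_one]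

namespace IsLogBump

variable {ε : ℝ} {φ : Plane → ℝ}

theorem integrable (h : IsLogBump ε φ) : Integrable φ := by
  by_contra hn
  have h1 := h.integral_eq
  rw [integral_undef hn] at h1
  exact zero_ne_one h1

theorem norm_integral_le (h : IsLogBump ε φ) (p : Plane) {G : Plane → ℂ} {C : ℝ}
    (hG : ∀ ξ, ‖ξ - p‖ < ε → ‖G ξ‖ ≤ C) : ‖∫ ξ, (φ (ξ - p) : ℂ) * G ξ‖ ≤ C := by
  have hi : Integrable fun ξ => φ (ξ - p) * C := (h.integrable.comp_sub_right p).mul_const C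
  calc _ ≤ ∫ ξ, φ (ξ - p) * C := by
        refine norm_integral_le_of_norm_le hi (Eventually.of_forall fun ξ => ?_)
        rw [norm_mul, Complex.norm_real, Real.norm_of_nonneg (h.nonneg _)]
        by_cases hξ : ‖ξ - p‖ < ε
        · exact mul_le_mul_of_nonneg_left (hG ξ hξ) (h.nonneg _)
        · rw [h.eq_zero _ (not_lt.mp hξ), zero_mul, zero_mul]
    _ = C := by
        rw [integral_mul_const, integral_sub_right_eq_self φ p, h.integral_eq, one_mul]

/-- The bumps form an approximate identity: they have mass one and shrinking supports. Continuity of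
`G` at the single point `p` suffices. -/
theorem tendsto_integral {φ : ℕ → Plane → ℝ} {ε : ℕ → ℝ} (h : ∀ n, IsLogBump (ε n) (φ n))
    (hε : Tendsto ε atTop (𝓝 0)) {p : Plane} {G : Plane → ℂ} (hGm : Measurable G) {C : ℝ}
    (hGb : ∀ ξ, ‖G ξ‖ ≤ C) (hG : ContinuousAt G p) :
    Tendsto (fun n => ∫ ξ, (φ n (ξ - p) : ℂ) * G ξ) atTop (𝓝 (G p)) := by
  rw [Metric.tendsto_atTop]
  intro η hη
  obtain ⟨δ, hδ, hGδ⟩ := Metric.continuousAt_iff.mp hG (η / 2) (by positivity)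
  obtain ⟨N, hN⟩ := (hε.eventually (gt_mem_nhds hδ)).exists_forall_of_atTop
  refine ⟨N, fun n hn => ?_⟩
  have hi : Integrable fun ξ => (φ n (ξ - p) : ℂ) := ((h n).integrable.comp_sub_right p).ofReal
  have h1 : ∫ ξ, (φ n (ξ - p) : ℂ) * G p = G p := by
    rw [integral_mul_const, integral_complex_ofReal, integral_sub_right_eq_self (φ n) p,
      (h n).integral_eq, Complex.ofReal_one, one_mul]
  have h2 : Integrable fun ξ => (φ n (ξ - p) : ℂ) * G ξ :=
    hi.mul_bdd (c := C) hGm.aestronglyMeasurable (Eventually.of_forall hGb)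
  have h3 : (∫ ξ, (φ n (ξ - p) : ℂ) * G ξ) - G p = ∫ ξ, (φ n (ξ - p) : ℂ) * (G ξ - G p) := by
    simp only [mul_sub]
    rw [integral_sub h2 (hi.mul_const _), h1]
  rw [dist_eq_norm, h3]
  refine lt_of_le_of_lt ((h n).norm_integral_le p (C := η / 2) fun ξ hξ => ?_) (by linarith)
  rw [← dist_eq_norm]
  refine (hGδ ?_).le
  rw [dist_eq_norm]
  exact hξ.trans (hN n hn)

end IsLogBump

/-- A spinor with prescribed bounded and compactly supported Fourier transform. -/
theorem exists_packet {g : Plane → Fin 2 → ℂ} (hg : ∀ i, Measurable fun ξ => g ξ i) {C R : ℝ}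
    (hgb : ∀ ξ i, ‖g ξ i‖ ≤ C) (hgR : ∀ ξ, R ≤ ‖ξ‖ → g ξ = 0) :
    ∃ u : FormDomain, (∀ᵐ ξ, hat u.fn ξ = g ξ) ∧ ∀ (V : Perturbation) (i : Fin 2),
      J V.m (u.fn i) =ᵐ[V.m] fun x => ∫ ξ, star (wave x ξ) * g ξ i := by
  set r := max R 1 with hr
  have hr0 : 0 < r := lt_of_lt_of_le one_pos (le_max_right _ _)
  -- A cutoff equal to one on the support of `g`, so that band-limiting leaves `g` unchanged and the
  -- formula for `J` on band-limited functions applies.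
  let χ : ContDiffBump (0 : Plane) := ⟨r, r + 1, hr0, by linarith⟩
  have hχ : ∀ ξ i, ((χ ξ : ℝ) : ℂ) * g ξ i = g ξ i := by
    intro ξ i
    by_cases hξ : R ≤ ‖ξ‖
    · rw [hgR ξ hξ, Pi.zero_apply, mul_zero]
    · have h1 : ξ ∈ Metric.closedBall (0 : Plane) χ.rIn :=
        mem_closedBall_zero_iff.mpr ((not_le.mp hξ).le.trans (le_max_left _ _))
      rw [χ.one_of_mem_closedBall h1, Complex.ofReal_one, one_mul]
  have hmem : ∀ i, MemLp (fun ξ => g ξ i) 2 volume := by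
    intro i
    have h1 : MemLp (fun ξ => g ξ i) 2 (volume.restrict (Metric.closedBall (0 : Plane) r)) := by
      have : IsFiniteMeasure (volume.restrict (Metric.closedBall (0 : Plane) r)) :=
        ⟨by rw [Measure.restrict_apply_univ]; exact measure_closedBall_lt_top⟩
      exact MemLp.of_bound (hg i).aestronglyMeasurable C (Eventually.of_forall fun ξ => hgb ξ i)
    rw [← memLp_indicator_iff_restrict Metric.isClosed_closedBall.measurableSet] at h1
    refine h1.ae_eq (Eventually.of_forall fun ξ => ?_)
    refine congrFun (Set.indicator_eq_self.mpr fun ξ hξ => ?_) ξ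
    rw [mem_closedBall_zero_iff]
    by_contra! hcon
    exact hξ (congrFun (hgR ξ ((le_max_left _ _).trans hcon.le)) i)
  refine ⟨FormDomain.mk fun i => bandlimit χ ((hmem i).toLp _), ?_, fun V i => ?_⟩
  · have h1 : ∀ᵐ ξ, ∀ i, (𝓕 (H1.toL2 (bandlimit χ ((hmem i).toLp _))) : L2) ξ = g ξ i := by
      refine ae_all_iff.mpr fun i => ?_
      filter_upwards [fourier_bandlimit χ ((hmem i).toLp _), (hmem i).coeFn_toLp] with ξ h1 h2
      rw [h1, h2, hχ]
    filter_upwards [h1] with ξ hξ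
    rw [FormDomain.fn_mk]
    exact funext hξ
  · rw [FormDomain.fn_mk]
    filter_upwards [coeFn_J_bandlimit χ V ((hmem i).toLp _)] with x hx
    rw [hx, inner_wavePacket]
    refine integral_congr_ae ?_
    filter_upwards [(hmem i).coeFn_toLp] with ξ hξ
    rw [hξ, hχ]

/-! ### Local eigenvectors at the minimum points -/

/-- A minimum point admits a quadratic upper bound. -/
theorem exists_le_sq_of_isLocalMin {f : Plane → ℝ} {p : Plane} (hf : ContDiffAt ℝ 2 f p)
    (hmin : IsLocalMin f p) : ∃ C δ : ℝ, 0 ≤ C ∧ 0 < δ ∧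
      ∀ q, ‖q - p‖ < δ → f q - f p ≤ C * ‖q - p‖ ^ 2 := by
  -- The derivative is Lipschitz near `p` and vanishes at the minimum, so it is at most `K ‖q - p‖`
  -- on the ball through `q`; the mean value inequality supplies the second factor.
  have h1 : ContDiffAt ℝ 1 (fderiv ℝ f) p := hf.fderiv_right (by norm_num)
  obtain ⟨K, t, ht, hK⟩ := h1.exists_lipschitzOnWith
  have h2 : ∀ᶠ q in 𝓝 p, DifferentiableAt ℝ f q := by
    filter_upwards [hf.eventually (by simp)] with q hq
    exact hq.differentiableAt (by norm_num)
  obtain ⟨δ, hδ, hball⟩ := Metric.mem_nhds_iff.mp (inter_mem ht h2)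
  have hp0 : fderiv ℝ f p = 0 := hmin.fderiv_eq_zero
  have hpt : p ∈ t := mem_of_mem_nhds ht
  refine ⟨K, δ, K.2, hδ, fun q hq => ?_⟩
  set s := Metric.closedBall p ‖q - p‖ with hs
  have hsub : s ⊆ Metric.ball p δ := Metric.closedBall_subset_ball hq
  have h3 := (convex_closedBall p ‖q - p‖).norm_image_sub_le_of_norm_fderiv_le (𝕜 := ℝ) (f := f)
    (C := K * ‖q - p‖) (fun x hx => (hball (hsub hx)).2) (fun x hx => by
      have h4 := hK.norm_sub_le (hball (hsub hx)).1 hpt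
      rw [hp0, sub_zero] at h4
      refine h4.trans (mul_le_mul_of_nonneg_left ?_ K.2)
      rw [← dist_eq_norm]
      exact hx) (Metric.mem_closedBall_self (norm_nonneg _)) (y := q)
      (by rw [Metric.mem_closedBall, dist_eq_norm])
  rw [sq, ← mul_assoc]
  exact (le_abs_self _).trans h3

/-- The form of `Ĥ₀(p) - κ`. -/
def Coupling.quadSub (σ : Coupling) (p : Plane) (z w : Fin 2 → ℂ) : ℂ :=
  σ.quad p z w - σ.kappa * (star z ⬝ᵥ w)

/-- Near a minimum point there is a field of approximate eigenvectors for the lowest eigenvalue. -/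
theorem Coupling.exists_local_eigenvector (σ : Coupling) (hσ : σ.IsC2NearS) {p : Plane}
    (hp : p ∈ σ.S) : ∃ v : Plane → Fin 2 → ℂ, (∀ i, Measurable fun q => v q i) ∧
      (∀ q i, ‖v q i‖ ≤ 1) ∧ (∀ i, ContinuousAt (fun q => v q i) p) ∧ v p 0 = 1 ∧
      ∃ C δ : ℝ, 0 ≤ C ∧ 0 < δ ∧ ∀ q, ‖q - p‖ < δ →
        ‖σ.quadSub q (v q) (v q)‖ ≤ C * ‖q - p‖ ^ 2 := by
  have hpk : σ.lambdaMinus p = σ.kappa := hp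
  -- A zero of `A` in `S` gives `|p|² = κ ≤ λ₋(0) ≤ 0`, hence `p = 0` and `κ = 0`. The eigenvector
  -- field below need not be continuous there, but the constant spinor `(1, 0)` has energy exactly
  -- `|q|²`.
  by_cases hA : σ.A p = 0
  · have h0 : σ.lambdaMinus 0 ≤ 0 := by
      rw [lambdaMinus, norm_zero]
      linarith [norm_nonneg (σ.A 0), zero_pow (M₀ := ℝ) two_ne_zero]
    have h1 : ‖p‖ ^ 2 = σ.kappa := by
      rw [← hpk, lambdaMinus, hA, norm_zero, sub_zero]
    have h2 : ‖p‖ ^ 2 ≤ 0 := h1.trans_le ((σ.kappa_le 0).trans h0)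
    have hp0 : p = 0 := norm_eq_zero.mp
      ((pow_eq_zero_iff two_ne_zero).mp (le_antisymm h2 (sq_nonneg _)))
    have hκ : σ.kappa = 0 := by rw [← h1, hp0, norm_zero, zero_pow two_ne_zero]
    refine ⟨fun _ => ![1, 0], fun i => measurable_const, fun q i => ?_,
      fun i => continuousAt_const, rfl, 1, 1, zero_le_one, one_pos, fun q _ => ?_⟩
    · fin_cases i <;> simp
    · rw [quadSub, quad_eq, hκ, hp0]
      simp
  -- The eigenvector of `Ĥ₀(q)` for `λ₋(q)` wherever `A q ≠ 0`. Its squared norm is 2, whence the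
  -- constant `2 * C`.
  · set v : Plane → Fin 2 → ℂ := fun q => ![1, -(star (σ.A q) / (‖σ.A q‖ : ℂ))] with hv
    have hAm : Measurable σ.A := σ.continuous.measurable
    obtain ⟨U, hU, hSU, hUc⟩ := hσ
    have hc : ContDiffAt ℝ 2 σ.lambdaMinus p :=
      (contDiff_norm_sq ℝ).contDiffAt.sub (hUc.contDiffAt (hU.mem_nhds (hSU hp)))
    obtain ⟨C, δ, hC, hδ, hCδ⟩ := exists_le_sq_of_isLocalMin hc
      (Eventually.of_forall fun q => hpk.trans_le (σ.kappa_le q))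
    obtain ⟨δ', hδ', hAδ⟩ := Metric.eventually_nhds_iff.mp
      (σ.continuous.continuousAt.eventually_ne hA)
    refine ⟨v, fun i => ?_, fun q i => ?_, fun i => ?_, rfl, 2 * C, min δ δ', by positivity,
      lt_min hδ hδ', fun q hq => ?_⟩
    · fin_cases i
      · exact measurable_const
      · exact ((continuous_star.measurable.comp hAm).div
          (Complex.measurable_ofReal.comp hAm.norm)).neg
    · fin_cases i
      · simp [hv]
      · change ‖-(star (σ.A q) / (‖σ.A q‖ : ℂ))‖ ≤ 1
        rw [norm_neg, norm_div, norm_star, Complex.norm_real, norm_norm]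
        exact div_self_le_one _
    · fin_cases i
      · exact continuousAt_const
      · have h1 : ((‖σ.A p‖ : ℝ) : ℂ) ≠ 0 := Complex.ofReal_ne_zero.mpr (norm_ne_zero_iff.mpr hA)
        exact ((continuous_star.comp σ.continuous).continuousAt.div
          (Complex.continuous_ofReal.comp σ.continuous.norm).continuousAt h1).neg
    · have hAq : σ.A q ≠ 0 := hAδ (by rw [dist_eq_norm]; exact hq.trans_le (min_le_right _ _))
      have h1 : ((‖σ.A q‖ : ℝ) : ℂ) ≠ 0 := Complex.ofReal_ne_zero.mpr (norm_ne_zero_iff.mpr hAq)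
      have h2 : σ.A q * (starRingEnd ℂ) (σ.A q) = ((‖σ.A q‖ : ℝ) : ℂ) ^ 2 := Complex.mul_conj' _
      have h3 : σ.quadSub q (v q) (v q) = ((2 * (σ.lambdaMinus q - σ.kappa) : ℝ) : ℂ) := by
        have h6 : star (v q 1) = -(σ.A q / (‖σ.A q‖ : ℂ)) := by
          change star (-(star (σ.A q) / (‖σ.A q‖ : ℂ))) = _
          rw [star_neg, star_div₀, star_star, Complex.star_def, Complex.conj_ofReal]
        have h7 : v q 1 = -((starRingEnd ℂ) (σ.A q) / (‖σ.A q‖ : ℂ)) := rfl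
        have h8 : v q 0 = 1 := rfl
        rw [quadSub, quad_eq, lambdaMinus, dotProduct, Fin.sum_univ_two, Pi.star_apply,
          Pi.star_apply, h6, h7, h8, star_one]
        push_cast
        field_simp
        simp only [Complex.star_def]
        linear_combination (-2 * ((‖σ.A q‖ : ℝ) : ℂ) + ((‖q‖ : ℝ) : ℂ) ^ 2 - σ.kappa) * h2
      have h4 : 0 ≤ σ.lambdaMinus q - σ.kappa := sub_nonneg.mpr (σ.kappa_le q)
      have h5 := hCδ q (hq.trans_le (min_le_left _ _))
      rw [hpk] at h5
      rw [h3, Complex.norm_real, Real.norm_of_nonneg (by positivity)]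
      linarith

end SpinOrbit

/-- If the limit of a sequence of matrices is negative definite, so is one of the matrices. -/
theorem exists_forall_re_dotProduct_mulVec_neg {N : ℕ} {M : ℕ → Matrix (Fin N) (Fin N) ℂ}
    {L : Matrix (Fin N) (Fin N) ℂ} (hM : ∀ j k, Tendsto (fun n => M n j k) atTop (𝓝 (L j k)))
    (hL : ∀ c : Fin N → ℂ, c ≠ 0 → (star c ⬝ᵥ L.mulVec c).re < 0) :
    ∃ n, ∀ c : Fin N → ℂ, c ≠ 0 → (star c ⬝ᵥ (M n).mulVec c).re < 0 := by
  have hM' : Tendsto M atTop (𝓝 L) :=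
    tendsto_pi_nhds.mpr fun j => tendsto_pi_nhds.mpr fun k => hM j k
  have hcont : Continuous fun z : Matrix (Fin N) (Fin N) ℂ × (Fin N → ℂ) =>
      (star z.2 ⬝ᵥ z.1.mulVec z.2).re :=
    Complex.continuous_re.comp
      (continuous_snd.star.dotProduct (continuous_fst.matrix_mulVec continuous_snd))
  -- Compactness of the unit sphere makes the strict inequality stable under perturbation of the
  -- matrix, uniformly in `c`; homogeneity then covers all nonzero `c`.
  have hev : ∀ᶠ B in 𝓝 L, ∀ c ∈ Metric.sphere (0 : Fin N → ℂ) 1,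
      (star c ⬝ᵥ B.mulVec c).re < 0 :=
    (isCompact_sphere _ _).eventually_forall_of_forall_eventually fun c hc =>
      (hcont.tendsto (L, c)).eventually
        (gt_mem_nhds (hL c (ne_zero_of_mem_unit_sphere (⟨c, hc⟩ : Metric.sphere _ _))))
  obtain ⟨n, hn⟩ := (hM'.eventually hev).exists
  refine ⟨n, fun c hc => ?_⟩
  have hc0 : 0 < ‖c‖ := norm_pos_iff.mpr hc
  have h1 := hn (((‖c‖⁻¹ : ℝ) : ℂ) • c) (by
    rw [mem_sphere_zero_iff_norm, norm_smul, Complex.norm_real, norm_inv, norm_norm,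
      inv_mul_cancel₀ hc0.ne'])
  rw [star_smul, Matrix.mulVec_smul, smul_dotProduct, dotProduct_smul, Complex.star_def,
    Complex.conj_ofReal, smul_eq_mul, smul_eq_mul, Complex.re_ofReal_mul,
    Complex.re_ofReal_mul, ← mul_assoc] at h1
  exact neg_of_mul_neg_right h1 (by positivity)

/-! ### Trial spinors and their energy -/

namespace SpinOrbit

theorem IsLogBump.integrable_sq {ε : ℝ} {φ : Plane → ℝ} (h : IsLogBump ε φ) :
    Integrable fun ξ => ‖ξ‖ ^ 2 * φ ξ ^ 2 := by
  obtain ⟨C, hC⟩ := h.bounded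
  refine (h.integrable.const_mul (ε ^ 2 * C)).mono'
    ((measurable_norm.pow_const 2).mul (h.measurable.pow_const 2)).aestronglyMeasurable
    (Eventually.of_forall fun ξ => ?_)
  have h0 := h.nonneg ξ
  rw [Real.norm_of_nonneg (by positivity)]
  by_cases hξ : ε ≤ ‖ξ‖
  · rw [h.eq_zero ξ hξ]
    simp
  · have h1 : ‖ξ‖ ^ 2 ≤ ε ^ 2 := pow_le_pow_left₀ (norm_nonneg _) (not_le.mp hξ).le 2
    have h2 : φ ξ ^ 2 ≤ C * φ ξ := by
      rw [sq]
      exact mul_le_mul_of_nonneg_right (hC ξ) h0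
    calc _ ≤ ε ^ 2 * (C * φ ξ) := mul_le_mul h1 h2 (sq_nonneg _) (sq_nonneg _)
      _ = _ := by ring

namespace Coupling

variable (σ : Coupling)

theorem quadSub_zero_left (p : Plane) (w : Fin 2 → ℂ) : σ.quadSub p 0 w = 0 := by
  simp [quadSub, quad]

theorem quadSub_zero_right (p : Plane) (z : Fin 2 → ℂ) : σ.quadSub p z 0 = 0 := by
  simp [quadSub, quad]

theorem quadSub_smul (t : ℝ) (p : Plane) (z : Fin 2 → ℂ) :
    σ.quadSub p ((t : ℂ) • z) ((t : ℂ) • z) = ((t ^ 2 : ℝ) : ℂ) * σ.quadSub p z z := by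
  simp only [quadSub, quad, star_smul, Matrix.mulVec_smul, smul_dotProduct, dotProduct_smul,
    Complex.star_def, Complex.conj_ofReal, smul_eq_mul]
  push_cast
  ring

/-- Energy is measured from `κ`. The kinetic part is local in momentum and the `ν` part local in
position, so their limits can be taken separately. -/
theorem shiftedForm_neg_kappa (V : Perturbation) (u v : FormDomain) :
    shiftedForm σ V (-σ.kappa) u v =
      (∫ ξ, σ.quadSub ((2 * Real.pi) • ξ) (hat u.fn ξ) (hat v.fn ξ)) + V.form u.fn v.fn := by
  simp only [quadSub]
  rw [shiftedForm, form, inner_spinorIncl, form₀_eq, integral_sub (σ.integrable_quad _ _)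
    ((integrable_dotProduct_hat _ _).const_mul _), integral_const_mul]
  push_cast
  ring

/-- The energy of a concentrated field of approximate eigenvectors is small. -/
theorem norm_integral_quadSub_le {ε : ℝ} {φ : Plane → ℝ} (hφ : IsLogBump ε φ)
    {v : Plane → Fin 2 → ℂ} {p ξ₀ : Plane} (hξ₀ : (2 * Real.pi) • ξ₀ = p) {C δ : ℝ} (hC : 0 ≤ C)
    (hv : ∀ q, ‖q - p‖ < δ → ‖σ.quadSub q (v q) (v q)‖ ≤ C * ‖q - p‖ ^ 2)
    (hε : 2 * Real.pi * ε ≤ δ) :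
    ‖∫ ξ, σ.quadSub ((2 * Real.pi) • ξ) ((φ (ξ - ξ₀) : ℂ) • v ((2 * Real.pi) • ξ))
      ((φ (ξ - ξ₀) : ℂ) • v ((2 * Real.pi) • ξ))‖ ≤ C * (2 * Real.pi) ^ 2 * ε := by
  have hpi := Real.two_pi_pos
  have hi := (hφ.integrable_sq.comp_sub_right ξ₀).const_mul (C * (2 * Real.pi) ^ 2)
  calc _ ≤ ∫ ξ, C * (2 * Real.pi) ^ 2 * (‖ξ - ξ₀‖ ^ 2 * φ (ξ - ξ₀) ^ 2) := by
        refine norm_integral_le_of_norm_le hi (Eventually.of_forall fun ξ => ?_)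
        rw [quadSub_smul, norm_mul, Complex.norm_real, Real.norm_of_nonneg (sq_nonneg _)]
        by_cases hξ : ε ≤ ‖ξ - ξ₀‖
        · rw [hφ.eq_zero _ hξ]
          simp
        · have h1 : ‖(2 * Real.pi) • ξ - p‖ = 2 * Real.pi * ‖ξ - ξ₀‖ := by
            rw [← hξ₀, ← smul_sub, norm_smul, Real.norm_of_nonneg hpi.le]
          have h2 := hv ((2 * Real.pi) • ξ) (by
            rw [h1]
            exact (mul_lt_mul_of_pos_left (not_le.mp hξ) hpi).trans_le hε)
          rw [h1] at h2
          calc _ ≤ φ (ξ - ξ₀) ^ 2 * (C * (2 * Real.pi * ‖ξ - ξ₀‖) ^ 2) :=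
                mul_le_mul_of_nonneg_left h2 (sq_nonneg _)
            _ = _ := by ring
    _ ≤ _ := by
        rw [integral_const_mul, integral_sub_right_eq_self (fun ξ => ‖ξ‖ ^ 2 * φ ξ ^ 2) ξ₀]
        exact mul_le_mul_of_nonneg_left hφ.integral_sq_le (by positivity)

/-- Trial spinors concentrated at a minimum point in momentum space. In position space they
converge to a plane wave while their energy converges to `κ`. -/
theorem exists_trial_sequence (hσ : σ.IsC2NearS) {p : Plane} (hp : p ∈ σ.S) :
    ∃ (a : Fin 2 → ℂ) (u : ℕ → FormDomain), a 0 = 1 ∧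
      (∀ n : ℕ, ∀ᵐ ξ, 1 / ((n : ℝ) + 1) ≤ ‖ξ - (2 * Real.pi)⁻¹ • p‖ → hat (u n).fn ξ = 0) ∧
      Tendsto (fun n => ∫ ξ, σ.quadSub ((2 * Real.pi) • ξ) (hat (u n).fn ξ) (hat (u n).fn ξ))
        atTop (𝓝 0) ∧
      ∀ (V : Perturbation) (i : Fin 2),
        (∀ n, ∀ᵐ x ∂V.m, ‖J V.m ((u n).fn i) x‖ ≤ 1) ∧
        ∀ᵐ x ∂V.m, Tendsto (fun n => J V.m ((u n).fn i) x) atTop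
          (𝓝 (star (wave x ((2 * Real.pi)⁻¹ • p)) * a i)) := by
  obtain ⟨v, hvm, hvb, hvc, hv0, C, δ, hC, hδ, hCδ⟩ := σ.exists_local_eigenvector hσ hp
  have hpi := Real.two_pi_pos
  set ξ₀ := (2 * Real.pi)⁻¹ • p with hξ₀
  have hξp : (2 * Real.pi) • ξ₀ = p := smul_inv_smul₀ hpi.ne' p
  set ε : ℕ → ℝ := fun n => 1 / ((n : ℝ) + 1) with hεdef
  have hε0 : ∀ n, 0 < ε n := fun n => Nat.one_div_pos_of_nat
  have hε : Tendsto ε atTop (𝓝 0) := tendsto_one_div_add_atTop_nhds_zero_nat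
  choose φ hφ using fun n => exists_isLogBump (hε0 n)
  have hsm : Continuous fun ξ : Plane => (2 * Real.pi) • ξ := continuous_const_smul _
  have hGm : ∀ i, Measurable fun ξ : Plane => v ((2 * Real.pi) • ξ) i := fun i =>
    (hvm i).comp hsm.measurable
  have hex : ∀ n, ∃ u : FormDomain,
      (∀ᵐ ξ, hat u.fn ξ = (φ n (ξ - ξ₀) : ℂ) • v ((2 * Real.pi) • ξ)) ∧
      ∀ (V : Perturbation) (i : Fin 2), J V.m (u.fn i) =ᵐ[V.m] fun x =>
        ∫ ξ, star (wave x ξ) * ((φ n (ξ - ξ₀) : ℂ) • v ((2 * Real.pi) • ξ)) i := by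
    intro n
    obtain ⟨B, hB⟩ := (hφ n).bounded
    refine exists_packet (C := B) (R := ‖ξ₀‖ + ε n) (fun i => ?_) (fun ξ i => ?_) fun ξ hξ => ?_
    · exact (Complex.measurable_ofReal.comp
        ((hφ n).measurable.comp (measurable_id.sub_const ξ₀))).mul (hGm i)
    · rw [Pi.smul_apply, smul_eq_mul, norm_mul, Complex.norm_real,
        Real.norm_of_nonneg ((hφ n).nonneg _)]
      exact (mul_le_of_le_one_right ((hφ n).nonneg _) (hvb _ _)).trans (hB _)
    · rw [(hφ n).eq_zero _ (by linarith [norm_sub_norm_le ξ ξ₀]), Complex.ofReal_zero, zero_smul]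
  choose u hu1 hu2 using hex
  have hrw : ∀ (n : ℕ) (x : Plane) (i : Fin 2),
      (∫ ξ, star (wave x ξ) * ((φ n (ξ - ξ₀) : ℂ) • v ((2 * Real.pi) • ξ)) i) =
        ∫ ξ, (φ n (ξ - ξ₀) : ℂ) * (star (wave x ξ) * v ((2 * Real.pi) • ξ) i) := by
    intro n x i
    refine integral_congr_ae (Eventually.of_forall fun ξ => ?_)
    simp only [Pi.smul_apply, smul_eq_mul]
    ring
  have hbd : ∀ x ξ i, ‖star (wave x ξ) * v ((2 * Real.pi) • ξ) i‖ ≤ 1 := by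
    intro x ξ i
    rw [norm_mul, norm_star, norm_wave, one_mul]
    exact hvb _ _
  refine ⟨v p, u, hv0, fun n => ?_, ?_, fun V i => ⟨fun n => ?_, ?_⟩⟩
  · filter_upwards [hu1 n] with ξ hξ hle
    rw [hξ, (hφ n).eq_zero _ hle, Complex.ofReal_zero, zero_smul]
  · refine squeeze_zero_norm' (a := fun n => C * (2 * Real.pi) ^ 2 * ε n) ?_ ?_
    · have h1 : Tendsto (fun n => 2 * Real.pi * ε n) atTop (𝓝 0) := by
        simpa using hε.const_mul (2 * Real.pi)
      filter_upwards [h1.eventually (gt_mem_nhds hδ)] with n hn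
      refine le_of_eq_of_le (congrArg _ (integral_congr_ae ?_))
        (σ.norm_integral_quadSub_le (hφ n) hξp hC hCδ hn.le)
      filter_upwards [hu1 n] with ξ hξ
      rw [hξ]
    · simpa using hε.const_mul (C * (2 * Real.pi) ^ 2)
  · filter_upwards [hu2 n V i] with x hx
    rw [hx, hrw]
    exact (hφ n).norm_integral_le ξ₀ fun ξ _ => hbd x ξ i
  · filter_upwards [ae_all_iff.mpr fun n => hu2 n V i] with x hx
    simp only [hx, hrw]
    have hw : Continuous fun ξ => star (wave x ξ) :=
      (continuous_wave.comp (Continuous.prodMk_right x)).star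
    have h2 : ContinuousAt (fun ξ : Plane => v ((2 * Real.pi) • ξ) i) ξ₀ :=
      ContinuousAt.comp_of_eq (g := fun q => v q i) (f := fun ξ : Plane => (2 * Real.pi) • ξ)
        (hvc i) hsm.continuousAt hξp
    have h1 := IsLogBump.tendsto_integral hφ hε (p := ξ₀)
      (G := fun ξ => star (wave x ξ) * v ((2 * Real.pi) • ξ) i)
      (hw.measurable.mul (hGm i)) (fun ξ => hbd x ξ i)
      (hw.continuousAt.mul h2)
    rwa [hξp] at h1

end Coupling


/-! ### Counting eigenvalues with trial spinors -/

/-- The form of `ν` is continuous under bounded almost everywhere convergence. -/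
theorem Perturbation.tendsto_form (V : Perturbation) {u w : ℕ → FormDomain}
    {Φ Ψ : Plane → Fin 2 → ℂ} (hu : ∀ i n, ∀ᵐ x ∂V.m, ‖J V.m ((u n).fn i) x‖ ≤ 1)
    (hw : ∀ i n, ∀ᵐ x ∂V.m, ‖J V.m ((w n).fn i) x‖ ≤ 1)
    (hΦ : ∀ i, ∀ᵐ x ∂V.m, Tendsto (fun n => J V.m ((u n).fn i) x) atTop (𝓝 (Φ x i)))
    (hΨ : ∀ i, ∀ᵐ x ∂V.m, Tendsto (fun n => J V.m ((w n).fn i) x) atTop (𝓝 (Ψ x i))) :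
    Tendsto (fun n => V.form (u n).fn (w n).fn) atTop
      (𝓝 (∫ x, (V.h x : ℂ) * (star (Φ x) ⬝ᵥ Ψ x) ∂V.m)) := by
  refine tendsto_integral_of_dominated_convergence (fun x => |V.h x| * 2)
    (fun n => (V.integrable_form _ _).aestronglyMeasurable) (V.integrable_h.abs.mul_const 2)
    (fun n => ?_) ?_
  · filter_upwards [ae_all_iff.mpr fun i => hu i n, ae_all_iff.mpr fun i => hw i n] with x h1 h2
    rw [norm_mul, Complex.norm_real, Real.norm_eq_abs]
    refine mul_le_mul_of_nonneg_left ?_ (abs_nonneg _)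
    rw [dotProduct, Fin.sum_univ_two]
    have h3 : ∀ i, ‖star (J V.m ((u n).fn i) x) * J V.m ((w n).fn i) x‖ ≤ 1 := fun i => by
      rw [norm_mul, norm_star]
      exact mul_le_one₀ (h1 i) (norm_nonneg _) (h2 i)
    exact (norm_add_le _ _).trans ((add_le_add (h3 0) (h3 1)).trans_eq one_add_one_eq_two)
  · filter_upwards [ae_all_iff.mpr hΦ, ae_all_iff.mpr hΨ] with x h1 h2
    simp only [dotProduct, Pi.star_apply]
    exact (tendsto_finsetSum _ fun i _ => (h1 i).star.mul (h2 i)).const_mul _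

variable {σ : Coupling} {V : Perturbation}

/-- The limiting Gram matrix of the perturbation on plane waves is negative definite. -/
theorem Perturbation.re_gram_neg (hneg : V.nu ≤ 0) (hsupp : 0 < volume V.supp) {N : ℕ}
    {ξ : Fin N → Plane} (hξ : Function.Injective ξ) {a : Fin N → Fin 2 → ℂ} (ha : ∀ j, a j 0 = 1)
    {c : Fin N → ℂ} (hc : c ≠ 0) :
    (star c ⬝ᵥ (Matrix.of fun j k => ∫ x, (V.h x : ℂ) * (star (star (wave x (ξ j)) • a j) ⬝ᵥ
      (star (wave x (ξ k)) • a k)) ∂V.m : Matrix (Fin N) (Fin N) ℂ).mulVec c).re < 0 := by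
  set Ψ : Fin N → Plane → Fin 2 → ℂ := fun j x => star (wave x (ξ j)) • a j with hΨ
  set Φ : Plane → Fin 2 → ℂ := fun x => ∑ k, c k • Ψ k x with hΦ
  have hw : ∀ j, Continuous fun x => wave x (ξ j) := fun j => by
    unfold wave
    fun_prop
  have hwc : ∀ j, Continuous fun x => star (wave x (ξ j)) := fun j => (hw j).star
  have hint : ∀ j k, Integrable (fun x => (V.h x : ℂ) * (star (Ψ j x) ⬝ᵥ Ψ k x)) V.m := by
    intro j k
    have h1 : (fun x => star (Ψ j x) ⬝ᵥ Ψ k x) = fun x =>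
        wave x (ξ j) * star (wave x (ξ k)) * (star (a j) ⬝ᵥ a k) := by
      funext x
      simp only [hΨ, star_smul, star_star, smul_dotProduct, dotProduct_smul, smul_eq_mul]
      ring
    refine V.integrable_h.ofReal.mul_bdd (c := ‖star (a j) ⬝ᵥ a k‖) ?_
      (Eventually.of_forall fun x => ?_)
    · rw [h1]
      exact (((hw j).mul (hwc k)).mul continuous_const).aestronglyMeasurable
    · rw [congrFun h1 x, norm_mul, norm_mul, norm_star, norm_wave, norm_wave, one_mul, one_mul]
  have hsum : ∀ x, (V.h x : ℂ) * (star (Φ x) ⬝ᵥ Φ x) =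
      ∑ j, ∑ k, star (c j) * ((V.h x : ℂ) * (star (Ψ j x) ⬝ᵥ Ψ k x)) * c k := by
    intro x
    simp only [hΦ, star_sum, star_smul, sum_dotProduct, dotProduct_sum, smul_dotProduct,
      dotProduct_smul, Finset.mul_sum, smul_eq_mul]
    rw [Finset.sum_comm]
    refine Finset.sum_congr rfl fun j _ => Finset.sum_congr rfl fun k _ => ?_
    ring
  have hintΦ : Integrable (fun x => (V.h x : ℂ) * (star (Φ x) ⬝ᵥ Φ x)) V.m := by
    simp only [hsum]
    exact integrable_finsetSum _ fun j _ => integrable_finsetSum _ fun k _ =>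
      ((hint j k).const_mul _).mul_const _
  have heq : star c ⬝ᵥ (Matrix.of fun j k => ∫ x, (V.h x : ℂ) * (star (Ψ j x) ⬝ᵥ Ψ k x) ∂V.m :
      Matrix (Fin N) (Fin N) ℂ).mulVec c = ∫ x, (V.h x : ℂ) * (star (Φ x) ⬝ᵥ Φ x) ∂V.m := by
    simp only [hsum]
    rw [integral_finsetSum _ fun j _ => integrable_finsetSum _ fun k _ =>
      ((hint j k).const_mul _).mul_const _]
    refine Finset.sum_congr rfl fun j _ => ?_
    rw [integral_finsetSum _ fun k _ => ((hint j k).const_mul _).mul_const _, Pi.star_apply,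
      Matrix.mulVec, dotProduct, Finset.mul_sum]
    refine Finset.sum_congr rfl fun k _ => ?_
    rw [integral_mul_const, integral_const_mul, Matrix.of_apply, mul_assoc]
  have hre : ∀ x, ((V.h x : ℂ) * (star (Φ x) ⬝ᵥ Φ x)).re = V.h x * ∑ i, ‖Φ x i‖ ^ 2 := fun x => by
    rw [Complex.re_ofReal_mul, re_dotProduct_self]
  have hreint : (∫ x, (V.h x : ℂ) * (star (Φ x) ⬝ᵥ Φ x) ∂V.m).re =
      ∫ x, V.h x * ∑ i, ‖Φ x i‖ ^ 2 ∂V.m := by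
    simp only [← hre]
    exact (integral_re hintΦ).symm
  rw [heq, hreint]
  have hreI : Integrable (fun x => V.h x * ∑ i, ‖Φ x i‖ ^ 2) V.m := by
    simp only [← hre]
    exact hintΦ.re
  -- The integrand has a sign, so a nonnegative integral forces it to vanish: almost everywhere
  -- either `h = 0` or `Φ = 0`. Because `a j 0 = 1`, the first component of `Φ` is the trigonometric
  -- polynomial with coefficients `c`.
  by_contra! hcon
  have hnn : 0 ≤ᵐ[V.m] fun x => -(V.h x * ∑ i, ‖Φ x i‖ ^ 2) := by
    filter_upwards [V.h_nonpos hneg] with x hx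
    exact neg_nonneg.mpr (mul_nonpos_of_nonpos_of_nonneg hx
      (Finset.sum_nonneg fun i _ => sq_nonneg _))
  have h0 : ∫ x, -(V.h x * ∑ i, ‖Φ x i‖ ^ 2) ∂V.m = 0 := by
    refine le_antisymm ?_ (integral_nonneg_of_ae hnn)
    rw [integral_neg]
    linarith
  have hae := (integral_eq_zero_iff_of_nonneg_ae hnn hreI.neg).mp h0
  refine V.not_ae_mem_or_eq_zero hsupp
    (Z := {x : Plane | ∑ k, c k * star (wave x (ξ k)) = 0})
    (isClosed_eq (continuous_finsetSum _ fun k _ => continuous_const.mul (hwc k))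
      continuous_const) (volume_zeros_trigPolynomial hξ hc) ?_
  filter_upwards [hae] with x hx
  rcases mul_eq_zero.mp (neg_eq_zero.mp hx) with h1 | h1
  · exact Or.inr h1
  · left
    have h2 := (Finset.sum_eq_zero_iff_of_nonneg fun i _ => sq_nonneg _).mp h1 0 (Finset.mem_univ _)
    have h3 : Φ x 0 = 0 := norm_eq_zero.mp ((pow_eq_zero_iff two_ne_zero).mp h2)
    have h4 : Φ x 0 = ∑ k, (c k • Ψ k x) 0 := Finset.sum_apply _ _ _
    rw [h3] at h4
    refine (Finset.sum_congr rfl fun k _ => ?_).trans h4.symm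
    rw [Pi.smul_apply, hΨ]
    simp only [Pi.smul_apply, ha, smul_eq_mul, mul_one]

theorem shiftedForm_sum (σ : Coupling) (V : Perturbation) (t : ℝ) {N : ℕ} (u : Fin N → FormDomain)
    (c : Fin N → ℂ) : shiftedForm σ V t (∑ j, c j • u j) (∑ k, c k • u k) =
      star c ⬝ᵥ (Matrix.of fun j k => shiftedForm σ V t (u j) (u k) :
        Matrix (Fin N) (Fin N) ℂ).mulVec c := by
  rw [← shiftedFormL_apply, map_sum (shiftedFormL σ V t), sum_apply]
  refine Finset.sum_congr rfl fun j _ => ?_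
  rw [map_sum, Matrix.mulVec, dotProduct, Finset.mul_sum]
  refine Finset.sum_congr rfl fun k _ => ?_
  rw [shiftedFormL_apply, shiftedForm_smul_left, shiftedForm_smul_right, Matrix.of_apply,
    Pi.star_apply]
  ring

/-- Distinct minimum points give independent eigenvectors below `κ`. -/
theorem le_rank_of_mem_S (h : IsRelativelyBounded σ V) (hσ : σ.IsC2NearS) (hneg : V.nu ≤ 0)
    (hsupp : 0 < volume V.supp) {N : ℕ} {p : Fin N → Plane} (hp : ∀ j, p j ∈ σ.S)
    (hinj : Function.Injective p) :
    (N : Cardinal) ≤ Module.rank ℂ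
      (⨆ E ∈ Set.Iio σ.kappa, eigenspace (hamiltonian σ V) E : Submodule ℂ Spinor) := by
  choose a u ha hloc hE hJ using fun j => σ.exists_trial_sequence hσ (hp j)
  set ξ : Fin N → Plane := fun j => (2 * Real.pi)⁻¹ • p j with hξ
  have hξinj : Function.Injective ξ := (smul_right_injective Plane
    (inv_ne_zero Real.two_pi_pos.ne')).comp hinj
  have hlim : ∀ j k, Tendsto (fun n => shiftedForm σ V (-σ.kappa) (u j n) (u k n)) atTop
      (𝓝 (∫ x, (V.h x : ℂ) * (star (star (wave x (ξ j)) • a j) ⬝ᵥ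
        (star (wave x (ξ k)) • a k)) ∂V.m)) := by
    intro j k
    simp only [σ.shiftedForm_neg_kappa V]
    -- The kinetic entries tend to zero and the `ν` entries to the Gram matrix of plane waves.
    rw [← zero_add (∫ x, _ ∂V.m)]
    refine Tendsto.add ?_ (V.tendsto_form (fun i n => (hJ j V i).1 n) (fun i n => (hJ k V i).1 n)
      (fun i => (hJ j V i).2) (fun i => (hJ k V i).2))
    by_cases hjk : j = k
    · rw [hjk]
      exact hE k
    · have hd : 0 < ‖ξ j - ξ k‖ := norm_pos_iff.mpr (sub_ne_zero.mpr (hξinj.ne hjk))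
      refine tendsto_const_nhds.congr' ?_
      -- Once the radius is below half the distance of the two centres, the momentum supports are
      -- disjoint and the off-diagonal kinetic entry is exactly zero.
      filter_upwards [(tendsto_one_div_add_atTop_nhds_zero_nat (𝕜 := ℝ)).eventually
        (gt_mem_nhds (half_pos hd))] with n hn
      refine (integral_eq_zero_of_ae ?_).symm
      filter_upwards [hloc j n, hloc k n] with η h1 h2
      by_cases hη : 1 / ((n : ℝ) + 1) ≤ ‖η - ξ j‖
      · rw [h1 hη, σ.quadSub_zero_left]
        rfl
      · have h3 : ‖ξ j - ξ k‖ ≤ ‖η - ξ j‖ + ‖η - ξ k‖ := by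
          rw [show ξ j - ξ k = (η - ξ k) - (η - ξ j) by abel, add_comm]
          exact norm_sub_le _ _
        rw [h2 (by linarith [not_le.mp hη]), σ.quadSub_zero_right]
        rfl
  obtain ⟨n, hn⟩ := exists_forall_re_dotProduct_mulVec_neg
    (M := fun n => Matrix.of fun j k => shiftedForm σ V (-σ.kappa) (u j n) (u k n)) hlim
    fun c hc => V.re_gram_neg hneg hsupp hξinj ha hc
  refine le_rank_iSup_eigenspace_hamiltonian h
    (Fintype.linearCombination ℂ fun j => u j n) fun c hc => ?_
  have h1 := hn c hc
  rw [← shiftedForm_sum, ← Fintype.linearCombination_apply ℂ (fun j => u j n) c] at h1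
  set w := Fintype.linearCombination ℂ (fun j => u j n) c with hw
  have h2 : (inner ℂ (spinorIncl w.fn) (spinorIncl w.fn)).re = ‖formIncl w‖ ^ 2 :=
    inner_self_eq_norm_sq (𝕜 := ℂ) (formIncl w)
  rw [shiftedForm, Complex.add_re, Complex.re_ofReal_mul, h2] at h1
  linarith

/-- There are at least `#S` eigenvalues below `κ`. -/
theorem encard_S_le_countBelow (h : IsRelativelyBounded σ V) (hσ : σ.IsC2NearS) (hneg : V.nu ≤ 0)
    (hsupp : 0 < volume V.supp) : σ.S.encard ≤ countBelow (hamiltonian σ V) σ.kappa := by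
  -- Comparing with every natural number below `#S` treats finite and infinite `S` together.
  refine ENat.forall_natCast_le_iff_le.mp fun N hN => ?_
  obtain ⟨t, htS, ht⟩ := Set.exists_subset_encard_eq hN
  have hfin : t.Finite := Set.finite_of_encard_eq_coe ht
  have hcard : hfin.toFinset.card = N := by
    rw [hfin.encard_eq_coe_toFinset_card] at ht
    exact_mod_cast ht
  have h1 := le_rank_of_mem_S h hσ hneg hsupp
    (p := fun j : Fin N => ((hfin.toFinset.equivFinOfCardEq hcard).symm j : Plane))
    (fun j => htS (hfin.mem_toFinset.mp ((hfin.toFinset.equivFinOfCardEq hcard).symm j).2))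
    (Subtype.val_injective.comp (Equiv.injective _))
  have h2 := OrderHomClass.mono Cardinal.toENat h1
  rwa [Cardinal.toENat_nat] at h2

/-- Finitely many eigenvalues, each of finite multiplicity, would span a finite-dimensional space,
whereas the count with multiplicity is infinite. -/
theorem infinite_eigenvaluesBelow (h : IsRelativelyBounded σ V) (hσ : σ.IsC2NearS)
    (hneg : V.nu ≤ 0) (hsupp : 0 < volume V.supp) (hS : σ.S.Infinite) :
    (eigenvaluesBelow (hamiltonian σ V) σ.kappa).Infinite := by
  intro hfin
  set W : Submodule ℂ Spinor :=
    ⨆ E ∈ eigenvaluesBelow (hamiltonian σ V) σ.kappa, eigenspace (hamiltonian σ V) E with hW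
  have hWfin : FiniteDimensional ℂ W := by
    have : Finite (eigenvaluesBelow (hamiltonian σ V) σ.kappa) := hfin
    have : ∀ E : eigenvaluesBelow (hamiltonian σ V) σ.kappa,
        FiniteDimensional ℂ (eigenspace (hamiltonian σ V) E) := fun E =>
      finiteDimensional_eigenspace h E.2.1
    rw [hW, iSup_subtype']
    infer_instance
  have hle : (⨆ E ∈ Set.Iio σ.kappa, eigenspace (hamiltonian σ V) E) ≤ W := by
    refine iSup₂_le fun E hE => ?_
    by_cases h0 : eigenspace (hamiltonian σ V) E = ⊥
    · rw [h0]
      exact bot_le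
    · exact le_iSup₂_of_le E ⟨hE, h0⟩ le_rfl
  have h1 := encard_S_le_countBelow h hσ hneg hsupp
  rw [hS.encard_eq, top_le_iff, countBelow, Cardinal.toENat_eq_top] at h1
  exact absurd (h1.trans (Submodule.rank_mono hle)) (not_le.mpr (Module.rank_lt_aleph0 ℂ W))


/-! ### Couplings of linear modulus -/

namespace Perturbation

variable (V : Perturbation)

/-- The form bound on Schwartz functions extends to `H¹`. -/
theorem exists_abs_integral_le : ∃ a b : ℝ, 0 < a ∧ a < 1 ∧ ∀ f : H1,
    2 * |∫ x, V.h x * ‖J V.m f x‖ ^ 2 ∂V.m| ≤ a * ‖f‖ ^ 2 + b * ‖H1.toL2 f‖ ^ 2 := by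
  obtain ⟨a, b, ha, ha1, hb, hab⟩ := V.form_bound
  obtain ⟨C, hC⟩ := V.bounded
  refine ⟨a, b, ha, ha1, fun f => ?_⟩
  have hmem : MemLp (fun x => (V.h x : ℂ)) ∞ V.m :=
    memLp_top_of_bound (Complex.measurable_ofReal.comp V.measurable).aestronglyMeasurable C
      (Eventually.of_forall fun x => by simpa using hC x)
  -- Writing the integral as `⟨J f, M (J f)⟩` with `M` multiplication by `h` makes the inequality a
  -- closed condition on `f ∈ H¹`, so density of Schwartz functions applies.
  set M : Lp (α := Plane) ℂ 2 V.m →L[ℂ] Lp (α := Plane) ℂ 2 V.m :=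
    (ContinuousLinearMap.mul ℂ ℂ).holderL V.m ∞ 2 2 (hmem.toLp _) with hM
  have hMc : ∀ g, M g =ᵐ[V.m] fun x => (V.h x : ℂ) * g x := fun g => by
    filter_upwards [(ContinuousLinearMap.mul ℂ ℂ).coeFn_holder (r := 2) (hmem.toLp _) g,
      hmem.coeFn_toLp] with x h1 h2
    change ((ContinuousLinearMap.mul ℂ ℂ).holder 2 (hmem.toLp _) g) x = _
    rw [h1, h2]
    rfl
  have hMi : ∀ g : Lp (α := Plane) ℂ 2 V.m,
      (inner ℂ g (M g)).re = ∫ x, V.h x * ‖g x‖ ^ 2 ∂V.m := fun g => by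
    rw [L2.inner_def]
    refine (integral_re (L2.integrable_inner (𝕜 := ℂ) g (M g))).symm.trans (integral_congr_ae ?_)
    filter_upwards [hMc g] with x hx
    rw [hx, RCLike.inner_apply, mul_assoc, Complex.mul_conj', RCLike.re_eq_complex_re]
    norm_cast
  have hint : ∀ (μ : Measure Plane) [μ.HasTemperateGrowth] (g : 𝓢(Plane, ℂ)),
      Integrable (fun x => ‖g x‖ ^ 2) μ := fun μ _ g =>
    (memLp_two_iff_integrable_sq_norm g.continuous.aestronglyMeasurable).mp (g.memLp 2 μ)
  have hsq : ∀ (μ : Measure Plane) [μ.HasTemperateGrowth] (g : 𝓢(Plane, ℂ)),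
      ‖g.toLp 2 μ‖ ^ 2 = ∫ x, ‖g x‖ ^ 2 ∂μ := fun μ _ g => by
    rw [L2_norm_sq]
    exact integral_congr_ae ((g.coeFn_toLp 2 μ).mono fun x hx => by simp only [hx])
  simp only [← hMi]
  refine denseRange_schwartzToH1.induction_on
    (p := fun f => 2 * |(inner ℂ (J V.m f) (M (J V.m f))).re| ≤
      a * ‖f‖ ^ 2 + b * ‖H1.toL2 f‖ ^ 2) f ?_ fun φ => ?_
  · have hc1 : Continuous fun f : H1 => (inner ℂ (J V.m f) (M (J V.m f))).re :=
      Complex.continuous_re.comp ((J V.m).continuous.inner (M.continuous.comp (J V.m).continuous))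
    have hc2 : Continuous fun f : H1 => H1.toL2 f := H1.toL2L.continuous
    exact isClosed_le (continuous_const.mul hc1.abs)
      ((continuous_const.mul (continuous_norm.pow 2)).add (continuous_const.mul (hc2.norm.pow 2)))
  · have hH : ‖schwartzToH1 φ‖ ^ 2 =
        (∫ x, ‖φ x‖ ^ 2) + ∫ x, ∑ i : Fin 2, ‖(∂_{e i} φ : 𝓢(Plane, ℂ)) x‖ ^ 2 := by
      rw [integral_finsetSum _ fun i _ => hint _ _,
        show ‖schwartzToH1 φ‖ = ‖(schwartzToH1 φ).1‖ from rfl,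
        WithLp.prod_norm_sq_eq_of_L2, PiLp.norm_sq_eq_of_L2]
      simp only [← hsq]
      rfl
    have hL : ‖H1.toL2 (schwartzToH1 φ)‖ ^ 2 = ∫ x, ‖φ x‖ ^ 2 := hsq volume φ
    have hJ : ∫ x, V.h x * ‖J V.m (schwartzToH1 φ) x‖ ^ 2 ∂V.m = ∫ x, V.h x * ‖φ x‖ ^ 2 ∂V.m := by
      rw [V.J_schwartz]
      exact integral_congr_ae ((φ.coeFn_toLp 2 V.m).mono fun x hx => by simp only [hx])
    have hI : Integrable (fun x => (1 + |V.h x| ^ 2) * ‖φ x‖ ^ 2) V.m := by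
      refine (hint V.m φ).bdd_mul (c := 1 + C ^ 2) ?_ (Eventually.of_forall fun x => ?_)
      · exact ((V.measurable.abs.pow_const 2).const_add 1).aestronglyMeasurable
      · rw [Real.norm_of_nonneg (by positivity)]
        gcongr
        exact hC x
    have h1 : |∫ x, V.h x * ‖φ x‖ ^ 2 ∂V.m| ≤
        ∫ x, 2⁻¹ * ((1 + |V.h x| ^ 2) * ‖φ x‖ ^ 2) ∂V.m := by
      rw [← Real.norm_eq_abs]
      refine norm_integral_le_of_norm_le (hI.const_mul _) (Eventually.of_forall fun x => ?_)
      rw [norm_mul, Real.norm_of_nonneg (sq_nonneg ‖φ x‖), ← mul_assoc, Real.norm_eq_abs]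
      refine mul_le_mul_of_nonneg_right ?_ (sq_nonneg _)
      -- `2 |h| ≤ 1 + h²`: the source of the factor 2 in the statement.
      nlinarith [sq_nonneg (|V.h x| - 1)]
    have h2 : 0 ≤ ∫ x, ‖φ x‖ ^ 2 := integral_nonneg fun x => by positivity
    rw [integral_const_mul] at h1
    rw [hMi, hJ, hH, hL]
    nlinarith [hab φ, mul_nonneg ha.le h2]

end Perturbation

namespace Coupling

variable {σ : Coupling} {c : ℝ}

theorem lambdaMinus_eq_of_linear (hA : ∀ p, ‖σ.A p‖ = c * ‖p‖) (p : Plane) :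
    σ.lambdaMinus p = (‖p‖ - c / 2) ^ 2 - c ^ 2 / 4 := by
  rw [lambdaMinus, hA]
  ring

/-- Completing the square, `λ₋(p) = (|p| - c / 2)² - c² / 4`, shows that the minimum is attained
exactly on a circle. -/
theorem mem_S_of_linear (hc : 0 < c) (hA : ∀ p, ‖σ.A p‖ = c * ‖p‖) {p : Plane} :
    p ∈ σ.S ↔ ‖p‖ = c / 2 := by
  have hκ : σ.kappa = -(c ^ 2 / 4) := by
    refine le_antisymm ?_ (le_ciInf fun q => ?_)
    · have h1 := σ.kappa_le ((c / 2) • e 0)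
      rw [lambdaMinus_eq_of_linear hA, norm_smul, PiLp.norm_single, norm_one, mul_one,
        Real.norm_of_nonneg (by positivity)] at h1
      linarith
    · rw [lambdaMinus_eq_of_linear hA]
      linarith [sq_nonneg (‖q‖ - c / 2)]
  change σ.lambdaMinus p = σ.kappa ↔ _
  rw [hκ, lambdaMinus_eq_of_linear hA, sub_eq_add_neg, add_eq_right, sq_eq_zero_iff, sub_eq_zero]

theorem infinite_S_of_linear (hc : 0 < c) (hA : ∀ p, ‖σ.A p‖ = c * ‖p‖) : σ.S.Infinite := by
  -- A quarter of the circle, parametrised by its first coordinate.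
  refine Set.infinite_of_injOn_mapsTo (s := Set.Icc 0 (c / 2))
    (f := fun t => (!₂[t, √((c / 2) ^ 2 - t ^ 2)] : Plane)) ?_ (fun t ht => ?_)
    (Set.Icc_infinite (by positivity))
  · intro s _ t _ hst
    have h1 := congrArg (fun p : Plane => p 0) hst
    simpa using h1
  · have h1 : 0 ≤ (c / 2) ^ 2 - t ^ 2 := sub_nonneg.mpr (pow_le_pow_left₀ ht.1 ht.2 2)
    rw [mem_S_of_linear hc hA, EuclideanSpace.norm_eq, Real.sqrt_eq_iff_mul_self_eq (by positivity)
      (by positivity)]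
    simp [Fin.sum_univ_two, Real.sq_sqrt h1]
    ring

/-- The norm is smooth away from the origin, and the circle of minimum points avoids it. -/
theorem isC2NearS_of_linear (hc : 0 < c) (hA : ∀ p, ‖σ.A p‖ = c * ‖p‖) : σ.IsC2NearS := by
  refine ⟨{0}ᶜ, isOpen_compl_singleton, fun p hp hp0 => ?_, fun p hp => ?_⟩
  · rw [mem_S_of_linear hc hA, Set.mem_singleton_iff.mp hp0, norm_zero] at hp
    linarith
  · simp only [hA]
    exact (contDiffAt_const.mul (contDiffAt_norm ℝ hp)).contDiffWithinAt

/-- The form of `ν` is at most `a / 2` times the squared `H¹` norm up to `L²` terms, and half of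
that norm is dominated by `q₀` plus `L²` terms. The relative bound is therefore the constant `a < 1`
of the perturbation. -/
theorem isRelativelyBounded_of_linear (hA : ∀ p, ‖σ.A p‖ = c * ‖p‖) (V : Perturbation) :
    IsRelativelyBounded σ V := by
  obtain ⟨a, b, ha, ha1, hab⟩ := V.exists_abs_integral_le
  refine ⟨a, a * (c ^ 2 / 2 + 1) + b / 2, ha1, fun u => ?_⟩
  -- `c |p| ≤ |p|² / 2 + c² / 2`. The value `θ = 1 / 2` matches the factor 2 gained in
  -- `Perturbation.exists_abs_integral_le`.
  have h1 := σ.le_re_form₀ (θ := 1 / 2) (C := c ^ 2 / 2) (by norm_num) (fun p => by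
    rw [hA]
    linarith [sq_nonneg (‖p‖ - c)]) u
  have hint : ∀ i, Integrable (fun x => V.h x * ‖J V.m (u i) x‖ ^ 2) V.m := fun i => by
    obtain ⟨C, hC⟩ := V.bounded
    exact (L2_integrable_sq (J V.m (u i))).bdd_mul (c := C) V.measurable.aestronglyMeasurable
      (Eventually.of_forall hC)
  have h2 : V.form u u = ((∑ i, ∫ x, V.h x * ‖J V.m (u i) x‖ ^ 2 ∂V.m : ℝ) : ℂ) := by
    rw [← integral_finsetSum _ fun i _ => hint i, ← integral_complex_ofReal]
    refine integral_congr_ae (Eventually.of_forall fun x => ?_)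
    simp only [dotProduct, Pi.star_apply, Complex.star_def, Complex.conj_mul']
    push_cast
    rw [Finset.mul_sum]
  have h3 : ‖V.form u u‖ ≤ ∑ i, (a * ‖u i‖ ^ 2 + b * ‖H1.toL2 (u i)‖ ^ 2) / 2 := by
    rw [h2, Complex.norm_real]
    refine (norm_sum_le _ _).trans (Finset.sum_le_sum fun i _ => ?_)
    have := hab (u i)
    rw [Real.norm_eq_abs]
    linarith
  rw [← Finset.sum_div, Finset.sum_add_distrib, ← Finset.mul_sum, ← Finset.mul_sum,
    ← norm_spinorIncl_sq] at h3
  nlinarith [mul_le_mul_of_nonneg_left h1 ha.le]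

end Coupling

theorem infinite_eigenvaluesBelow_of_linear {σ : Coupling} {V : Perturbation} {c : ℝ} (hc : 0 < c)
    (hA : ∀ p, ‖σ.A p‖ = c * ‖p‖) (hneg : V.nu ≤ 0) (hsupp : 0 < volume V.supp) :
    (eigenvaluesBelow (hamiltonian σ V) σ.kappa).Infinite :=
  infinite_eigenvaluesBelow (Coupling.isRelativelyBounded_of_linear hA V)
    (Coupling.isC2NearS_of_linear hc hA) hneg hsupp (Coupling.infinite_S_of_linear hc hA)

theorem norm_rashba (α : ℝ) (p : Plane) : ‖(rashba α).A p‖ = |α| * ‖p‖ := by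
  change ‖(α : ℂ) * (p 1 + Complex.I * p 0)‖ = _
  rw [norm_mul, Complex.norm_real, Real.norm_eq_abs, mul_comm Complex.I, Complex.norm_add_mul_I,
    EuclideanSpace.norm_eq, Fin.sum_univ_two, Real.norm_eq_abs, Real.norm_eq_abs, sq_abs, sq_abs,
    add_comm]

theorem norm_dresselhaus (α : ℝ) (p : Plane) : ‖(dresselhaus α).A p‖ = |α| * ‖p‖ := by
  change ‖-(α : ℂ) * (p 0 + Complex.I * p 1)‖ = _
  rw [norm_mul, norm_neg, Complex.norm_real, Real.norm_eq_abs, mul_comm Complex.I,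
    Complex.norm_add_mul_I, EuclideanSpace.norm_eq, Fin.sum_univ_two, Real.norm_eq_abs,
    Real.norm_eq_abs, sq_abs, sq_abs]

end SpinOrbit

end

theorem corollary1 (V : SpinOrbit.Perturbation) (hneg : V.nu ≤ 0)
    (hsupp : 0 < MeasureTheory.volume V.supp) :
    (∀ σ : SpinOrbit.Coupling, σ.IsC2NearS → SpinOrbit.IsRelativelyBounded σ V →
      σ.S.encard ≤ SpinOrbit.countBelow (SpinOrbit.hamiltonian σ V) σ.kappa ∧
      (σ.S.Infinite →
        (SpinOrbit.eigenvaluesBelow (SpinOrbit.hamiltonian σ V) σ.kappa).Infinite)) ∧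
    (∀ α : ℝ, α ≠ 0 →
      (SpinOrbit.eigenvaluesBelow (SpinOrbit.hamiltonian (SpinOrbit.rashba α) V)
        (SpinOrbit.rashba α).kappa).Infinite ∧
      (SpinOrbit.eigenvaluesBelow (SpinOrbit.hamiltonian (SpinOrbit.dresselhaus α) V)
        (SpinOrbit.dresselhaus α).kappa).Infinite) :=
  ⟨fun _ hσ h => ⟨SpinOrbit.encard_S_le_countBelow h hσ hneg hsupp,
    SpinOrbit.infinite_eigenvaluesBelow h hσ hneg hsupp⟩,
  fun α hα =>
    ⟨SpinOrbit.infinite_eigenvaluesBelow_of_linear (abs_pos.mpr hα) (SpinOrbit.norm_rashba α)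
      hneg hsupp,
    SpinOrbit.infinite_eigenvaluesBelow_of_linear (abs_pos.mpr hα) (SpinOrbit.norm_dresselhaus α)
      hneg hsupp⟩⟩
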